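/- **Setting.** Let $n\ge 1$, let $J_0(x,y)=(-y,x)$ on $\mathbb R^{2n}$ and $\omega_0(u,v)=J_0u\cdot v$. Let $\Omega\subset\mathbb R^{2n}$ be a uniformly convex domain, that is, a non-empty set $\{f<c\}$ where $f:\mathbb R^{2n}\to\mathbb R$ is smooth, coercive and has everywhere positive definite second differential. Let $\mathrm{Symp}_0(\overline\Omega)$ be the identity component, in the $C^\infty$ topology, of the group of symplectomorphisms of $\overline\Omega$ (diffeomorphisms, smooth up to the boundary, that preserve $\omega_0$). Let $\mathcal H^+(\overline\Omega)$ be the set of $H\in C^\infty(\overline\Omega)$ that are constant on each leaf of the characteristic foliation of $\partial\Omega$ and have positive definite Hessian $\nabla^2H(z)$ for every $z\in\overline\Omega$, and put $$\mathcal G(H)=\frac1{\mathrm{vol}(\Omega)}\int_\Omega(\det\nabla^2H(z))^{\frac1{2n}}\,dz .$$ A path $\phi=\{\phi^t\}_{t\in[0,1]}$ in $\mathrm{Symp}_0(\overline\Omega)$ is *positive* if there are $H_t\in\mathcal H^+(\overline\Omega)$, all of whose space derivatives are continuous in $(t,z)\in[0,1]\times\overline\Omega$, with $\frac{d}{dt}\phi^t=J_0\nabla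 H_t(\phi^t)$ on $\overline\Omega$ for all $t\in[0,1]$; its length is $\mathrm{length}_{\mathcal G}(\phi)=\int_0^1\mathcal G(H_t)\,dt$. For $W\in\mathrm{Sp}(2n)$ let $$\upsilon(W)=(-1)^m\prod_{\lambda\in\sigma(W),\,|\lambda|=1,\,\lambda\ne\pm1}\lambda^{p(\lambda)},$$ where $2m$ is the total algebraic multiplicity of the real negative eigenvalues of $W$ and $p(\lambda)$ is the maximal dimension of a subspace of the algebraic eigenspace of $\lambda$ in $\mathbb C^{2n}$ on which the Krein form $\kappa(w,w')=\langle -iJ_0w,w'\rangle$ is positive definite. For a path $w:[0,1]\to\mathrm{Sp}(2n)$ with $w(0)=\mathrm{id}$, let $\mu([w])=\theta(1)$, where $\theta:[0,1]\to\mathbb R$ is continuous with $\theta(0)=0$ and $\upsilon(w(t))=e^{2\pi i\theta(t)}$ for all $t$ (the homogeneous Maslov quasimorphism). For the homotopy class $\tilde\phi$ of a path $\phi$ in $\mathrm{Symp}_0(\overline\Omega)$ with $\phi^0=\mathrm{id}$, let $$\mathcal M(\tilde\phi)=\frac1{\mathrm{vol}(\Omega)}\int_\Omega\mu\bigl([\{d\phi^t(z)\}_{t\in[0,1]}]\bigr)\,dz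 .$$ **Theorem.** Let $\phi$ be a positive path in $\mathrm{Symp}_0(\overline\Omega)$ with $\phi^0=\mathrm{id}$ and such that $d\phi^t(z)$ does not have the eigenvalue $-1$ for every $z\in\overline\Omega$ and $t\in[0,1]$. Let $\psi$ be any positive path in $\mathrm{Symp}_0(\overline\Omega)$ that is homotopic to $\phi$ with fixed ends. Then $d\psi^t(z)$ does not have the eigenvalue $-1$ for every $z\in\overline\Omega$ and $t\in[0,1]$, and $$\mathrm{length}_{\mathcal G}(\psi)\le\frac{2\pi}{n}\,\mathcal M(\tilde\phi).$$ -/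

import Mathlib

open Set Filter Topology MeasureTheory
open scoped ContDiff Matrix unitInterval

noncomputable section

namespace ConvexSymp

/-- The phase space `ℝ²ⁿ`, with coordinates `(x, y)`. Only its vector space structure, its
topology, its Lebesgue measure and the matrices of linear maps in the standard basis are used. -/
abbrev PhaseSpace (n : ℕ) : Type := Fin n ⊕ Fin n → ℝ

variable {n : ℕ}

/-- The standard complex structure `J₀ (x, y) = (-y, x)` as a matrix. -/
abbrev J₀ (n : ℕ) : Matrix (Fin n ⊕ Fin n) (Fin n ⊕ Fin n) ℝ := Matrix.J (Fin n) ℝ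

/-- The standard symplectic form `ω₀(u, v) = J₀ u ⬝ v`. -/
def ω₀ (u v : PhaseSpace n) : ℝ := (J₀ n *ᵥ u) ⬝ᵥ v

/-- The linear symplectic group `Sp(2n)`, as matrices. -/
abbrev Sp (n : ℕ) : Type := Matrix.symplecticGroup (Fin n) ℝ

/-! ### Derivatives of functions on a set -/

/-- The second differential of `f` on the set `s`, as a bilinear form. -/
def secondDiff (s : Set (PhaseSpace n)) (f : PhaseSpace n → ℝ) (z : PhaseSpace n) :
    PhaseSpace n →L[ℝ] PhaseSpace n →L[ℝ] ℝ :=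
  fderivWithin ℝ (fderivWithin ℝ f s) s z

/-- The gradient `∇f`. -/
def grad (s : Set (PhaseSpace n)) (f : PhaseSpace n → ℝ) (z : PhaseSpace n) : PhaseSpace n :=
  fun i => fderivWithin ℝ f s z (Pi.single i 1)

/-- The Hessian matrix `∇²f`. -/
def hessian (s : Set (PhaseSpace n)) (f : PhaseSpace n → ℝ) (z : PhaseSpace n) :
    Matrix (Fin n ⊕ Fin n) (Fin n ⊕ Fin n) ℝ :=
  Matrix.of fun i j => secondDiff s f z (Pi.single i 1) (Pi.single j 1)

/-! ### Uniformly convex domains -/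

/-- A uniformly convex domain: a non-empty open sublevel of a coercive smooth function on `ℝ²ⁿ`
with everywhere positive definite second differential. -/
structure UniformlyConvexDomain (n : ℕ) where
  carrier : Set (PhaseSpace n)
  nonempty : carrier.Nonempty
  exists_function : ∃ (f : PhaseSpace n → ℝ) (c : ℝ), ContDiff ℝ ∞ f ∧
    Tendsto f (cocompact (PhaseSpace n)) atTop ∧
    (∀ z v, v ≠ 0 → 0 < secondDiff univ f z v v) ∧
    carrier = {z | f z < c}

/-- The closure `Ω̄`. -/
def UniformlyConvexDomain.cl (Ω : UniformlyConvexDomain n) : Set (PhaseSpace n) :=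
  closure Ω.carrier

theorem UniformlyConvexDomain.isOpen (Ω : UniformlyConvexDomain n) : IsOpen Ω.carrier := by
  obtain ⟨f, c, hf, -, -, h⟩ := Ω.exists_function
  rw [h]
  exact isOpen_lt hf.continuous continuous_const

theorem UniformlyConvexDomain.convex (Ω : UniformlyConvexDomain n) : Convex ℝ Ω.carrier := by
  obtain ⟨f, c, hf, -, hpos, h⟩ := Ω.exists_function
  have hf1 : Differentiable ℝ f := hf.differentiable (by simp)
  have hf2 : Differentiable ℝ (fderiv ℝ f) :=
    (hf.fderiv_right (m := 1) (by norm_cast)).differentiable (by simp)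
  have key : ConvexOn ℝ univ f := by
    refine ⟨convex_univ, fun x _ y _ a b ha hb hab => ?_⟩
    set v := y - x
    have hl : ∀ t : ℝ, HasDerivAt (fun t : ℝ => x + t • v) v t := fun t => by
      simpa using ((hasDerivAt_id t).smul_const v).const_add x
    have h1 : ∀ t : ℝ, HasDerivAt (fun t : ℝ => f (x + t • v)) (fderiv ℝ f (x + t • v) v) t :=
      fun t => (hf1 _).hasFDerivAt.comp_hasDerivAt t (hl t)
    have h2 : ∀ t : ℝ, HasDerivAt (fun t : ℝ => fderiv ℝ f (x + t • v) v)
        (fderiv ℝ (fderiv ℝ f) (x + t • v) v v) t := fun t => by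
      have := (hf2 (x + t • v)).hasFDerivAt.comp_hasDerivAt t (hl t)
      exact this.clm_apply (hasDerivAt_const t v) |>.congr_deriv (by simp)
    have hd : deriv (fun t : ℝ => f (x + t • v)) = fun t => fderiv ℝ f (x + t • v) v :=
      funext fun t => (h1 t).deriv
    have hconv : ConvexOn ℝ univ (fun t : ℝ => f (x + t • v)) := by
      refine convexOn_of_deriv2_nonneg' convex_univ
        (fun t _ => (h1 t).differentiableAt.differentiableWithinAt)
        (fun t _ => by rw [hd]; exact (h2 t).differentiableAt.differentiableWithinAt)
        (fun t _ => ?_)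
      have : deriv^[2] (fun t : ℝ => f (x + t • v)) t
          = fderiv ℝ (fderiv ℝ f) (x + t • v) v v := by
        simp only [Function.iterate_succ, Function.iterate_zero, Function.comp_apply, id]
        rw [hd, (h2 t).deriv]
      rw [this]
      rcases eq_or_ne v 0 with hv | hv
      · simp [hv]
      · have := hpos (x + t • v) v hv
        simp only [secondDiff, fderivWithin_univ] at this
        exact this.le
    have := hconv.2 (mem_univ (0 : ℝ)) (mem_univ (1 : ℝ)) ha hb hab
    have e : a • x + b • y = x + (a • (0 : ℝ) + b • (1 : ℝ)) • v := by
      have : a = 1 - b := by linarith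
      subst this
      simp only [v, smul_eq_mul, mul_zero, mul_one, zero_add]
      module
    rw [e]
    simpa [v] using this
  rw [h]
  simpa using key.convex_lt c

theorem UniformlyConvexDomain.uniqueDiffOn (Ω : UniformlyConvexDomain n) :
    UniqueDiffOn ℝ Ω.cl := by
  refine uniqueDiffOn_convex Ω.convex.closure ?_
  exact (Ω.nonempty.mono (interior_maximal subset_closure Ω.isOpen))

/-! ### The group of symplectomorphisms of `Ω̄` -/

open Classical in
/-- A self-map of a set `s`, seen as a map between the ambient spaces (its values outside of `s`
are irrelevant in what follows). -/
def extendMap {s : Set (PhaseSpace n)} (g : s → s) (z : PhaseSpace n) : PhaseSpace n :=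
  if h : z ∈ s then (g ⟨z, h⟩ : PhaseSpace n) else z

/-- A symplectomorphism of `Ω̄`: a smooth diffeomorphism of `Ω̄` (smooth up to the boundary, with
its inverse) whose differential at every point of `Ω̄` is a linear symplectomorphism. -/
structure Symp (Ω : UniformlyConvexDomain n) where
  toEquiv : Ω.cl ≃ Ω.cl
  contDiffOn : ContDiffOn ℝ ∞ (extendMap toEquiv) Ω.cl
  contDiffOn_symm : ContDiffOn ℝ ∞ (extendMap toEquiv.symm) Ω.cl
  symplectic : ∀ z ∈ Ω.cl, LinearMap.toMatrix'
    (fderivWithin ℝ (extendMap toEquiv) Ω.cl z : PhaseSpace n →ₗ[ℝ] PhaseSpace n)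
      ∈ Matrix.symplecticGroup (Fin n) ℝ

namespace Symp

variable {Ω : UniformlyConvexDomain n}

/-- The symplectomorphism `g` as a map between the ambient spaces. -/
def map (g : Symp Ω) : PhaseSpace n → PhaseSpace n := extendMap g.toEquiv

/-- The differential `dg(z)`, for `z ∈ Ω̄`. -/
def diff (g : Symp Ω) (z : PhaseSpace n) : PhaseSpace n →L[ℝ] PhaseSpace n :=
  fderivWithin ℝ g.map Ω.cl z

open Classical in
/-- The differential `dg(z)`, for `z ∈ Ω̄`, as an element of `Sp(2n)`. -/
def diffSp (g : Symp Ω) (z : PhaseSpace n) : Sp n :=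
  if h : z ∈ Ω.cl then
    ⟨LinearMap.toMatrix' (g.diff z : PhaseSpace n →ₗ[ℝ] PhaseSpace n), g.symplectic z h⟩
  else 1

theorem extendMap_id (s : Set (PhaseSpace n)) : extendMap (id : s → s) = id := by
  funext z
  simp [extendMap]

/-- The identity of `Ω̄`. -/
protected def id (Ω : UniformlyConvexDomain n) : Symp Ω where
  toEquiv := Equiv.refl _
  contDiffOn := by
    rw [Equiv.coe_refl, extendMap_id]; exact contDiffOn_id
  contDiffOn_symm := by
    rw [Equiv.refl_symm, Equiv.coe_refl, extendMap_id]; exact contDiffOn_id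
  symplectic := fun z hz => by
    rw [Equiv.coe_refl, extendMap_id, fderivWithin_id (Ω.uniqueDiffOn z hz)]
    simp

/-- The `C^∞` topology: uniform convergence on `Ω̄` of the derivatives of every order `k ≥ 0`. -/
instance : TopologicalSpace (Symp Ω) :=
  ⨅ k : ℕ, TopologicalSpace.induced
    (fun g => UniformOnFun.ofFun {Ω.cl} (iteratedFDerivWithin ℝ k g.map Ω.cl))
    (inferInstanceAs (TopologicalSpace
      (UniformOnFun (PhaseSpace n) (PhaseSpace n [×k]→L[ℝ] PhaseSpace n) {Ω.cl})))

end Symp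

/-- `Symp₀(Ω̄)`: the identity component of the group of symplectomorphisms of `Ω̄`. -/
abbrev Symp₀ (Ω : UniformlyConvexDomain n) : Type := connectedComponent (Symp.id Ω)

/-- The identity as an element of `Symp₀(Ω̄)`. -/
def Symp₀.id (Ω : UniformlyConvexDomain n) : Symp₀ Ω := ⟨Symp.id Ω, mem_connectedComponent⟩

/-! ### Hamiltonians -/

/-- `v` is a characteristic vector of the hypersurface `S` at `z`: it is tangent to `S` and lies in
the kernel of the restriction of `ω₀` to the tangent space of `S` at `z`. -/
def IsCharacteristic (S : Set (PhaseSpace n)) (z v : PhaseSpace n) : Prop :=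
  v ∈ tangentConeAt ℝ S z ∧ ∀ u ∈ tangentConeAt ℝ S z, ω₀ v u = 0

/-- `z` and `w` lie on the same leaf of the characteristic foliation of `S`: they are joined by a
curve in `S` which is everywhere tangent to the characteristic directions. -/
def SameLeaf (S : Set (PhaseSpace n)) (z w : PhaseSpace n) : Prop :=
  ∃ γ γ' : ℝ → PhaseSpace n, γ 0 = z ∧ γ 1 = w ∧ ContinuousOn γ' (Icc 0 1) ∧
    ∀ t ∈ Icc (0 : ℝ) 1, γ t ∈ S ∧ HasDerivWithinAt γ (γ' t) (Icc 0 1) t ∧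
      IsCharacteristic S (γ t) (γ' t)

/-- The space `𝓗(Ω̄)` of smooth functions on `Ω̄` which are constant on each leaf of the
characteristic foliation of `∂Ω`. Adding a constant to such a function changes nothing below. -/
def IsHamiltonian (Ω : UniformlyConvexDomain n) (H : PhaseSpace n → ℝ) : Prop :=
  ContDiffOn ℝ ∞ H Ω.cl ∧
    ∀ z w, SameLeaf (frontier Ω.carrier) z w → H z = H w

/-- The cone `𝓗⁺(Ω̄)` of elements of `𝓗(Ω̄)` with positive definite second differential at every
point of `Ω̄`. -/
def IsPosHamiltonian (Ω : UniformlyConvexDomain n) (H : PhaseSpace n → ℝ) : Prop :=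
  IsHamiltonian Ω H ∧ ∀ z ∈ Ω.cl, ∀ v, v ≠ 0 → 0 < secondDiff Ω.cl H z v v

/-- `𝓖(H) = vol(Ω)⁻¹ ∫_Ω (det ∇²H)^{1/2n}`. -/
def 𝓖 (Ω : UniformlyConvexDomain n) (H : PhaseSpace n → ℝ) : ℝ :=
  (volume.real Ω.carrier)⁻¹ *
    ∫ z in Ω.carrier, (hessian Ω.cl H z).det ^ (1 / (2 * (n : ℝ)))

/-- The Hamiltonian vector field `X_H = J₀ ∇H`, i.e. `ω₀(X_H, ·) = -dH`. -/
def hamVectorField (Ω : UniformlyConvexDomain n) (H : PhaseSpace n → ℝ) (z : PhaseSpace n) :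
    PhaseSpace n :=
  J₀ n *ᵥ grad Ω.cl H z

/-! ### Positive paths and their length -/

variable {Ω : UniformlyConvexDomain n} {g₀ g₁ : Symp₀ Ω}

/-- The time-dependent Hamiltonian `H`, which is smooth in space with all its space derivatives
continuous in `(t, z)`, generates the path `φ` in `Symp₀(Ω̄)`: one has
`d/dt φ^t(z) = X_{H_t}(φ^t(z))` for all `t ∈ [0,1]` and `z ∈ Ω̄`, and every `H_t` is in
`𝓗⁺(Ω̄)`. -/
structure PositivelyGenerates (H : ℝ → PhaseSpace n → ℝ) (φ : Path g₀ g₁) : Prop where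
  pos : ∀ t ∈ Icc (0 : ℝ) 1, IsPosHamiltonian Ω (H t)
  continuousOn : ∀ k : ℕ, ContinuousOn
    (fun p : ℝ × PhaseSpace n => iteratedFDerivWithin ℝ k (H p.1) Ω.cl p.2) (Icc 0 1 ×ˢ Ω.cl)
  hasDerivWithinAt : ∀ t ∈ Icc (0 : ℝ) 1, ∀ z ∈ Ω.cl,
    HasDerivWithinAt (fun s : ℝ => (φ.extend s).1.map z)
      (hamVectorField Ω (H t) ((φ.extend t).1.map z)) (Icc 0 1) t

/-- Positive (i.e. timelike) paths in `Symp₀(Ω̄)`: the continuously differentiable ones whose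
velocity, translated to the identity on the right, is everywhere in the cone `𝓗⁺(Ω̄)`. -/
def IsPositivePath (φ : Path g₀ g₁) : Prop := ∃ H, PositivelyGenerates H φ

open Classical in
/-- The Lorentz–Finsler length `∫₀¹ 𝓖(H_t) dt` of a positive path, where `H` is any Hamiltonian
generating it (see `length𝓖_eq`). -/
def length𝓖 (φ : Path g₀ g₁) : ℝ :=
  if h : IsPositivePath φ then ∫ t in (0 : ℝ)..1, 𝓖 Ω (h.choose t) else 0

theorem PositivelyGenerates.𝓖_eq {H K : ℝ → PhaseSpace n → ℝ} {φ : Path g₀ g₁}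
    (hH : PositivelyGenerates H φ) (hK : PositivelyGenerates K φ) {t : ℝ} (ht : t ∈ Icc (0 : ℝ) 1) :
    𝓖 Ω (H t) = 𝓖 Ω (K t) := by
  have hgrad : ∀ w ∈ Ω.cl, grad Ω.cl (H t) w = grad Ω.cl (K t) w := by
    intro w hw
    set e := (φ.extend t).1.toEquiv
    have hz : (φ.extend t).1.map (e.symm ⟨w, hw⟩) = w := by
      simp [Symp.map, extendMap, e]
    have h1 := hH.hasDerivWithinAt t ht _ (e.symm ⟨w, hw⟩).2
    have h2 := hK.hasDerivWithinAt t ht _ (e.symm ⟨w, hw⟩).2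
    have h3 := (uniqueDiffOn_Icc zero_lt_one t ht).eq_deriv _ h1 h2
    rw [hz] at h3
    have h4 := congrArg (fun v => J₀ n *ᵥ v) h3
    simpa [hamVectorField, Matrix.mulVec_mulVec, Matrix.J_squared, Matrix.neg_mulVec] using h4
  have hfd : ∀ w ∈ Ω.cl, fderivWithin ℝ (H t) Ω.cl w = fderivWithin ℝ (K t) Ω.cl w := by
    intro w hw
    refine ContinuousLinearMap.coe_injective (LinearMap.pi_ext' fun i => ?_)
    ext
    simpa [grad] using congrFun (hgrad w hw) i
  unfold 𝓖
  congr 1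
  refine setIntegral_congr_fun Ω.isOpen.measurableSet fun z hz => ?_
  have hz' : z ∈ Ω.cl := subset_closure hz
  simp only [hessian, secondDiff]
  rw [fderivWithin_congr hfd (hfd z hz')]

theorem length𝓖_eq {H : ℝ → PhaseSpace n → ℝ} {φ : Path g₀ g₁} (hH : PositivelyGenerates H φ) :
    length𝓖 φ = ∫ t in (0 : ℝ)..1, 𝓖 Ω (H t) := by
  have h : IsPositivePath φ := ⟨H, hH⟩
  rw [length𝓖, dif_pos h]
  refine intervalIntegral.integral_congr fun t ht => ?_
  rw [uIcc_of_le zero_le_one] at ht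
  exact h.choose_spec.𝓖_eq hH ht

/-! ### Krein theory and the homogeneous Maslov quasimorphism -/

/-- A real matrix acting on `ℂ²ⁿ`. -/
def complexify (W : Matrix (Fin n ⊕ Fin n) (Fin n ⊕ Fin n) ℝ) :
    Matrix (Fin n ⊕ Fin n) (Fin n ⊕ Fin n) ℂ :=
  W.map (fun x => (x : ℂ))

/-- The Krein form `κ(w, w') = ⟨-i J₀ w, w'⟩`. -/
def krein (w w' : Fin n ⊕ Fin n → ℂ) : ℂ :=
  ((-Complex.I) • (complexify (J₀ n) *ᵥ w)) ⬝ᵥ star w'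

/-- The algebraic eigenspace `E(z)` of `W` in `ℂ²ⁿ`. -/
def algEigenspace (W : Sp n) (z : ℂ) : Submodule ℂ (Fin n ⊕ Fin n → ℂ) :=
  Module.End.maxGenEigenspace (Matrix.toLin' (complexify W.1)) z

/-- The positive index `p(z)` of the restriction of the Krein form to `E(z)`: the maximal
dimension of a subspace on which it is positive definite. -/
def kreinPos (W : Sp n) (z : ℂ) : ℕ :=
  sSup {d | ∃ V : Submodule ℂ (Fin n ⊕ Fin n → ℂ), V ≤ algEigenspace W z ∧
    (∀ w ∈ V, w ≠ 0 → 0 < (krein w w).re) ∧ Module.finrank ℂ V = d}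

open Classical in
/-- The function `υ(W) = (-1)^m ∏ z^{p(z)}`, where the product is over the eigenvalues `z` of `W`
in the unit circle minus `±1`, and `2m` is the total algebraic multiplicity of the real negative
eigenvalues of `W`. -/
def upsilon (W : Sp n) : ℂ :=
  (-1) ^ ((W.1.charpoly.roots.filter fun r => r < 0).card / 2) *
    ∏ z ∈ (complexify W.1).charpoly.roots.toFinset with ‖z‖ = 1 ∧ z ≠ 1 ∧ z ≠ -1,
      z ^ kreinPos W z

open Classical in
/-- The homogeneous Maslov quasimorphism `μ` at the homotopy class of a path `w` in `Sp(2n)`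
starting at the identity: the final value `θ(1)` of the continuous lift `θ` with `θ(0) = 0` and
`υ(w(t)) = e^{2πiθ(t)}` for all `t`. -/
def maslov (w : I → Sp n) : ℝ :=
  if h : ∃ θ : C(I, ℝ), θ 0 = 0 ∧
      ∀ t, upsilon (w t) = Complex.exp (2 * Real.pi * Complex.I * θ t)
  then h.choose 1 else 0

/-- The averaged quasimorphism `𝓜` at the homotopy class of a path `φ` in `Symp₀(Ω̄)` starting at
the identity: the mean value over `z ∈ Ω` of `μ([dφ(z)])`. -/
def 𝓜 {g : Symp₀ Ω} (φ : Path (Symp₀.id Ω) g) : ℝ :=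
  (volume.real Ω.carrier)⁻¹ *
    ∫ z in Ω.carrier, maslov fun t => (φ t).1.diffSp z

/-- The linearizations `dφ^t(z)` do not have the eigenvalue `-1`, for all `t` and `z ∈ Ω̄`. -/
def NoEigenvalueNegOne (φ : Path g₀ g₁) : Prop :=
  ∀ t : I, ∀ z ∈ Ω.cl, ¬ Module.End.HasEigenvalue
    ((φ t).1.diff z : PhaseSpace n →ₗ[ℝ] PhaseSpace n) (-1)

end ConvexSymp

end

open ConvexSymp

noncomputable section

namespace ConvexSymp

/-! ### Krein-diagonalizable matrices -/

variable {n : ℕ}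

/-! Fix `z` and let `w t` be the differential at `z` of the time-`t` map of a positive path. The
linearized equation is `w' = J₀ A w`, where `A t`, the Hessian of `H_t` at the moving point, is
positive definite (`hasDerivWithinAt_jac`). As long as `w` avoids the eigenvalue `-1`, its Cayley
transform `S`, defined by `w - 1 = J₀ S (w + 1)`, is symmetric and strictly increasing, and it
vanishes at time `0`. So `S` is positive definite for `t > 0`. This makes `w t` diagonalizable with
eigenvalues `e^{iθⱼ}`, `0 < |θⱼ| < π`, in a basis `V` that is orthonormal for the Krein form, with
Krein signs `sign θⱼ` (`exists_kreinDiagonalizes`).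

Two consequences follow. First, `υ(w t) = e^{2πi rot(w t)}` with `4π rot = ∑ |θⱼ|`. Since `rot` is
continuous on such matrices, it is the lift that defines `μ`, and hence `μ = rot (w 1)` depends on
the endpoint only. Secondly, `|θⱼ|` grows formally at the rate `(Vᴴ A V)ⱼⱼ`. As `|det V| = 1`, the
arithmetic-geometric mean inequality bounds the sum of these rates below by `2n (det A)^{1/2n}`, so
that `∫ (det A)^{1/2n} ≤ (2π/n) rot (w 1)` (`integral_le_rot`). Individual eigenvalues are never
followed in time: traces of polynomials in `(w + w⁻¹)/2` replace them, with polynomials close to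
`arccos`. Averaging over `z` gives the length bound, because the maps preserve volume.

It remains to see that `ψ` avoids the eigenvalue `-1` (`IsPositiveLinearPath.det_add_one_ne_zero`).
A path cut into `N` small steps has a quadratic generating form on antiperiodic sequences,
degenerate exactly when the product of the steps has the eigenvalue `-1`. Its index is constant
along the side of the homotopy formed by the common endpoint and along `φ`, so it takes the same
value at both ends of `ψ`. Along `ψ` positivity makes the form nondecreasing, and each occurrence of
the eigenvalue `-1` before the endpoint would raise the index strictly. -/

theorem complexify_mul (A B : Matrix (Fin n ⊕ Fin n) (Fin n ⊕ Fin n) ℝ) :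
    complexify (A * B) = complexify A * complexify B :=
  Matrix.map_mul (f := Complex.ofRealHom)

theorem complexify_one : complexify (1 : Matrix (Fin n ⊕ Fin n) (Fin n ⊕ Fin n) ℝ) = 1 := by
  simp [complexify]

theorem complexify_add (A B : Matrix (Fin n ⊕ Fin n) (Fin n ⊕ Fin n) ℝ) :
    complexify (A + B) = complexify A + complexify B := by
  ext; simp [complexify]

theorem complexify_sub (A B : Matrix (Fin n ⊕ Fin n) (Fin n ⊕ Fin n) ℝ) :
    complexify (A - B) = complexify A - complexify B := by
  ext; simp [complexify]

theorem complexify_conjTranspose (A : Matrix (Fin n ⊕ Fin n) (Fin n ⊕ Fin n) ℝ) :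
    (complexify A)ᴴ = complexify Aᵀ := by
  ext; simp [complexify]

theorem complexify_charpoly (A : Matrix (Fin n ⊕ Fin n) (Fin n ⊕ Fin n) ℝ) :
    (complexify A).charpoly = A.charpoly.map Complex.ofRealHom :=
  Matrix.charpoly_map A Complex.ofRealHom

open scoped MatrixOrder Matrix.Norms.L2Operator in
theorem exists_isUnit_eq_transpose_mul_self {m : Type*} [Fintype m] [DecidableEq m]
    {A : Matrix m m ℝ} (hA : A.PosDef) : ∃ B : Matrix m m ℝ, IsUnit B ∧ A = Bᵀ * B := by
  obtain ⟨B, hB, h⟩ := CStarAlgebra.isStrictlyPositive_iff_eq_star_mul_self.mp hA.isStrictlyPositive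
  exact ⟨B, hB, by rw [h, Matrix.star_eq_conjTranspose, Matrix.conjTranspose_eq_transpose_of_trivial]⟩

theorem exists_isUnit_complexify_eq {A : Matrix (Fin n ⊕ Fin n) (Fin n ⊕ Fin n) ℝ}
    (hA : A.PosDef) : ∃ B, IsUnit B ∧ complexify A = Bᴴ * B := by
  obtain ⟨B, hB, rfl⟩ := exists_isUnit_eq_transpose_mul_self hA
  refine ⟨complexify B, hB.map (Complex.ofRealHom.mapMatrix (m := Fin n ⊕ Fin n)), ?_⟩
  rw [complexify_mul, complexify_conjTranspose]

/-- The Hermitian matrix `-iJ₀` of the Krein form. -/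
def kreinMatrix (n : ℕ) : Matrix (Fin n ⊕ Fin n) (Fin n ⊕ Fin n) ℂ :=
  (-Complex.I) • complexify (J₀ n)

theorem kreinMatrix_mul_self : kreinMatrix n * kreinMatrix n = 1 := by
  have : complexify (J₀ n) * complexify (J₀ n) = -1 := by
    rw [← complexify_mul, Matrix.J_squared]
    ext i j; simp [complexify, Matrix.one_apply]
    split_ifs <;> simp
  simp [kreinMatrix, this, smul_smul]

theorem kreinMatrix_isHermitian : (kreinMatrix n).IsHermitian := by
  have : complexify (-(J₀ n)) = - complexify (J₀ n) := by ext; simp [complexify]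
  simp only [Matrix.IsHermitian, kreinMatrix, Matrix.conjTranspose_smul,
    complexify_conjTranspose, Matrix.J_transpose]
  rw [this]; simp

theorem complexify_J : complexify (J₀ n) = Complex.I • kreinMatrix n := by
  simp [kreinMatrix, smul_smul]

/-- The columns of `V` form a Krein-orthonormal basis of eigenvectors of `W`, with eigenvalues
`e^{iθⱼ}` different from `±1` and Krein sign equal to the sign of `θⱼ`. -/
structure KreinDiagonalizes (W : Matrix (Fin n ⊕ Fin n) (Fin n ⊕ Fin n) ℝ)
    (V : Matrix (Fin n ⊕ Fin n) (Fin n ⊕ Fin n) ℂ) (θ : Fin n ⊕ Fin n → ℝ) : Prop where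
  abs_lt : ∀ j, |θ j| < Real.pi
  ne_zero : ∀ j, θ j ≠ 0
  mul_eq : complexify W * V = V * Matrix.diagonal fun j => Complex.exp (θ j * Complex.I)
  krein_eq : Vᴴ * kreinMatrix n * V = Matrix.diagonal fun j => ((SignType.sign (θ j) : ℝ) : ℂ)

/-- Polar form: `1 + id = √(1 + d²) e^{i arctan d}`, divided by its conjugate. This is the
eigenvalue of a Cayley transform whose generator has the eigenvalue `id`. -/
theorem exp_two_arctan (d : ℝ) : Complex.exp ((2 * Real.arctan d : ℝ) * Complex.I) *
    (1 - d * Complex.I) = 1 + d * Complex.I := by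
  have hs : (0 : ℝ) < Real.sqrt (1 + d ^ 2) := Real.sqrt_pos.2 (by positivity)
  have hs2 : Real.sqrt (1 + d ^ 2) ^ 2 = 1 + d ^ 2 := Real.sq_sqrt (by positivity)
  have h1 : Complex.exp ((Real.arctan d : ℝ) * Complex.I) * (Real.sqrt (1 + d ^ 2) : ℂ) =
      1 + d * Complex.I := by
    rw [Complex.exp_mul_I, ← Complex.ofReal_cos, ← Complex.ofReal_sin, Real.cos_arctan,
      Real.sin_arctan]
    have : (Real.sqrt (1 + d ^ 2) : ℂ) ≠ 0 := by exact_mod_cast hs.ne'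
    push_cast
    field_simp
  have h2 : ((Real.sqrt (1 + d ^ 2) : ℝ) : ℂ) ^ 2 = (1 + d * Complex.I) * (1 - d * Complex.I) := by
    rw [← Complex.ofReal_pow, hs2]; push_cast; ring_nf; simp
  have h3 : (1 + d * Complex.I : ℂ) ≠ 0 := by
    intro h
    have := congrArg Complex.re h
    simp at this
  have h4 : Complex.exp ((2 * Real.arctan d : ℝ) * Complex.I) =
      Complex.exp ((Real.arctan d : ℝ) * Complex.I) ^ 2 := by
    rw [← Complex.exp_nat_mul]; congr 1; push_cast; ring
  apply mul_left_cancel₀ h3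
  rw [h4]
  calc _ = (Complex.exp ((Real.arctan d : ℝ) * Complex.I)) ^ 2 *
        ((1 + d * Complex.I) * (1 - d * Complex.I)) := by ring
    _ = (Complex.exp ((Real.arctan d : ℝ) * Complex.I) * (Real.sqrt (1 + d ^ 2) : ℂ)) ^ 2 := by
        rw [← h2]; ring
    _ = _ := by rw [h1]; ring

/-- A Cayley transform of a positive definite symmetric matrix is Krein-diagonalizable with
matching signs. -/
theorem exists_kreinDiagonalizes {W X : Matrix (Fin n ⊕ Fin n) (Fin n ⊕ Fin n) ℝ}
    (hX : X.PosDef) (h : W - 1 = J₀ n * X * (W + 1)) : ∃ V θ, KreinDiagonalizes W V θ := by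
  obtain ⟨B, hB, hXB⟩ := exists_isUnit_complexify_eq hX
  set K := kreinMatrix n with hK
  -- With `X = Bᴴ B`, the matrix `K X` is similar to the Hermitian matrix `B K Bᴴ`. An orthonormal
  -- eigenbasis `U` of the latter gives the eigenbasis `B⁻¹ U` of the former, with real eigenvalues
  -- `d`.
  have hH : (B * K * Bᴴ).IsHermitian := by
    simpa using Matrix.isHermitian_mul_mul_conjTranspose B (kreinMatrix_isHermitian (n := n))
  set U := (hH.eigenvectorUnitary : Matrix (Fin n ⊕ Fin n) (Fin n ⊕ Fin n) ℂ) with hU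
  set d := hH.eigenvalues with hd
  set D : Matrix (Fin n ⊕ Fin n) (Fin n ⊕ Fin n) ℂ := Matrix.diagonal fun j => (d j : ℂ) with hD
  have hUU : Uᴴ * U = 1 := by
    exact Unitary.coe_star_mul_self hH.eigenvectorUnitary
  have hHU : B * K * Bᴴ * U = U * D := by
    have := hH.spectral_theorem
    conv_lhs => rw [this]
    simp only [Unitary.conjStarAlgAut_apply]
    rw [mul_assoc, Unitary.coe_star_mul_self, mul_one]
    rfl
  have hBi : B⁻¹ * B = 1 := Matrix.nonsing_inv_mul B ((Matrix.isUnit_iff_isUnit_det B).1 hB)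
  have hBi' : B * B⁻¹ = 1 := Matrix.mul_nonsing_inv B ((Matrix.isUnit_iff_isUnit_det B).1 hB)
  set V₀ := B⁻¹ * U with hV₀
  have h1 : K * complexify X * V₀ = V₀ * D := by
    calc K * complexify X * V₀ = (B⁻¹ * B) * K * (Bᴴ * B) * (B⁻¹ * U) := by
          rw [hBi, hXB, one_mul]
      _ = B⁻¹ * (B * K * Bᴴ * ((B * B⁻¹) * U)) := by simp only [mul_assoc]
      _ = V₀ * D := by rw [hBi', one_mul, hHU, hV₀, mul_assoc]
  have h2 : V₀ᴴ * complexify X * V₀ = 1 := by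
    calc V₀ᴴ * complexify X * V₀ = Uᴴ * ((B * B⁻¹)ᴴ * ((B * B⁻¹) * U)) := by
          rw [hXB, hV₀]; simp only [Matrix.conjTranspose_mul, mul_assoc]
      _ = 1 := by rw [hBi']; simp [hUU]
  have h3 : V₀ᴴ * K * V₀ * D = 1 := by
    calc V₀ᴴ * K * V₀ * D = V₀ᴴ * K * (K * complexify X * V₀) := by rw [h1]; simp only [mul_assoc]
      _ = V₀ᴴ * (K * K) * complexify X * V₀ := by simp only [mul_assoc]
      _ = 1 := by rw [hK, kreinMatrix_mul_self, mul_one, h2]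
  have hd0 : ∀ j, d j ≠ 0 := by
    intro j hj
    have : IsUnit D.det := Matrix.isUnit_det_of_left_inverse h3
    rw [hD, Matrix.det_diagonal] at this
    exact this.ne_zero (Finset.prod_eq_zero (Finset.mem_univ j) (by simp [hj]))
  -- The columns of `V₀` have Krein squares `1 / d j`; scaling them by `√|d j|` turns these into
  -- signs.
  set E : Matrix (Fin n ⊕ Fin n) (Fin n ⊕ Fin n) ℂ :=
    Matrix.diagonal fun j => (Real.sqrt |d j| : ℂ) with hE
  have hEE : Eᴴ = E := by
    rw [hE, Matrix.diagonal_conjTranspose]; congr 1; ext j; simp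
  have h4 : V₀ᴴ * K * V₀ = Matrix.diagonal fun j => ((d j)⁻¹ : ℂ) := by
    have hDi : D * Matrix.diagonal (fun j => ((d j)⁻¹ : ℂ)) = 1 := by
      rw [hD, Matrix.diagonal_mul_diagonal, ← Matrix.diagonal_one]
      congr 1; ext j
      have : (d j : ℂ) ≠ 0 := by exact_mod_cast hd0 j
      simp [this]
    calc V₀ᴴ * K * V₀ = V₀ᴴ * K * V₀ * (D * Matrix.diagonal (fun j => ((d j)⁻¹ : ℂ))) := by
          rw [hDi, mul_one]
      _ = _ := by rw [← mul_assoc, h3, one_mul]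
  have hDE : D * E = E * D := by
    rw [hD, hE, Matrix.diagonal_mul_diagonal, Matrix.diagonal_mul_diagonal]
    congr 1; ext j; ring
  set V := V₀ * E with hV
  have h5 : complexify (J₀ n * X) * V = V * (Complex.I • D) := by
    rw [complexify_mul, complexify_J, hV]
    simp only [Matrix.smul_mul, Matrix.mul_smul]
    congr 1
    calc K * complexify X * (V₀ * E) = (K * complexify X * V₀) * E := by simp only [mul_assoc]
      _ = V₀ * E * D := by rw [h1, mul_assoc, hDE, mul_assoc V₀ E D]
  refine ⟨V, fun j => 2 * Real.arctan (d j), ⟨fun j => ?_, fun j => ?_, ?_, ?_⟩⟩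
  · rw [_root_.abs_lt]
    constructor <;> linarith [Real.arctan_lt_pi_div_two (d j), Real.neg_pi_div_two_lt_arctan (d j)]
  · simpa using hd0 j
  · set Y := complexify (J₀ n * X) with hY
    set Z : Matrix (Fin n ⊕ Fin n) (Fin n ⊕ Fin n) ℂ :=
      Matrix.diagonal fun j => Complex.exp ((2 * Real.arctan (d j) : ℝ) * Complex.I) with hZ
    set Wc := complexify W with hWc
    have hW : Wc - 1 = Y * (Wc + 1) := by
      rw [hWc, hY, ← complexify_one, ← complexify_sub, ← complexify_add, ← complexify_mul, h]
    -- This makes `1 - Y` invertible, so the eigenvalue equation for `W` may be checked after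
    -- multiplication by `1 - Y`, where it reads `(1 - id) e^{2i arctan d} = 1 + id`.
    have e1 : (1 - Y) * (Wc + 1) = (2 : ℂ) • 1 := by
      rw [sub_mul, ← hW, one_mul, two_smul]; abel
    have e2 : (Wc + 1) * (1 - Y) = (2 : ℂ) • 1 := by
      have : (1 - Y) * ((2 : ℂ)⁻¹ • (Wc + 1)) = 1 := by
        rw [Matrix.mul_smul, e1, smul_smul]; norm_num
      have := mul_eq_one_comm.1 this
      rw [Matrix.smul_mul] at this
      exact (inv_smul_eq_iff₀ two_ne_zero).1 this
    have e3 : (1 - Y) * (Wc * V) = V * (1 + Complex.I • D) := by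
      have : (1 - Y) * Wc = 1 + Y := by
        rw [sub_mul, one_mul]
        have h7 : Wc - 1 = Y * Wc + Y := by rw [hW, mul_add, mul_one]
        rw [sub_eq_iff_eq_add]
        rw [sub_eq_iff_eq_add] at h7
        conv_lhs => rw [h7]
        abel
      rw [← mul_assoc, this, add_mul, one_mul, h5, mul_add, mul_one]
    have e4 : (1 - Y) * (V * Z) = V * (1 + Complex.I • D) := by
      have : (1 - Y) * V = V * (1 - Complex.I • D) := by rw [sub_mul, one_mul, h5, mul_sub, mul_one]
      rw [← mul_assoc, this, mul_assoc]
      congr 1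
      rw [hD, hZ, ← Matrix.diagonal_one, ← Matrix.diagonal_smul, Matrix.diagonal_sub,
        Matrix.diagonal_mul_diagonal, Matrix.diagonal_add]
      congr 1; ext j
      have := exp_two_arctan (d j)
      simp only [Pi.smul_apply, smul_eq_mul]
      rw [mul_comm, mul_comm Complex.I, this]
    have e5 : (2 : ℂ) • (Wc * V) = (2 : ℂ) • (V * Z) := by
      rw [← one_mul (Wc * V), ← one_mul (V * Z), ← Matrix.smul_mul, ← Matrix.smul_mul, ← e2,
        mul_assoc, mul_assoc, e3, e4]
    simpa using congrArg (fun M => (2 : ℂ)⁻¹ • M) e5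
  · rw [hV, Matrix.conjTranspose_mul, hEE]
    calc E * V₀ᴴ * kreinMatrix n * (V₀ * E) = E * (V₀ᴴ * K * V₀) * E := by simp only [mul_assoc, hK]
      _ = _ := by
        rw [h4, hE, Matrix.diagonal_mul_diagonal, Matrix.diagonal_mul_diagonal]
        congr 1; ext j
        have hsq : Real.sqrt |d j| * (d j)⁻¹ * Real.sqrt |d j| = SignType.sign (2 * Real.arctan (d j)) := by
          rw [mul_right_comm, Real.mul_self_sqrt (abs_nonneg _)]
          rcases lt_or_gt_of_ne (hd0 j) with hj | hj
          · rw [sign_neg (by linarith [Real.arctan_lt_zero.2 hj]), abs_of_neg hj]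
            simp [hd0 j]
          · rw [sign_pos (by linarith [Real.arctan_pos.2 hj]), abs_of_pos hj]
            simp [hd0 j]
        have := congrArg (fun x : ℝ => (x : ℂ)) hsq
        push_cast at this
        rw [this]

end ConvexSymp
end

noncomputable section

namespace ConvexSymp

/-! ### The rotation number and the function `υ` -/

variable {n : ℕ}

theorem arg_exp_mul_I_of_abs_lt {θ : ℝ} (h : |θ| < Real.pi) :
    Complex.arg (Complex.exp (θ * Complex.I)) = θ := by
  rw [Complex.exp_mul_I]
  exact Complex.arg_cos_add_sin_mul_I ⟨(_root_.abs_lt.1 h).1, (_root_.abs_lt.1 h).2.le⟩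

/-- The mean rotation number of the eigenvalues of `W`. -/
def rot (W : Matrix (Fin n ⊕ Fin n) (Fin n ⊕ Fin n) ℝ) : ℝ :=
  (4 * Real.pi)⁻¹ * ((complexify W).charpoly.roots.map fun z => |Complex.arg z|).sum

namespace KreinDiagonalizes

variable {W : Matrix (Fin n ⊕ Fin n) (Fin n ⊕ Fin n) ℝ}
  {V : Matrix (Fin n ⊕ Fin n) (Fin n ⊕ Fin n) ℂ} {θ : Fin n ⊕ Fin n → ℝ}

theorem sign_ne_zero (h : KreinDiagonalizes W V θ) (j : Fin n ⊕ Fin n) :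
    ((SignType.sign (θ j) : ℝ) : ℂ) ≠ 0 := by
  rcases lt_or_gt_of_ne (h.ne_zero j) with hj | hj
  · simp [sign_neg hj]
  · simp [sign_pos hj]

theorem isUnit_det (h : KreinDiagonalizes W V θ) : IsUnit V.det := by
  have := congrArg Matrix.det h.krein_eq
  rw [Matrix.det_mul, Matrix.det_diagonal] at this
  refine isUnit_iff_ne_zero.2 fun h0 => ?_
  rw [h0, mul_zero] at this
  exact (Finset.prod_ne_zero_iff.2 fun j _ => h.sign_ne_zero j) this.symm

theorem complexify_eq (h : KreinDiagonalizes W V θ) :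
    complexify W = V * Matrix.diagonal (fun j => Complex.exp (θ j * Complex.I)) * V⁻¹ := by
  rw [← h.mul_eq, mul_assoc, Matrix.mul_nonsing_inv _ h.isUnit_det, mul_one]

theorem charpoly_eq (h : KreinDiagonalizes W V θ) : (complexify W).charpoly =
    ∏ j, (Polynomial.X - Polynomial.C (Complex.exp (θ j * Complex.I))) := by
  rw [h.complexify_eq, Matrix.charpoly_mul_comm, ← mul_assoc,
    Matrix.nonsing_inv_mul _ h.isUnit_det, one_mul, Matrix.charpoly_diagonal]

theorem roots_eq (h : KreinDiagonalizes W V θ) : (complexify W).charpoly.roots =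
    Finset.univ.val.map fun j => Complex.exp (θ j * Complex.I) := by
  rw [h.charpoly_eq]
  have := Polynomial.roots_multiset_prod_X_sub_C
    (Finset.univ.val.map fun j => Complex.exp (θ j * Complex.I))
  rwa [Multiset.map_map] at this

theorem rot_eq (h : KreinDiagonalizes W V θ) : rot W = (4 * Real.pi)⁻¹ * ∑ j, |θ j| := by
  rw [rot, h.roots_eq, Multiset.map_map]
  congr 1
  refine Finset.sum_congr rfl fun j _ => ?_
  simp only [Function.comp_apply]
  rw [arg_exp_mul_I_of_abs_lt (h.abs_lt j)]

/-- `W` is real, so conjugation fixes its characteristic polynomial. -/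
theorem map_conj (h : KreinDiagonalizes W V θ) :
    (Finset.univ.val.map fun j => Complex.exp (θ j * Complex.I)) =
      Finset.univ.val.map fun j => Complex.exp ((-θ j : ℝ) * Complex.I) := by
  have h1 : (complexify W).charpoly.map (starRingEnd ℂ) = (complexify W).charpoly := by
    rw [complexify_charpoly, Polynomial.map_map]
    congr 1
    ext; simp
  rw [← h.roots_eq, ← h1, h.charpoly_eq, Polynomial.map_prod]
  have := Polynomial.roots_multiset_prod_X_sub_C
    (Finset.univ.val.map fun j => Complex.exp ((-θ j : ℝ) * Complex.I))
  rw [Multiset.map_map] at this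
  rw [← this]
  congr 1
  refine Finset.prod_congr rfl fun j _ => ?_
  simp [← Complex.exp_conj]

theorem sum_abs_eq (h : KreinDiagonalizes W V θ) :
    ∑ j, |θ j| = 2 * ∑ j with 0 < θ j, θ j := by
  -- Summing `max (arg z) 0` over the spectrum and over its conjugate shows that the positive and
  -- the negative parts of `θ` have the same total.
  have h1 := congrArg (fun s => (s.map fun z => max (Complex.arg z) 0).sum) h.map_conj
  simp only [Multiset.map_map, Function.comp_def] at h1
  have h2 : ∑ j, max (θ j) 0 = ∑ j, max (-θ j) 0 := by
    refine Eq.trans (Finset.sum_congr rfl fun j _ => ?_) (h1.trans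
      (Finset.sum_congr rfl fun j _ => ?_))
    · rw [arg_exp_mul_I_of_abs_lt (h.abs_lt j)]
    · rw [arg_exp_mul_I_of_abs_lt (by rw [abs_neg]; exact h.abs_lt j)]
  have h3 : ∑ j, |θ j| = ∑ j, max (θ j) 0 + ∑ j, max (-θ j) 0 := by
    rw [← Finset.sum_add_distrib]
    refine Finset.sum_congr rfl fun j _ => ?_
    rcases le_total 0 (θ j) with hj | hj
    · rw [abs_of_nonneg hj, max_eq_left hj, max_eq_right (by linarith), add_zero]
    · rw [abs_of_nonpos hj, max_eq_right hj, max_eq_left (by linarith), zero_add]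
  rw [h3, ← h2, Finset.sum_filter, two_mul]
  congr 1 <;>
  · refine Finset.sum_congr rfl fun j _ => ?_
    split_ifs with hj
    · exact max_eq_left hj.le
    · exact max_eq_right (not_lt.1 hj)

theorem krein_mulVec (h : KreinDiagonalizes W V θ) (a : Fin n ⊕ Fin n → ℂ) :
    (krein (V *ᵥ a) (V *ᵥ a)).re = ∑ j, (SignType.sign (θ j) : ℝ) * Complex.normSq (a j) := by
  have h1 : krein (V *ᵥ a) (V *ᵥ a) =
      star a ⬝ᵥ ((Matrix.diagonal fun j => ((SignType.sign (θ j) : ℝ) : ℂ)) *ᵥ a) := by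
    rw [← h.krein_eq, krein, ← Matrix.smul_mulVec, dotProduct_comm, Matrix.star_mulVec,
      ← Matrix.mulVec_mulVec, ← Matrix.mulVec_mulVec, ← Matrix.dotProduct_mulVec]
    rfl
  rw [h1, dotProduct, Complex.re_sum]
  refine Finset.sum_congr rfl fun j _ => ?_
  rw [Matrix.mulVec_diagonal, Pi.star_apply, Complex.star_def, mul_left_comm,
    ← Complex.normSq_eq_conj_mul_self, Complex.re_ofReal_mul, Complex.ofReal_re]

theorem mulVec_mem_algEigenspace {W : Sp n} (h : KreinDiagonalizes W.1 V θ) (z : ℂ)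
    (a : Fin n ⊕ Fin n → ℂ) : V *ᵥ a ∈ algEigenspace W z ↔
      ∀ j, Complex.exp (θ j * Complex.I) ≠ z → a j = 0 := by
  have hpow : ∀ k : ℕ, (complexify W.1 - z • 1) ^ k * V =
      V * Matrix.diagonal (fun j => (Complex.exp (θ j * Complex.I) - z) ^ k) := by
    have h1 : (complexify W.1 - z • 1) * V =
        V * Matrix.diagonal (fun j => Complex.exp (θ j * Complex.I) - z) := by
      rw [← Matrix.diagonal_sub, mul_sub, ← h.mul_eq, sub_mul, Matrix.smul_mul, one_mul]
      congr 1
      ext i j; simp [mul_comm]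
    intro k
    induction k with
    | zero => simp
    | succ k ih =>
      rw [pow_succ, mul_assoc, h1, ← mul_assoc, ih, mul_assoc, Matrix.diagonal_mul_diagonal]
      simp only [pow_succ]
  have hinj : Function.Injective V.mulVec :=
    Matrix.mulVec_injective_of_isUnit ((Matrix.isUnit_iff_isUnit_det V).2 h.isUnit_det)
  have hk : ∀ k : ℕ, ((Matrix.toLin' (complexify W.1) - z • 1) ^ k) (V *ᵥ a) = 0 ↔
      ∀ j, (Complex.exp (θ j * Complex.I) - z) ^ k * a j = 0 := by
    intro k
    have h2 : Matrix.toLin' (complexify W.1) - z • 1 =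
        Matrix.toLin' (complexify W.1 - z • 1) := by
      simp [map_sub, Matrix.toLin'_one, Module.End.one_eq_id]
    rw [h2, ← Matrix.toLin'_pow, Matrix.toLin'_apply, Matrix.mulVec_mulVec, hpow,
      ← Matrix.mulVec_mulVec, hinj.eq_iff' (Matrix.mulVec_zero V), funext_iff]
    simp [Matrix.mulVec_diagonal]
  rw [algEigenspace, Module.End.mem_maxGenEigenspace]
  constructor
  · rintro ⟨k, h3⟩ j hj
    exact (mul_eq_zero.1 ((hk k).1 h3 j)).resolve_left (pow_ne_zero _ (sub_ne_zero.2 hj))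
  · intro h3
    refine ⟨1, (hk 1).2 fun j => ?_⟩
    by_cases hj : Complex.exp (θ j * Complex.I) = z
    · simp [hj]
    · rw [h3 j hj, mul_zero]

theorem finrank_algEigenspace {W : Sp n} (h : KreinDiagonalizes W.1 V θ) (z : ℂ) :
    Module.finrank ℂ (algEigenspace W z) =
      (Finset.univ.filter fun j => Complex.exp (θ j * Complex.I) = z).card := by
  have h1 := Matrix.nonsing_inv_mul _ h.isUnit_det
  have h2 := Matrix.mul_nonsing_inv _ h.isUnit_det
  have happ : ∀ a, (Matrix.toLin'OfInv h1 h2).toLinearMap a = V *ᵥ a := fun a => rfl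
  have h3 : algEigenspace W z =
      (Pi.spanSubset ℂ {j | Complex.exp (θ j * Complex.I) = z}).map
        (Matrix.toLin'OfInv h1 h2).toLinearMap := by
    ext w
    rw [Submodule.mem_map]
    constructor
    · intro hw
      refine ⟨V⁻¹ *ᵥ w, Pi.mem_spanSubset_iff.2 fun j hj => ?_, ?_⟩
      · refine (h.mulVec_mem_algEigenspace z (V⁻¹ *ᵥ w)).1 ?_ j hj
        rwa [Matrix.mulVec_mulVec, h2, Matrix.one_mulVec]
      · rw [happ, Matrix.mulVec_mulVec, h2, Matrix.one_mulVec]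
    · rintro ⟨a, ha, rfl⟩
      rw [happ]
      exact (h.mulVec_mem_algEigenspace z a).2 fun j hj => Pi.mem_spanSubset_iff.1 ha j hj
  rw [h3, LinearEquiv.finrank_map_eq, Pi.dim_spanSubset, Set.ncard_eq_toFinset_card']
  congr 1
  ext; simp

/-- All `θ j` with the eigenvalue `z` are equal to `arg z`, so the Krein form is definite on `E(z)`,
with the sign of `arg z`. The positive index is then the full dimension or zero. -/
theorem kreinPos_eq {W : Sp n} (h : KreinDiagonalizes W.1 V θ) (z : ℂ) :
    kreinPos W z =
      (Finset.univ.filter fun j => 0 < θ j ∧ Complex.exp (θ j * Complex.I) = z).card := by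
  have harg : ∀ j, Complex.exp (θ j * Complex.I) = z → Complex.arg z = θ j := by
    rintro j rfl
    exact arg_exp_mul_I_of_abs_lt (h.abs_lt j)
  have hrep : ∀ w : Fin n ⊕ Fin n → ℂ, ∃ a, V *ᵥ a = w := fun w =>
    ⟨V⁻¹ *ᵥ w, by rw [Matrix.mulVec_mulVec, Matrix.mul_nonsing_inv _ h.isUnit_det,
      Matrix.one_mulVec]⟩
  rw [kreinPos]
  by_cases hz : 0 < Complex.arg z
  · have h1 : (Finset.univ.filter fun j => 0 < θ j ∧ Complex.exp (θ j * Complex.I) = z) =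
        Finset.univ.filter fun j => Complex.exp (θ j * Complex.I) = z := by
      ext j
      simp only [Finset.mem_filter, Finset.mem_univ, true_and, and_iff_right_iff_imp]
      intro hj
      rwa [← harg j hj]
    rw [h1, ← h.finrank_algEigenspace]
    refine IsGreatest.csSup_eq ⟨⟨_, le_rfl, fun w hw hw0 => ?_, rfl⟩, ?_⟩
    · obtain ⟨a, rfl⟩ := hrep w
      rw [h.mulVec_mem_algEigenspace] at hw
      rw [h.krein_mulVec]
      refine Finset.sum_pos' (fun j _ => ?_) ?_
      · by_cases hj : Complex.exp (θ j * Complex.I) = z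
        · rw [sign_pos (by rwa [← harg j hj])]
          simpa using Complex.normSq_nonneg _
        · simp [hw j hj]
      · obtain ⟨j, hj⟩ : ∃ j, a j ≠ 0 := by
          by_contra! hc
          exact hw0 (by rw [show a = 0 from funext hc, Matrix.mulVec_zero])
        refine ⟨j, Finset.mem_univ _, ?_⟩
        have hj' : Complex.exp (θ j * Complex.I) = z := by
          by_contra hc
          exact hj (hw j hc)
        rw [sign_pos (by rwa [← harg j hj'])]
        simpa using hj
    · rintro d ⟨P, hP, -, rfl⟩
      exact Submodule.finrank_mono hP
  · have h1 : (Finset.univ.filter fun j => 0 < θ j ∧ Complex.exp (θ j * Complex.I) = z) = ∅ := by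
      rw [Finset.filter_eq_empty_iff]
      rintro j - ⟨hj, hj'⟩
      rw [← harg j hj'] at hj
      exact hz hj
    rw [h1, Finset.card_empty]
    refine IsGreatest.csSup_eq ⟨⟨⊥, bot_le, fun w hw hw0 => absurd ((Submodule.mem_bot ℂ).1 hw) hw0,
      finrank_bot _ _⟩, ?_⟩
    rintro d ⟨P, hP, hpos, rfl⟩
    have : P = ⊥ := by
      rw [Submodule.eq_bot_iff]
      intro w hw
      by_contra hw0
      have h2 := hpos w hw hw0
      have h3 := hP hw
      obtain ⟨a, rfl⟩ := hrep w
      rw [h.mulVec_mem_algEigenspace] at h3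
      rw [h.krein_mulVec] at h2
      refine absurd h2 (not_lt.2 (Finset.sum_nonpos fun j _ => ?_))
      by_cases hj : Complex.exp (θ j * Complex.I) = z
      · have hle : θ j ≤ 0 := by rw [← harg j hj]; exact not_lt.1 hz
        rw [sign_neg (lt_of_le_of_ne hle (h.ne_zero j))]
        simpa using Complex.normSq_nonneg _
      · simp [h3 j hj]
    rw [this, finrank_bot]

/-- There is no negative real eigenvalue, so the sign `(-1)^m` is trivial. The product has one
factor `e^{iθⱼ}` for each positive `θⱼ`, and `∑_{θⱼ > 0} θⱼ = ½ ∑ |θⱼ| = 2π rot W`. -/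
theorem upsilon_eq {W : Sp n} (h : KreinDiagonalizes W.1 V θ) :
    upsilon W = Complex.exp (2 * Real.pi * Complex.I * rot W.1) := by
  classical
  have hroot : ∀ z, z ∈ (complexify W.1).charpoly.roots ↔
      ∃ j, Complex.exp (θ j * Complex.I) = z := by
    intro z; rw [h.roots_eq]; simp
  have hne1 : ∀ j, Complex.exp (θ j * Complex.I) ≠ 1 := by
    intro j hj
    have := arg_exp_mul_I_of_abs_lt (h.abs_lt j)
    rw [hj, Complex.arg_one] at this
    exact h.ne_zero j this.symm
  have hne2 : ∀ j, Complex.exp (θ j * Complex.I) ≠ -1 := by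
    intro j hj
    have := arg_exp_mul_I_of_abs_lt (h.abs_lt j)
    rw [hj, Complex.arg_neg_one] at this
    have h2 := h.abs_lt j
    rw [← this, abs_of_pos Real.pi_pos] at h2
    exact lt_irrefl _ h2
  have h1 : (W.1.charpoly.roots.filter fun r => r < 0) = 0 := by
    rw [Multiset.filter_eq_nil]
    intro r hr hr0
    have : (r : ℂ) ∈ (complexify W.1).charpoly.roots := by
      rw [Polynomial.mem_roots (Matrix.charpoly_monic _).ne_zero, complexify_charpoly]
      exact (Polynomial.isRoot_of_mem_roots hr).map (f := Complex.ofRealHom)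
    obtain ⟨j, hj⟩ := (hroot _).1 this
    have h2 := Complex.norm_exp_ofReal_mul_I (θ j)
    rw [hj, Complex.norm_real, Real.norm_eq_abs, abs_of_neg hr0] at h2
    refine hne2 j ?_
    rw [hj, show r = -1 by linarith]; simp
  rw [upsilon]
  simp only [h1, Multiset.card_zero, Nat.zero_div, pow_zero, one_mul]
  -- Each power becomes a product over the indices lying above `z`; the product over all `z` then
  -- regroups into one over the indices with `0 < θ j`.
  have h2 : ∀ z, z ^ kreinPos W z = ∏ j ∈ (Finset.univ.filter fun j => 0 < θ j) with
      Complex.exp (θ j * Complex.I) = z, Complex.exp (θ j * Complex.I) := by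
    intro z
    rw [h.kreinPos_eq, Finset.prod_congr rfl (g := fun _ => z), Finset.prod_const,
      Finset.filter_filter]
    intro j hj
    exact (Finset.mem_filter.1 hj).2
  simp only [h2]
  rw [Finset.prod_fiberwise_of_maps_to, ← Complex.exp_sum, ← Finset.sum_mul, h.rot_eq,
    h.sum_abs_eq]
  · congr 1
    have : (Real.pi : ℂ) ≠ 0 := by exact_mod_cast Real.pi_pos.ne'
    push_cast
    field_simp
    ring
  · intro j _
    simp only [Finset.mem_filter, Multiset.mem_toFinset]
    exact ⟨(hroot _).2 ⟨j, rfl⟩, Complex.norm_exp_ofReal_mul_I _, hne1 j, hne2 j⟩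

end KreinDiagonalizes

end ConvexSymp
end

noncomputable section

namespace ConvexSymp

/-! ### Symmetric functions of the eigenvalues and the arithmetic-geometric mean inequality -/

variable {n : ℕ}

/-- The inverse of a symplectic matrix, as a polynomial expression. -/
def symplecticInv (W : Matrix (Fin n ⊕ Fin n) (Fin n ⊕ Fin n) ℝ) :
    Matrix (Fin n ⊕ Fin n) (Fin n ⊕ Fin n) ℝ :=
  -(J₀ n * Wᵀ * J₀ n)

theorem symplecticInv_mul {W : Matrix (Fin n ⊕ Fin n) (Fin n ⊕ Fin n) ℝ}
    (hW : W ∈ Matrix.symplecticGroup (Fin n) ℝ) : symplecticInv W * W = 1 := by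
  have := SymplecticGroup.inv_left_mul_aux hW
  simpa [symplecticInv] using this

theorem mul_symplecticInv {W : Matrix (Fin n ⊕ Fin n) (Fin n ⊕ Fin n) ℝ}
    (hW : W ∈ Matrix.symplecticGroup (Fin n) ℝ) : W * symplecticInv W = 1 :=
  mul_eq_one_comm.1 (symplecticInv_mul hW)

theorem symplecticInv_one :
    symplecticInv (1 : Matrix (Fin n ⊕ Fin n) (Fin n ⊕ Fin n) ℝ) = 1 := by
  simp [symplecticInv, Matrix.J_squared]

theorem symplecticInv_mul_J (W A : Matrix (Fin n ⊕ Fin n) (Fin n ⊕ Fin n) ℝ) (hA : Aᵀ = A) :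
    symplecticInv (J₀ n * A * W) = -(symplecticInv W * J₀ n * A) := by
  have h2 : J₀ n * J₀ n = -1 := Matrix.J_squared _ _
  simp only [symplecticInv, Matrix.transpose_mul, hA, Matrix.J_transpose, neg_mul, mul_neg, neg_neg,
    mul_assoc]
  rw [← mul_assoc (J₀ n) (J₀ n) A, h2]
  simp

/-- The real part `(W + W⁻¹)/2` of a symplectic matrix. -/
def cosPart (W : Matrix (Fin n ⊕ Fin n) (Fin n ⊕ Fin n) ℝ) :
    Matrix (Fin n ⊕ Fin n) (Fin n ⊕ Fin n) ℝ :=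
  (2⁻¹ : ℝ) • (W + symplecticInv W)

theorem cosPart_one : cosPart (1 : Matrix (Fin n ⊕ Fin n) (Fin n ⊕ Fin n) ℝ) = 1 := by
  rw [cosPart, symplecticInv_one, ← two_smul ℝ, smul_smul]; norm_num

theorem continuous_symplecticInv : Continuous (symplecticInv (n := n)) := by
  unfold symplecticInv; fun_prop

theorem continuous_cosPart : Continuous (cosPart (n := n)) := by
  unfold cosPart
  exact (continuous_id.add continuous_symplecticInv).const_smul (2⁻¹ : ℝ)

theorem continuous_trace_aeval_cosPart (p : Polynomial ℝ) :
    Continuous fun W : Matrix (Fin n ⊕ Fin n) (Fin n ⊕ Fin n) ℝ =>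
      (Polynomial.aeval (cosPart W) p).trace := by
  refine Continuous.matrix_trace ?_
  exact p.continuous_aeval.comp continuous_cosPart

namespace KreinDiagonalizes

variable {W : Matrix (Fin n ⊕ Fin n) (Fin n ⊕ Fin n) ℝ}
  {V : Matrix (Fin n ⊕ Fin n) (Fin n ⊕ Fin n) ℂ} {θ : Fin n ⊕ Fin n → ℝ}

theorem symplecticInv_mul_eq (h : KreinDiagonalizes W V θ)
    (hW : W ∈ Matrix.symplecticGroup (Fin n) ℝ) :
    complexify (symplecticInv W) * V =
      V * Matrix.diagonal fun j => Complex.exp (-(θ j * Complex.I)) := by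
  have h1 : complexify (symplecticInv W) * complexify W = 1 := by
    rw [← complexify_mul, symplecticInv_mul hW, complexify_one]
  have h2 : (Matrix.diagonal fun j => Complex.exp (θ j * Complex.I)) *
      (Matrix.diagonal fun j => Complex.exp (-(θ j * Complex.I))) = 1 := by
    rw [Matrix.diagonal_mul_diagonal, ← Matrix.diagonal_one]
    congr 1; ext j
    rw [← Complex.exp_add, add_neg_cancel, Complex.exp_zero]
  calc complexify (symplecticInv W) * V
      = complexify (symplecticInv W) * (V * ((Matrix.diagonal fun j => Complex.exp (θ j * Complex.I)) *
      (Matrix.diagonal fun j => Complex.exp (-(θ j * Complex.I))))) := by rw [h2, mul_one]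
    _ = complexify (symplecticInv W) * complexify W * V *
      (Matrix.diagonal fun j => Complex.exp (-(θ j * Complex.I))) := by
        rw [← mul_assoc V, ← h.mul_eq]; simp only [mul_assoc]
    _ = _ := by rw [h1, one_mul]

theorem cosPart_mul_eq (h : KreinDiagonalizes W V θ)
    (hW : W ∈ Matrix.symplecticGroup (Fin n) ℝ) :
    complexify (cosPart W) * V = V * Matrix.diagonal fun j => (Real.cos (θ j) : ℂ) := by
  have h1 : complexify (cosPart W) =
      (2⁻¹ : ℂ) • (complexify W + complexify (symplecticInv W)) := by
    ext; simp [complexify, cosPart, mul_add]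
  rw [h1, Matrix.smul_mul, add_mul, h.mul_eq, h.symplecticInv_mul_eq hW, ← mul_add,
    ← Matrix.mul_smul, Matrix.diagonal_add, ← Matrix.diagonal_smul]
  congr 2; ext j
  simp only [Pi.smul_apply, smul_eq_mul, Complex.ofReal_cos, Complex.cos]
  rw [neg_mul]; ring

theorem aeval_cosPart_mul_eq (h : KreinDiagonalizes W V θ)
    (hW : W ∈ Matrix.symplecticGroup (Fin n) ℝ) (p : Polynomial ℝ) :
    complexify (Polynomial.aeval (cosPart W) p) * V =
      V * Matrix.diagonal fun j => ((p.eval (Real.cos (θ j)) : ℝ) : ℂ) := by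
  induction p using Polynomial.induction_on' with
  | add p q hp hq =>
    rw [map_add, complexify_add, add_mul, hp, hq, ← mul_add, Matrix.diagonal_add]
    congr 2; ext j; simp
  | monomial k a =>
    have hk : complexify (cosPart W ^ k) * V =
        V * Matrix.diagonal fun j => (Real.cos (θ j) : ℂ) ^ k := by
      induction k with
      | zero => simp [complexify_one]
      | succ k ih =>
        rw [pow_succ, complexify_mul, mul_assoc, h.cosPart_mul_eq hW, ← mul_assoc, ih, mul_assoc,
          Matrix.diagonal_mul_diagonal]
        simp only [pow_succ]
    have h1 : complexify (Polynomial.aeval (cosPart W) (Polynomial.monomial k a)) =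
        (a : ℂ) • complexify (cosPart W ^ k) := by
      rw [Polynomial.aeval_monomial, ← Algebra.smul_def]
      ext; simp [complexify]
    rw [h1, Matrix.smul_mul, hk, ← Matrix.mul_smul, ← Matrix.diagonal_smul]
    congr 2; ext j; simp

theorem trace_complexify (M : Matrix (Fin n ⊕ Fin n) (Fin n ⊕ Fin n) ℝ) :
    (complexify M).trace = (M.trace : ℂ) := by
  simp [Matrix.trace, complexify]

theorem trace_eq_of_mul_eq (h : KreinDiagonalizes W V θ)
    {M N : Matrix (Fin n ⊕ Fin n) (Fin n ⊕ Fin n) ℂ} (hM : M * V = V * N) : M.trace = N.trace := by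
  have h1 : M = V * N * V⁻¹ := by
    rw [← hM, mul_assoc, Matrix.mul_nonsing_inv _ h.isUnit_det, mul_one]
  rw [h1, Matrix.trace_mul_comm, ← mul_assoc, Matrix.nonsing_inv_mul _ h.isUnit_det, one_mul]

theorem trace_aeval_cosPart (h : KreinDiagonalizes W V θ)
    (hW : W ∈ Matrix.symplecticGroup (Fin n) ℝ) (p : Polynomial ℝ) :
    (Polynomial.aeval (cosPart W) p).trace = ∑ j, p.eval (Real.cos (θ j)) := by
  have h1 := h.trace_eq_of_mul_eq (h.aeval_cosPart_mul_eq hW p)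
  rw [trace_complexify, Matrix.trace_diagonal] at h1
  exact_mod_cast h1

/-- The determinant `∏ sin² θⱼ` depends continuously on `W` and controls the distance of all the
eigenvalues from `±1` at once. -/
theorem det_one_sub_cosPart_sq (h : KreinDiagonalizes W V θ)
    (hW : W ∈ Matrix.symplecticGroup (Fin n) ℝ) :
    (1 - cosPart W * cosPart W).det = ∏ j, (1 - Real.cos (θ j) ^ 2) := by
  have h1 : complexify (1 - cosPart W * cosPart W) * V =
      V * Matrix.diagonal fun j => (1 - (Real.cos (θ j) : ℂ) ^ 2) := by
    rw [complexify_sub, complexify_one, complexify_mul, sub_mul, mul_assoc, h.cosPart_mul_eq hW,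
      ← mul_assoc, h.cosPart_mul_eq hW, mul_assoc, Matrix.diagonal_mul_diagonal, one_mul]
    rw [← Matrix.diagonal_sub, mul_sub, Matrix.diagonal_one, mul_one]
    simp only [sq]
  have h2 := congrArg Matrix.det h1
  rw [Matrix.det_mul, Matrix.det_mul, mul_comm] at h2
  have h3 := mul_left_cancel₀ h.isUnit_det.ne_zero h2
  have h4 : (complexify (1 - cosPart W * cosPart W)).det =
      ((1 - cosPart W * cosPart W).det : ℂ) := by
    exact (RingHom.map_det Complex.ofRealHom _).symm
  rw [h4, Matrix.det_diagonal] at h3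
  exact_mod_cast h3

theorem sign_mul_conj_mul_krein (h : KreinDiagonalizes W V θ) :
    V⁻¹ = Matrix.diagonal (fun j => ((SignType.sign (θ j) : ℝ) : ℂ)) * Vᴴ * kreinMatrix n := by
  refine Matrix.inv_eq_left_inv ?_
  rw [mul_assoc, mul_assoc, ← mul_assoc Vᴴ, h.krein_eq, Matrix.diagonal_mul_diagonal,
    ← Matrix.diagonal_one]
  congr 1; ext j
  rcases lt_or_gt_of_ne (h.ne_zero j) with hj | hj
  · simp [sign_neg hj]
  · simp [sign_pos hj]

theorem sign_mul_sin (h : KreinDiagonalizes W V θ) (j : Fin n ⊕ Fin n) :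
    (SignType.sign (θ j) : ℝ) * Real.sin (θ j) = Real.sqrt (1 - Real.cos (θ j) ^ 2) := by
  have h0 := _root_.abs_lt.1 (h.abs_lt j)
  rw [← Real.abs_sin_eq_sqrt_one_sub_cos_sq]
  rcases lt_or_gt_of_ne (h.ne_zero j) with hj | hj
  · rw [sign_neg hj, abs_of_neg (Real.sin_neg_of_neg_of_neg_pi_lt hj h0.1)]; simp
  · rw [sign_pos hj, abs_of_pos (Real.sin_pos_of_pos_of_lt_pi hj h0.2)]; simp

/-- The matrix multiplied by `aeval (cosPart W) q` is the derivative of `cosPart` along `w' = J₀ A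
w`. In the basis `V` the matrices `W` and `W⁻¹` are diagonal and differ by `2i sin θⱼ`, while `J₀ A`
becomes `i sign(θⱼ) Vᴴ A V`. For `q = p'` the identity says that `∑ p(cos θⱼ)` changes as if `|θⱼ|`
had the derivative `(Vᴴ A V)ⱼⱼ`. -/
theorem trace_aeval_mul_deriv (h : KreinDiagonalizes W V θ)
    (hW : W ∈ Matrix.symplecticGroup (Fin n) ℝ) (q : Polynomial ℝ)
    (A : Matrix (Fin n ⊕ Fin n) (Fin n ⊕ Fin n) ℝ) :
    (Polynomial.aeval (cosPart W) q *
      ((2⁻¹ : ℝ) • (J₀ n * A * W - symplecticInv W * J₀ n * A))).trace =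
      -∑ j, q.eval (Real.cos (θ j)) * Real.sqrt (1 - Real.cos (θ j) ^ 2) *
        ((Vᴴ * complexify A * V) j j).re := by
  set Q := Polynomial.aeval (cosPart W) q with hQ
  have h1 : (Q * ((2⁻¹ : ℝ) • (J₀ n * A * W - symplecticInv W * J₀ n * A))).trace =
      2⁻¹ * ((W * Q - Q * symplecticInv W) * (J₀ n * A)).trace := by
    rw [Matrix.mul_smul, Matrix.trace_smul, smul_eq_mul, mul_sub, sub_mul, Matrix.trace_sub,
      Matrix.trace_sub, ← mul_assoc, Matrix.trace_mul_comm _ W]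
    simp only [mul_assoc]
  have h2 : complexify (W * Q - Q * symplecticInv W) * V = V * Matrix.diagonal fun j =>
      2 * Complex.I * (q.eval (Real.cos (θ j)) * Real.sin (θ j) : ℝ) := by
    rw [complexify_sub, complexify_mul, complexify_mul, sub_mul, mul_assoc, mul_assoc,
      h.aeval_cosPart_mul_eq hW, h.symplecticInv_mul_eq hW, ← mul_assoc, ← mul_assoc,
      h.aeval_cosPart_mul_eq hW, h.mul_eq, mul_assoc, mul_assoc, ← mul_sub,
      Matrix.diagonal_mul_diagonal, Matrix.diagonal_mul_diagonal, Matrix.diagonal_sub]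
    congr 2; ext j
    push_cast
    simp only [Complex.sin]
    rw [neg_mul]; ring_nf; rw [Complex.I_sq]; ring
  have h3 : complexify ((W * Q - Q * symplecticInv W) * (J₀ n * A)) * V = V * (Matrix.diagonal (fun j =>
      2 * Complex.I * (q.eval (Real.cos (θ j)) * Real.sin (θ j) : ℝ)) *
      (Matrix.diagonal (fun j => Complex.I * ((SignType.sign (θ j) : ℝ) : ℂ)) *
        (Vᴴ * complexify A * V))) := by
    have h4 : complexify (J₀ n * A) * V = V * (Matrix.diagonal
        (fun j => Complex.I * ((SignType.sign (θ j) : ℝ) : ℂ)) * (Vᴴ * complexify A * V)) := by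
      have h5 : V * (Matrix.diagonal (fun j => Complex.I * ((SignType.sign (θ j) : ℝ) : ℂ)) * Vᴴ) =
          complexify (J₀ n) := by
        -- Krein-orthonormality gives `V⁻¹ = sign(θ) Vᴴ K`, and `J₀ = i K` with `K² = 1`.
        have h6 : (Matrix.diagonal (fun j => Complex.I * ((SignType.sign (θ j) : ℝ) : ℂ)) * Vᴴ) =
            V⁻¹ * complexify (J₀ n) := by
          rw [h.sign_mul_conj_mul_krein, complexify_J, Matrix.mul_smul, mul_assoc _ (kreinMatrix n),
            kreinMatrix_mul_self, mul_one, ← Matrix.smul_mul, ← Matrix.diagonal_smul]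
          rfl
        rw [h6, ← mul_assoc, Matrix.mul_nonsing_inv _ h.isUnit_det, one_mul]
      rw [complexify_mul, ← h5]
      simp only [mul_assoc]
    rw [complexify_mul, mul_assoc, h4, ← mul_assoc, h2, mul_assoc]
  have h7 := h.trace_eq_of_mul_eq h3
  rw [trace_complexify, ← mul_assoc (Matrix.diagonal _) (Matrix.diagonal _), Matrix.diagonal_mul_diagonal] at h7
  rw [h1, ← Complex.ofReal_re (Matrix.trace _), h7, Matrix.trace, Complex.re_sum, Finset.mul_sum,
    ← Finset.sum_neg_distrib]
  refine Finset.sum_congr rfl fun j _ => ?_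
  rw [Matrix.diag_apply, Matrix.diagonal_mul, ← h.sign_mul_sin]
  have h8 : 2 * Complex.I * (q.eval (Real.cos (θ j)) * Real.sin (θ j) : ℝ) *
      (Complex.I * ((SignType.sign (θ j) : ℝ) : ℂ)) =
      ((-2 * (q.eval (Real.cos (θ j)) * Real.sin (θ j) * (SignType.sign (θ j) : ℝ)) : ℝ) : ℂ) := by
    push_cast; ring_nf; rw [Complex.I_sq]; ring
  rw [h8, Complex.re_ofReal_mul]
  ring

theorem normSq_det (h : KreinDiagonalizes W V θ) : star V.det * V.det = 1 := by
  have h1 := congrArg Matrix.det h.krein_eq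
  rw [Matrix.det_mul, Matrix.det_mul, Matrix.det_conjTranspose, Matrix.det_diagonal] at h1
  have hK : ‖(kreinMatrix n).det‖ = 1 := by
    have := congrArg (fun M => ‖Matrix.det M‖) (kreinMatrix_mul_self (n := n))
    simp only [Matrix.det_mul, Matrix.det_one, norm_mul, norm_one] at this
    nlinarith [norm_nonneg (kreinMatrix n).det]
  have h2 := congrArg norm h1
  rw [norm_mul, norm_mul, hK, norm_star, norm_prod, Finset.prod_eq_one] at h2
  · rw [Complex.star_def, ← Complex.normSq_eq_conj_mul_self, Complex.normSq_eq_norm_sq]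
    norm_cast
    linarith
  · intro j _
    rcases lt_or_gt_of_ne (h.ne_zero j) with hj | hj
    · simp [sign_neg hj]
    · simp [sign_pos hj]

open scoped ComplexOrder in
/-- The inequality between the arithmetic and the geometric mean, in a Krein-orthonormal basis. -/
theorem det_rpow_le (h : KreinDiagonalizes W V θ) (hn : 1 ≤ n)
    {A : Matrix (Fin n ⊕ Fin n) (Fin n ⊕ Fin n) ℝ} (hA : A.PosDef) :
    2 * n * A.det ^ (1 / (2 * (n : ℝ))) ≤ ∑ j, ((Vᴴ * complexify A * V) j j).re ∧
      ∀ j, 0 ≤ ((Vᴴ * complexify A * V) j j).re := by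
  obtain ⟨B, -, hB⟩ := exists_isUnit_complexify_eq hA
  set G := Vᴴ * complexify A * V with hG
  have hG' : G = (B * V)ᴴ * (B * V) := by
    rw [hG, hB, Matrix.conjTranspose_mul]; simp only [mul_assoc]
  have hpos : G.PosSemidef := by rw [hG']; exact Matrix.posSemidef_conjTranspose_mul_self _
  -- Since `|det V| = 1`, passing from `A` to `Vᴴ A V` keeps the determinant.
  have hdet : ∏ j, hpos.isHermitian.eigenvalues j = A.det := by
    have h1 := hpos.isHermitian.det_eq_prod_eigenvalues
    have h2 : G.det = (A.det : ℂ) := by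
      have h3 : (complexify A).det = (A.det : ℂ) := (RingHom.map_det Complex.ofRealHom _).symm
      rw [hG, Matrix.det_mul, Matrix.det_mul, Matrix.det_conjTranspose, mul_right_comm,
        h.normSq_det, one_mul, h3]
    rw [h2] at h1
    exact Complex.ofReal_injective (by rw [Complex.ofReal_prod]; exact h1.symm)
  have htr : ∑ j, hpos.isHermitian.eigenvalues j = ∑ j, (G j j).re := by
    have h1 := congrArg Complex.re hpos.isHermitian.trace_eq_sum_eigenvalues
    rw [Matrix.trace, Complex.re_sum, Complex.re_sum] at h1
    exact h1.symm
  have hn' : (0 : ℝ) < n := by exact_mod_cast hn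
  refine ⟨?_, fun j => ?_⟩
  · have hcard : (Finset.univ : Finset (Fin n ⊕ Fin n)).sum (fun _ => 1 / (2 * (n : ℝ))) = 1 := by
      simp
      field_simp
      ring
    have h1 := Real.geom_mean_le_arith_mean_weighted Finset.univ (fun _ => 1 / (2 * (n : ℝ)))
      hpos.isHermitian.eigenvalues (fun _ _ => by positivity) hcard
      (fun j _ => hpos.eigenvalues_nonneg j)
    rw [Real.finsetProd_rpow _ _ (fun j _ => hpos.eigenvalues_nonneg j), hdet, ← Finset.mul_sum,
      htr] at h1
    calc 2 * n * A.det ^ (1 / (2 * (n : ℝ)))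
        ≤ 2 * n * (1 / (2 * (n : ℝ)) * ∑ j, (G j j).re) := by gcongr
      _ = _ := by field_simp
  · exact (Complex.le_def.1 hpos.diag_nonneg).1

end KreinDiagonalizes

end ConvexSymp
end

noncomputable section

namespace ConvexSymp

/-! ### Derivatives of matrices and the Cayley transform -/

variable {n : ℕ}

/-- Here and below the statements involve only the topology of the matrix space; a submultiplicative
norm inducing it is chosen inside each proof. -/
theorem hasDerivWithinAt_matrix_mul {m : Type*} [Fintype m] [DecidableEq m]
    {A B : ℝ → Matrix m m ℝ} {A' B' : Matrix m m ℝ} {s : Set ℝ} {t : ℝ}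
    (hA : HasDerivWithinAt A A' s t) (hB : HasDerivWithinAt B B' s t) :
    HasDerivWithinAt (fun t => A t * B t) (A' * B t + A t * B') s t := by
  let _ := Matrix.linftyOpNormedRing (n := m) (α := ℝ)
  let _ := Matrix.linftyOpNormedAlgebra (n := m) (α := ℝ) (R := ℝ)
  exact HasDerivWithinAt.mul hA hB

theorem hasDerivWithinAt_matrix_const {m : Type*} [Fintype m] [DecidableEq m]
    (A : Matrix m m ℝ) (s : Set ℝ) (t : ℝ) : HasDerivWithinAt (fun _ => A) 0 s t := by
  let _ := Matrix.linftyOpNormedRing (n := m) (α := ℝ)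
  let _ := Matrix.linftyOpNormedAlgebra (n := m) (α := ℝ) (R := ℝ)
  exact hasDerivWithinAt_const t s A

theorem hasDerivWithinAt_matrix_add {m : Type*} [Fintype m] [DecidableEq m]
    {A B : ℝ → Matrix m m ℝ} {A' B' : Matrix m m ℝ} {s : Set ℝ} {t : ℝ}
    (hA : HasDerivWithinAt A A' s t) (hB : HasDerivWithinAt B B' s t) :
    HasDerivWithinAt (fun t => A t + B t) (A' + B') s t := by
  let _ := Matrix.linftyOpNormedRing (n := m) (α := ℝ)
  let _ := Matrix.linftyOpNormedAlgebra (n := m) (α := ℝ) (R := ℝ)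
  exact HasDerivWithinAt.add hA hB

theorem hasDerivWithinAt_matrix_linear {m F : Type*} [Fintype m] [DecidableEq m]
    [NormedAddCommGroup F] [NormedSpace ℝ F] (L : Matrix m m ℝ →ₗ[ℝ] F)
    {A : ℝ → Matrix m m ℝ} {A' : Matrix m m ℝ} {s : Set ℝ} {t : ℝ}
    (hA : HasDerivWithinAt A A' s t) : HasDerivWithinAt (fun t => L (A t)) (L A') s t := by
  let _ := Matrix.linftyOpNormedRing (n := m) (α := ℝ)
  let _ := Matrix.linftyOpNormedAlgebra (n := m) (α := ℝ) (R := ℝ)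
  exact (LinearMap.toContinuousLinearMap L).hasFDerivAt.comp_hasDerivWithinAt t hA

theorem hasDerivWithinAt_matrix_map {m : Type*} [Fintype m] [DecidableEq m]
    (L : Matrix m m ℝ →ₗ[ℝ] Matrix m m ℝ)
    {A : ℝ → Matrix m m ℝ} {A' : Matrix m m ℝ} {s : Set ℝ} {t : ℝ}
    (hA : HasDerivWithinAt A A' s t) : HasDerivWithinAt (fun t => L (A t)) (L A') s t := by
  let _ := Matrix.linftyOpNormedRing (n := m) (α := ℝ)
  let _ := Matrix.linftyOpNormedAlgebra (n := m) (α := ℝ) (R := ℝ)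
  exact (LinearMap.toContinuousLinearMap L).hasFDerivAt.comp_hasDerivWithinAt t hA

theorem hasDerivWithinAt_matrix_mono {m : Type*} [Fintype m] [DecidableEq m]
    {A : ℝ → Matrix m m ℝ} {A' : Matrix m m ℝ} {s s' : Set ℝ} {t : ℝ}
    (hA : HasDerivWithinAt A A' s t) (hs : s' ⊆ s) : HasDerivWithinAt A A' s' t := by
  let _ := Matrix.linftyOpNormedRing (n := m) (α := ℝ)
  let _ := Matrix.linftyOpNormedAlgebra (n := m) (α := ℝ) (R := ℝ)
  exact HasDerivWithinAt.mono hA hs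

theorem hasDerivWithinAt_const_matrix_mul {m : Type*} [Fintype m] [DecidableEq m]
    (A : Matrix m m ℝ) {B : ℝ → Matrix m m ℝ} {B' : Matrix m m ℝ} {s : Set ℝ} {t : ℝ}
    (hB : HasDerivWithinAt B B' s t) : HasDerivWithinAt (fun t => A * B t) (A * B') s t := by
  have := hasDerivWithinAt_matrix_mul (hasDerivWithinAt_matrix_const A s t) hB
  simpa using this

theorem hasDerivWithinAt_matrix_mul_const {m : Type*} [Fintype m] [DecidableEq m]
    {A : ℝ → Matrix m m ℝ} {A' : Matrix m m ℝ} (B : Matrix m m ℝ) {s : Set ℝ} {t : ℝ}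
    (hA : HasDerivWithinAt A A' s t) : HasDerivWithinAt (fun t => A t * B) (A' * B) s t := by
  have := hasDerivWithinAt_matrix_mul hA (hasDerivWithinAt_matrix_const B s t)
  simpa using this

theorem hasDerivWithinAt_matrix_inv {m : Type*} [Fintype m] [DecidableEq m]
    {A : ℝ → Matrix m m ℝ} {A' : Matrix m m ℝ} {s : Set ℝ} {t : ℝ}
    (hA : HasDerivWithinAt A A' s t) (h : (A t).det ≠ 0) :
    HasDerivWithinAt (fun t => (A t)⁻¹) (-((A t)⁻¹ * A' * (A t)⁻¹)) s t := by
  let _ := Matrix.linftyOpNormedRing (n := m) (α := ℝ)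
  let _ := Matrix.linftyOpNormedAlgebra (n := m) (α := ℝ) (R := ℝ)
  have hu : IsUnit (A t) := (Matrix.isUnit_iff_isUnit_det _).2 (isUnit_iff_ne_zero.2 h)
  obtain ⟨u, hu⟩ := hu
  have h1 := hasFDerivAt_ringInverse (𝕜 := ℝ) u
  rw [hu] at h1
  have h2 := h1.comp_hasDerivWithinAt t hA
  have h3 : (fun t => (A t)⁻¹) = Ring.inverse ∘ A := by
    ext1 t; exact Matrix.nonsing_inv_eq_ringInverse (A t)
  have h4 : ((u⁻¹ : (Matrix m m ℝ)ˣ) : Matrix m m ℝ) = (A t)⁻¹ := by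
    rw [Matrix.coe_units_inv, hu]
  rw [h3]
  refine h2.congr_deriv ?_
  simp [h4]

/-- The generating matrix of `W` given by the Cayley transform, for `W + 1` invertible. -/
def cayley (W : Matrix (Fin n ⊕ Fin n) (Fin n ⊕ Fin n) ℝ) :
    Matrix (Fin n ⊕ Fin n) (Fin n ⊕ Fin n) ℝ :=
  -(J₀ n * (W - 1) * (W + 1)⁻¹)

theorem cayley_one : cayley (1 : Matrix (Fin n ⊕ Fin n) (Fin n ⊕ Fin n) ℝ) = 0 := by
  simp [cayley]

theorem cayley_mul_add_one {W : Matrix (Fin n ⊕ Fin n) (Fin n ⊕ Fin n) ℝ}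
    (hW : (W + 1).det ≠ 0) : W - 1 = J₀ n * cayley W * (W + 1) := by
  have h1 : (W + 1)⁻¹ * (W + 1) = 1 := Matrix.nonsing_inv_mul _ (isUnit_iff_ne_zero.2 hW)
  have h2 : J₀ n * J₀ n = -1 := Matrix.J_squared _ _
  calc W - 1 = -(J₀ n * J₀ n) * (W - 1) * ((W + 1)⁻¹ * (W + 1)) := by rw [h1, h2]; simp
    _ = _ := by simp [cayley, mul_assoc]

theorem isSymm_cayley {W : Matrix (Fin n ⊕ Fin n) (Fin n ⊕ Fin n) ℝ}
    (hs : W ∈ Matrix.symplecticGroup (Fin n) ℝ) (hW : (W + 1).det ≠ 0) : (cayley W)ᵀ = cayley W := by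
  have hu : IsUnit (W + 1).det := isUnit_iff_ne_zero.2 hW
  have h1 : (W + 1)⁻¹ * (W + 1) = 1 := Matrix.nonsing_inv_mul _ hu
  have h1' : (W + 1)ᵀ * ((W + 1)⁻¹)ᵀ = 1 := by rw [← Matrix.transpose_mul, h1, Matrix.transpose_one]
  have hJ : Wᵀ * J₀ n * W = J₀ n := SymplecticGroup.mem_iff'.1 hs
  have hu2 : IsUnit (W + 1) := (Matrix.isUnit_iff_isUnit_det _).2 hu
  have hu3 : IsUnit (W + 1)ᵀ := by
    rw [Matrix.isUnit_iff_isUnit_det, Matrix.det_transpose]; exact hu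
  apply hu2.mul_right_cancel
  apply hu3.mul_left_cancel
  have e1 : (W + 1)ᵀ * ((cayley W)ᵀ * (W + 1)) = (Wᵀ - 1) * J₀ n * (W + 1) := by
    rw [cayley, Matrix.transpose_neg, Matrix.transpose_mul, Matrix.transpose_mul,
      Matrix.J_transpose, neg_mul, mul_neg, ← mul_assoc, ← mul_assoc, h1', one_mul]
    simp
  have e2 : (W + 1)ᵀ * (cayley W * (W + 1)) = -((Wᵀ + 1) * J₀ n * (W - 1)) := by
    rw [cayley, neg_mul, mul_assoc _ _ (W + 1), h1, mul_one, mul_neg]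
    simp [mul_assoc]
  rw [e1, e2]
  simp only [sub_mul, add_mul, mul_add, mul_sub, hJ, one_mul, mul_one]
  abel

/-- Follows from `(W + 1)ᵀ J₀ = Wᵀ J₀ (W + 1)`. It is what puts the derivative of the Cayley
transform into the form of a congruence. -/
theorem neg_J_mul_inv_mul_J {W : Matrix (Fin n ⊕ Fin n) (Fin n ⊕ Fin n) ℝ}
    (hs : W ∈ Matrix.symplecticGroup (Fin n) ℝ) (hW : (W + 1).det ≠ 0) :
    -(J₀ n * (W + 1)⁻¹ * J₀ n) = (W * (W + 1)⁻¹)ᵀ := by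
  have hu : IsUnit (W + 1).det := isUnit_iff_ne_zero.2 hW
  have h1 : (W + 1)⁻¹ * (W + 1) = 1 := Matrix.nonsing_inv_mul _ hu
  have h0 : (W + 1) * (W + 1)⁻¹ = 1 := Matrix.mul_nonsing_inv _ hu
  have h1' : (W + 1)ᵀ * ((W + 1)⁻¹)ᵀ = 1 := by rw [← Matrix.transpose_mul, h1, Matrix.transpose_one]
  have hJ : Wᵀ * J₀ n * W = J₀ n := SymplecticGroup.mem_iff'.1 hs
  have h2 : J₀ n * J₀ n = -1 := Matrix.J_squared _ _
  have hu3 : IsUnit (W + 1)ᵀ := by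
    rw [Matrix.isUnit_iff_isUnit_det, Matrix.det_transpose]; exact hu
  apply hu3.mul_left_cancel
  rw [Matrix.transpose_mul, ← mul_assoc, h1', one_mul]
  have h3 : (W + 1)ᵀ * J₀ n = Wᵀ * J₀ n * (W + 1) := by
    rw [mul_add, hJ, mul_one, Matrix.transpose_add, Matrix.transpose_one, add_mul, one_mul, add_comm]
  calc (W + 1)ᵀ * -(J₀ n * (W + 1)⁻¹ * J₀ n)
      = -(((W + 1)ᵀ * J₀ n) * (W + 1)⁻¹ * J₀ n) := by simp only [mul_neg, mul_assoc]
    _ = -(Wᵀ * (J₀ n * (((W + 1) * (W + 1)⁻¹) * J₀ n))) := by rw [h3]; simp only [mul_assoc]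
    _ = Wᵀ := by rw [h0, one_mul, h2]; simp

theorem hasDerivWithinAt_cayley {w : ℝ → Matrix (Fin n ⊕ Fin n) (Fin n ⊕ Fin n) ℝ}
    {A : Matrix (Fin n ⊕ Fin n) (Fin n ⊕ Fin n) ℝ} {s : Set ℝ} {t : ℝ}
    (hw : HasDerivWithinAt w (J₀ n * A * w t) s t)
    (hs : w t ∈ Matrix.symplecticGroup (Fin n) ℝ) (hdet : (w t + 1).det ≠ 0) :
    HasDerivWithinAt (fun t => cayley (w t))
      ((2 : ℝ) • ((w t * (w t + 1)⁻¹)ᵀ * A * (w t * (w t + 1)⁻¹))) s t := by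
  have h1 : HasDerivWithinAt (fun t => w t - 1) (J₀ n * A * w t) s t := by
    simpa [sub_eq_add_neg] using hasDerivWithinAt_matrix_add hw (hasDerivWithinAt_matrix_const (-1) s t)
  have h2 : HasDerivWithinAt (fun t => w t + 1) (J₀ n * A * w t) s t := by
    simpa using hasDerivWithinAt_matrix_add hw (hasDerivWithinAt_matrix_const 1 s t)
  have h3 := hasDerivWithinAt_matrix_inv h2 hdet
  have h4 := hasDerivWithinAt_matrix_map (-LinearMap.id)
    (hasDerivWithinAt_matrix_mul (hasDerivWithinAt_const_matrix_mul (J₀ n) h1) h3)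
  have h0 : (w t + 1) * (w t + 1)⁻¹ = 1 := Matrix.mul_nonsing_inv _ (isUnit_iff_ne_zero.2 hdet)
  rw [← neg_J_mul_inv_mul_J hs hdet]
  set R := (w t + 1)⁻¹ with hR
  -- With this the two terms of the derivative combine into a single one, `-2 J₀ R J₀ A (w R)`.
  have h5 : (w t - 1) * R = 1 - (2 : ℝ) • R := by
    have : w t - 1 = (w t + 1) - (2 : ℝ) • 1 := by rw [two_smul]; abel
    rw [this, sub_mul, h0, Matrix.smul_mul, one_mul]
  have key : -(J₀ n * (J₀ n * A * w t) * R + J₀ n * (w t - 1) * -(R * (J₀ n * A * w t) * R)) =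
      (2 : ℝ) • (-(J₀ n * R * J₀ n) * A * (w t * R)) := by
    calc -(J₀ n * (J₀ n * A * w t) * R + J₀ n * (w t - 1) * -(R * (J₀ n * A * w t) * R))
        = -(J₀ n * (J₀ n * A * w t) * R - J₀ n * ((w t - 1) * R) * (J₀ n * A * w t) * R) := by
          simp only [mul_neg, mul_assoc, sub_eq_add_neg]
      _ = _ := by
          rw [h5]
          simp only [mul_sub, sub_mul, mul_one, Matrix.mul_smul, Matrix.smul_mul, neg_mul, smul_neg,
            mul_assoc]
          abel
  rw [← key]
  exact h4

theorem continuousAt_cayley {W : Matrix (Fin n ⊕ Fin n) (Fin n ⊕ Fin n) ℝ}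
    (hW : (W + 1).det ≠ 0) : ContinuousAt cayley W := by
  have h1 : ContinuousAt (fun W : Matrix (Fin n ⊕ Fin n) (Fin n ⊕ Fin n) ℝ => (W + 1)⁻¹) W := by
    have h2 : ContinuousAt (fun W : Matrix (Fin n ⊕ Fin n) (Fin n ⊕ Fin n) ℝ =>
        ((W + 1).det)⁻¹ • (W + 1).adjugate) W := by
      refine ContinuousAt.smul (M := ℝ) (ContinuousAt.inv₀ ?_ hW) ?_
      · exact (Continuous.matrix_det (by fun_prop)).continuousAt
      · exact (Continuous.matrix_adjugate (by fun_prop)).continuousAt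
    refine h2.congr (Eventually.of_forall fun M => ?_)
    simp [Matrix.inv_def]
  have h3 : Continuous fun W : Matrix (Fin n ⊕ Fin n) (Fin n ⊕ Fin n) ℝ => J₀ n * (W - 1) := by
    fun_prop
  exact (h3.continuousAt.mul h1).neg

/-- The derivative is `2 Mᵀ A M` with `M = W (W + 1)⁻¹` invertible, so `v ⬝ cayley (w t) v`
increases strictly for each `v ≠ 0`. The path need not start at the identity, which allows the use
on increments over short intervals. -/
theorem cayley_sub_posDef {w a : ℝ → Matrix (Fin n ⊕ Fin n) (Fin n ⊕ Fin n) ℝ} {s : Set ℝ}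
    (hsconv : Convex ℝ s) (hs : ∀ t ∈ s, w t ∈ Matrix.symplecticGroup (Fin n) ℝ)
    (hw : ∀ t ∈ s, HasDerivWithinAt w (J₀ n * a t * w t) s t) (ha : ∀ t ∈ s, (a t).PosDef)
    (hdet : ∀ t ∈ s, (w t + 1).det ≠ 0) {t₁ t₂ : ℝ} (h₁ : t₁ ∈ s) (h₂ : t₂ ∈ s) (hlt : t₁ < t₂) :
    (cayley (w t₂) - cayley (w t₁)).PosDef := by
  refine Matrix.PosDef.of_dotProduct_mulVec_pos ?_ fun v hv => ?_
  · rw [Matrix.IsHermitian, Matrix.conjTranspose_eq_transpose_of_trivial, Matrix.transpose_sub,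
      isSymm_cayley (hs _ h₁) (hdet _ h₁), isSymm_cayley (hs _ h₂) (hdet _ h₂)]
  · let L : Matrix (Fin n ⊕ Fin n) (Fin n ⊕ Fin n) ℝ →ₗ[ℝ] ℝ :=
      { toFun := fun M => star v ⬝ᵥ (M *ᵥ v)
        map_add' := fun M N => by rw [Matrix.add_mulVec, dotProduct_add]
        map_smul' := fun c M => by rw [Matrix.smul_mulVec, dotProduct_smul]; rfl }
    have hd : ∀ t ∈ s, HasDerivWithinAt (fun t => L (cayley (w t)))
        (L ((2 : ℝ) • ((w t * (w t + 1)⁻¹)ᵀ * a t * (w t * (w t + 1)⁻¹)))) s t := fun t ht =>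
      hasDerivWithinAt_matrix_linear L
        (hasDerivWithinAt_cayley (hw t ht) (hs t ht) (hdet t ht))
    have hpos : ∀ t ∈ s, 0 < L ((2 : ℝ) • ((w t * (w t + 1)⁻¹)ᵀ * a t * (w t * (w t + 1)⁻¹))) := by
      intro t ht
      rw [map_smul, smul_eq_mul]
      refine mul_pos two_pos ?_
      have hinj : Function.Injective (w t * (w t + 1)⁻¹).mulVec := by
        apply Matrix.mulVec_injective_of_isUnit
        refine IsUnit.mul ?_ ?_
        · exact (Matrix.isUnit_iff_isUnit_det _).2 (SymplecticGroup.symplectic_det (hs t ht))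
        · rw [Matrix.isUnit_nonsing_inv_iff, Matrix.isUnit_iff_isUnit_det]
          exact isUnit_iff_ne_zero.2 (hdet t ht)
      have := (ha t ht).conjTranspose_mul_mul_same hinj
      rw [Matrix.conjTranspose_eq_transpose_of_trivial] at this
      exact this.dotProduct_mulVec_pos hv
    have hmono : StrictMonoOn (fun t => L (cayley (w t))) s := by
      refine strictMonoOn_of_hasDerivWithinAt_pos hsconv (fun t ht => (hd t ht).continuousWithinAt)
        (fun t ht => (hd t (interior_subset ht)).mono interior_subset)
        (fun t ht => hpos t (interior_subset ht))
    have h3 := hmono h₁ h₂ hlt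
    have h4 : L (cayley (w t₂) - cayley (w t₁)) = L (cayley (w t₂)) - L (cayley (w t₁)) :=
      map_sub L _ _
    change 0 < L (cayley (w t₂) - cayley (w t₁))
    rw [h4]
    exact sub_pos.2 h3

end ConvexSymp
end

noncomputable section

namespace ConvexSymp

/-! ### Positive paths of symplectic matrices -/

variable {n : ℕ}

/-- Symplectic matrices which are the identity or Krein-diagonalizable with matching signs. -/
def IsElliptic (W : Matrix (Fin n ⊕ Fin n) (Fin n ⊕ Fin n) ℝ) : Prop :=
  W ∈ Matrix.symplecticGroup (Fin n) ℝ ∧ (W = 1 ∨ ∃ V θ, KreinDiagonalizes W V θ)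

theorem rot_one : rot (1 : Matrix (Fin n ⊕ Fin n) (Fin n ⊕ Fin n) ℝ) = 0 := by
  rw [rot, complexify_one, ← Matrix.diagonal_one, Matrix.charpoly_diagonal]
  have := Polynomial.roots_multiset_prod_X_sub_C
    (Finset.univ.val.map fun _ : Fin n ⊕ Fin n => (1 : ℂ))
  rw [Multiset.map_map] at this
  rw [show ∏ _i : Fin n ⊕ Fin n, (Polynomial.X - Polynomial.C (1 : ℂ)) = (Multiset.map
    ((fun a => Polynomial.X - Polynomial.C a) ∘ fun _ => 1) Finset.univ.val).prod from rfl, this]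
  simp

theorem upsilon_one : upsilon (1 : Sp n) = 1 := by
  have h1 : (1 : Matrix (Fin n ⊕ Fin n) (Fin n ⊕ Fin n) ℝ).charpoly.roots =
      Finset.univ.val.map fun _ : Fin n ⊕ Fin n => (1 : ℝ) := by
    have := Polynomial.roots_multiset_prod_X_sub_C
      (Finset.univ.val.map fun _ : Fin n ⊕ Fin n => (1 : ℝ))
    rw [Multiset.map_map] at this
    rw [← Matrix.diagonal_one, Matrix.charpoly_diagonal]
    exact this
  have h2 : (1 : Matrix (Fin n ⊕ Fin n) (Fin n ⊕ Fin n) ℂ).charpoly.roots =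
      Finset.univ.val.map fun _ : Fin n ⊕ Fin n => (1 : ℂ) := by
    have := Polynomial.roots_multiset_prod_X_sub_C
      (Finset.univ.val.map fun _ : Fin n ⊕ Fin n => (1 : ℂ))
    rw [Multiset.map_map] at this
    rw [← Matrix.diagonal_one, Matrix.charpoly_diagonal]
    exact this
  have h3 : ((1 : Matrix (Fin n ⊕ Fin n) (Fin n ⊕ Fin n) ℝ).charpoly.roots.filter
      fun r => r < 0) = 0 := by
    rw [Multiset.filter_eq_nil, h1]
    intro r hr
    obtain ⟨_, -, rfl⟩ := Multiset.mem_map.1 hr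
    norm_num
  rw [upsilon]
  simp only [OneMemClass.coe_one, h3, complexify_one, h2]
  rw [Finset.prod_eq_one]
  · simp
  · intro z hz
    simp only [Finset.mem_filter, Multiset.mem_toFinset] at hz
    obtain ⟨_, -, h⟩ := Multiset.mem_map.1 hz.1
    exact absurd h.symm hz.2.2.1

theorem upsilon_eq_exp_rot {W : Sp n} (hW : IsElliptic W.1) :
    upsilon W = Complex.exp (2 * Real.pi * Complex.I * rot W.1) := by
  rcases hW.2 with h | ⟨V, θ, h⟩
  · have h1 : W = 1 := Subtype.ext h
    subst h1
    rw [upsilon_one]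
    simp [rot_one]
  · exact h.upsilon_eq

/-- The eigenvalues of `(W + W⁻¹)/2` and the rotation number of an elliptic `W`. -/
theorem IsElliptic.exists_cos {W : Matrix (Fin n ⊕ Fin n) (Fin n ⊕ Fin n) ℝ} (hW : IsElliptic W) :
    ∃ c : Fin n ⊕ Fin n → ℝ, (∀ j, c j ∈ Icc (-1) 1) ∧
      4 * Real.pi * rot W = ∑ j, Real.arccos (c j) ∧
      ∀ p : Polynomial ℝ, (Polynomial.aeval (cosPart W) p).trace = ∑ j, p.eval (c j) := by
  rcases hW.2 with rfl | ⟨V, θ, h⟩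
  · refine ⟨fun _ => 1, fun _ => by norm_num, by simp [rot_one], fun p => ?_⟩
    · rw [cosPart_one]
      have : Polynomial.aeval (1 : Matrix (Fin n ⊕ Fin n) (Fin n ⊕ Fin n) ℝ) p =
          (p.eval 1) • 1 := by
        have := Polynomial.aeval_algebraMap_apply (Matrix (Fin n ⊕ Fin n) (Fin n ⊕ Fin n) ℝ) (1 : ℝ) p
        rw [map_one] at this
        rw [this, Algebra.algebraMap_eq_smul_one, Polynomial.coe_aeval_eq_eval]
      rw [this, Matrix.trace_smul, Matrix.trace_one]
      simp [mul_comm]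
  · refine ⟨fun j => Real.cos (θ j), fun j => Real.cos_mem_Icc _, ?_,
      fun p => h.trace_aeval_cosPart hW.1 p⟩
    rw [h.rot_eq, ← mul_assoc, mul_inv_cancel₀ (by positivity), one_mul]
    refine Finset.sum_congr rfl fun j _ => ?_
    exact (by rw [← Real.cos_abs, Real.arccos_cos (abs_nonneg _) (h.abs_lt j).le] :
      |θ j| = Real.arccos (Real.cos (θ j)))

/-- Weierstrass approximation of `arccos` on `[-1, 1]` makes `4π rot` a uniform limit of the
continuous functions `W ↦ tr p(cosPart W)`. -/
theorem continuousOn_rot : ContinuousOn (rot (n := n)) {W | IsElliptic W} := by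
  have key : ContinuousOn (fun W => 4 * Real.pi * rot (n := n) W) {W | IsElliptic W} := by
    refine continuousOn_of_uniform_approx_of_continuousOn fun u hu => ?_
    obtain ⟨ε, hε, hu⟩ := Metric.mem_uniformity_dist.1 hu
    -- There are `2n` eigenvalues; the extra `1` makes the final inequality strict, also for `n =
    -- 0`.
    obtain ⟨p, hp⟩ := exists_polynomial_near_of_continuousOn (-1) 1 Real.arccos
      Real.continuous_arccos.continuousOn (ε / (2 * n + 1)) (by positivity)
    refine ⟨fun W => (Polynomial.aeval (cosPart W) p).trace,
      (continuous_trace_aeval_cosPart p).continuousOn, fun W hW => hu ?_⟩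
    obtain ⟨c, hc, h1, h2⟩ := IsElliptic.exists_cos hW
    simp only [h2]
    rw [h1, dist_comm, Real.dist_eq, ← Finset.sum_sub_distrib]
    calc |∑ j, (p.eval (c j) - Real.arccos (c j))|
        ≤ ∑ j, |p.eval (c j) - Real.arccos (c j)| := Finset.abs_sum_le_sum_abs _ _
      _ ≤ ∑ _j : Fin n ⊕ Fin n, ε / (2 * n + 1) :=
          Finset.sum_le_sum fun j _ => (hp _ (hc j)).le
      _ = (2 * n) * (ε / (2 * n + 1)) := by
          rw [Finset.sum_const, Finset.card_univ]; simp; ring_nf; simp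
      _ < ε := by
          rw [mul_div_assoc', div_lt_iff₀ (by positivity)]
          nlinarith
  have h2 : rot (n := n) = fun W => (4 * Real.pi)⁻¹ * (4 * Real.pi * rot W) := by
    ext W
    rw [← mul_assoc, inv_mul_cancel₀ (by positivity), one_mul]
  rw [h2]
  exact continuousOn_const.mul key

theorem exists_derivative_eq (q : Polynomial ℝ) : ∃ p : Polynomial ℝ, p.derivative = q := by
  induction q using Polynomial.induction_on' with
  | add q₁ q₂ h₁ h₂ =>
    obtain ⟨p₁, rfl⟩ := h₁
    obtain ⟨p₂, rfl⟩ := h₂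
    exact ⟨p₁ + p₂, Polynomial.derivative_add⟩
  | monomial k a =>
    refine ⟨Polynomial.monomial (k + 1) (a / (k + 1)), ?_⟩
    rw [Polynomial.derivative_monomial]
    congr 1
    push_cast
    field_simp

/-- The derivative of `arccos` is approximated and then integrated, so that values and derivatives
are controlled together. It is unbounded near `±1`, whence the interval `[-b, b]`. The constant `k`
cancels when two times are compared. -/
theorem exists_polynomial_near_arccos {b ε : ℝ} (hb : b < 1) (hε : 0 < ε) :
    ∃ (p : Polynomial ℝ) (k : ℝ), (∀ c ∈ Icc (-b) b, |p.eval c - Real.arccos c - k| ≤ ε) ∧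
      ∀ c ∈ Icc (-b) b, p.derivative.eval c * Real.sqrt (1 - c ^ 2) ≤ -(1 - ε) := by
  have hsq : ∀ c ∈ Icc (-b) b, 0 < Real.sqrt (1 - c ^ 2) := by
    intro c hc
    apply Real.sqrt_pos.2
    nlinarith [hc.1, hc.2]
  obtain ⟨q, hq⟩ := exists_polynomial_near_of_continuousOn (-b) b
    (fun c => -(1 / Real.sqrt (1 - c ^ 2)))
    (by
      refine (continuousOn_const.div (by fun_prop) fun c hc => (hsq c hc).ne').neg) ε hε
  obtain ⟨p, rfl⟩ := exists_derivative_eq q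
  refine ⟨p, p.eval 0 - Real.arccos 0, fun c hc => ?_, fun c hc => ?_⟩
  · have h0 : (0 : ℝ) ∈ Icc (-b) b := ⟨by linarith [hc.1, hc.2], by linarith [hc.1, hc.2]⟩
    have h1 : ∀ x ∈ Icc (-b) b, HasDerivWithinAt (fun x => p.eval x - Real.arccos x)
        (p.derivative.eval x - -(1 / Real.sqrt (1 - x ^ 2))) (Icc (-b) b) x := by
      intro x hx
      exact ((p.hasDerivAt x).sub (Real.hasDerivAt_arccos (by linarith [hx.1]) 
        (by linarith [hx.2]))).hasDerivWithinAt
    have h2 := Convex.norm_image_sub_le_of_norm_hasDerivWithin_le h1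
      (fun x hx => (Real.norm_eq_abs _).trans_le (hq x hx).le) (convex_Icc _ _) h0 hc
    have h3 : |c| ≤ 1 := abs_le.2 ⟨by linarith [hc.1], by linarith [hc.2]⟩
    rw [Real.norm_eq_abs, sub_zero, Real.norm_eq_abs] at h2
    exact h2.trans (mul_le_of_le_one_right hε.le h3)
  · have h1 := (abs_lt.1 (hq c hc)).2
    have h2 := hsq c hc
    have h3 : Real.sqrt (1 - c ^ 2) ≤ 1 := Real.sqrt_le_one.2 (by nlinarith [sq_nonneg c])
    have h4 : p.derivative.eval c ≤ ε - 1 / Real.sqrt (1 - c ^ 2) := by linarith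
    calc p.derivative.eval c * Real.sqrt (1 - c ^ 2)
        ≤ (ε - 1 / Real.sqrt (1 - c ^ 2)) * Real.sqrt (1 - c ^ 2) := by gcongr
      _ = ε * Real.sqrt (1 - c ^ 2) - 1 := by field_simp
      _ ≤ _ := by nlinarith

/-- `C` and `C'` need not commute, so the power rule holds only under a trace. Pairing with every
power `C ^ l` makes the induction close. -/
theorem hasDerivWithinAt_trace_pow {m : Type*} [Fintype m] [DecidableEq m]
    {C : ℝ → Matrix m m ℝ} {C' : Matrix m m ℝ} {s : Set ℝ} {t : ℝ}
    (hC : HasDerivWithinAt C C' s t) (k : ℕ) :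
    ∃ D, HasDerivWithinAt (fun t => C t ^ (k + 1)) D s t ∧
      ∀ l, (D * C t ^ l).trace = (k + 1) * (C t ^ (k + l) * C').trace := by
  induction k with
  | zero =>
    refine ⟨C', by simpa using hC, fun l => ?_⟩
    rw [Matrix.trace_mul_comm]; simp
  | succ k ih =>
    obtain ⟨D, hD, hl⟩ := ih
    refine ⟨D * C t + C t ^ (k + 1) * C', ?_, fun l => ?_⟩
    · simpa only [pow_succ _ (k + 1)] using hasDerivWithinAt_matrix_mul hD hC
    · rw [add_mul, Matrix.trace_add, mul_assoc, ← pow_succ', hl, Matrix.trace_mul_comm _ (C t ^ l),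
        ← mul_assoc, ← pow_add, show k + (l + 1) = k + 1 + l by ring, add_comm l (k + 1)]
      push_cast; ring

theorem hasDerivWithinAt_trace_aeval {m : Type*} [Fintype m] [DecidableEq m]
    {C : ℝ → Matrix m m ℝ} {C' : Matrix m m ℝ} {s : Set ℝ} {t : ℝ}
    (hC : HasDerivWithinAt C C' s t) (p : Polynomial ℝ) :
    HasDerivWithinAt (fun t => (Polynomial.aeval (C t) p).trace)
      ((Polynomial.aeval (C t) p.derivative) * C').trace s t := by
  induction p using Polynomial.induction_on' with
  | add p q hp hq =>
    simp only [map_add, Matrix.trace_add, add_mul]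
    exact hp.add hq
  | monomial k a =>
    cases k with
    | zero =>
      simp only [Polynomial.monomial_zero_left, Polynomial.aeval_C, Polynomial.derivative_C, map_zero,
        zero_mul, Matrix.trace_zero]
      exact hasDerivWithinAt_const _ _ _
    | succ k =>
      obtain ⟨D, hD, hl⟩ := hasDerivWithinAt_trace_pow hC k
      have h1 := (hasDerivWithinAt_matrix_linear (Matrix.traceLinearMap m ℝ ℝ) hD).const_mul a
      have h2 := hl 0
      simp only [pow_zero, mul_one, add_zero] at h2
      simp only [Polynomial.derivative_monomial, Polynomial.aeval_monomial, ← Algebra.smul_def,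
        Matrix.trace_smul, Matrix.smul_mul, smul_eq_mul, Nat.add_sub_cancel]
      refine h1.congr_deriv ?_
      rw [Matrix.traceLinearMap_apply, h2]
      push_cast; ring

theorem hasDerivWithinAt_cosPart {w : ℝ → Matrix (Fin n ⊕ Fin n) (Fin n ⊕ Fin n) ℝ}
    {A : Matrix (Fin n ⊕ Fin n) (Fin n ⊕ Fin n) ℝ} {s : Set ℝ} {t : ℝ} (hA : Aᵀ = A)
    (hw : HasDerivWithinAt w (J₀ n * A * w t) s t) :
    HasDerivWithinAt (fun t => cosPart (w t))
      ((2⁻¹ : ℝ) • (J₀ n * A * w t - symplecticInv (w t) * J₀ n * A)) s t := by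
  let L : Matrix (Fin n ⊕ Fin n) (Fin n ⊕ Fin n) ℝ →ₗ[ℝ] Matrix (Fin n ⊕ Fin n) (Fin n ⊕ Fin n) ℝ :=
    { toFun := cosPart
      map_add' := fun M N => by
        simp only [cosPart, symplecticInv, Matrix.transpose_add, mul_add, add_mul, smul_add]; abel_nf
        simp
      map_smul' := fun c M => by
        simp [cosPart, symplecticInv, smul_comm c (2⁻¹ : ℝ)] }
  have h1 := hasDerivWithinAt_matrix_map L hw
  have h2 : L (J₀ n * A * w t) =
      (2⁻¹ : ℝ) • (J₀ n * A * w t - symplecticInv (w t) * J₀ n * A) := by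
    change (2⁻¹ : ℝ) • (J₀ n * A * w t + symplecticInv (J₀ n * A * w t)) = _
    rw [symplecticInv_mul_J _ _ hA, sub_eq_add_neg]
  rw [← h2]
  exact h1

/-- A positive path of symplectic matrices starting at the identity, with generator `a`. -/
structure IsPositiveLinearPath (w a : ℝ → Matrix (Fin n ⊕ Fin n) (Fin n ⊕ Fin n) ℝ) : Prop where
  symplectic : ∀ t ∈ Icc (0 : ℝ) 1, w t ∈ Matrix.symplecticGroup (Fin n) ℝ
  zero : w 0 = 1
  hasDerivWithinAt : ∀ t ∈ Icc (0 : ℝ) 1, HasDerivWithinAt w (J₀ n * a t * w t) (Icc 0 1) t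
  posDef : ∀ t ∈ Icc (0 : ℝ) 1, (a t).PosDef

namespace IsPositiveLinearPath

variable {w a : ℝ → Matrix (Fin n ⊕ Fin n) (Fin n ⊕ Fin n) ℝ}

theorem continuousOn (h : IsPositiveLinearPath w a) : ContinuousOn w (Icc 0 1) := by
  let _ := Matrix.linftyOpNormedRing (n := Fin n ⊕ Fin n) (α := ℝ)
  let _ := Matrix.linftyOpNormedAlgebra (n := Fin n ⊕ Fin n) (α := ℝ) (R := ℝ)
  exact fun t ht => HasDerivWithinAt.continuousWithinAt (h.hasDerivWithinAt t ht)

/-- The Cayley transform is zero at time `0` and strictly increasing, hence positive definite at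
every later time. -/
theorem exists_kreinDiagonalizes (h : IsPositiveLinearPath w a)
    (hdet : ∀ t ∈ Icc (0 : ℝ) 1, (w t + 1).det ≠ 0) {t : ℝ} (ht : t ∈ Ioc (0 : ℝ) 1) :
    ∃ V θ, KreinDiagonalizes (w t) V θ := by
  have h0 : (0 : ℝ) ∈ Icc (0 : ℝ) 1 := ⟨le_rfl, zero_le_one⟩
  have ht' : t ∈ Icc (0 : ℝ) 1 := ⟨ht.1.le, ht.2⟩
  have h1 := cayley_sub_posDef (convex_Icc 0 1) h.symplectic h.hasDerivWithinAt h.posDef hdet h0 ht'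
    ht.1
  rw [h.zero, cayley_one, sub_zero] at h1
  exact ConvexSymp.exists_kreinDiagonalizes h1 (cayley_mul_add_one (hdet t ht'))

theorem isElliptic (h : IsPositiveLinearPath w a)
    (hdet : ∀ t ∈ Icc (0 : ℝ) 1, (w t + 1).det ≠ 0) {t : ℝ} (ht : t ∈ Icc (0 : ℝ) 1) :
    IsElliptic (w t) := by
  refine ⟨h.symplectic t ht, ?_⟩
  rcases ht.1.eq_or_lt with rfl | h0
  · exact Or.inl h.zero
  · exact Or.inr (h.exists_kreinDiagonalizes hdet ⟨h0, ht.2⟩)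

/-- Away from time `0` the eigenvalues stay away from `±1`. -/
theorem exists_cos_le (h : IsPositiveLinearPath w a)
    (hdet : ∀ t ∈ Icc (0 : ℝ) 1, (w t + 1).det ≠ 0) {t₀ : ℝ} (ht₀ : t₀ ∈ Ioc (0 : ℝ) 1) :
    ∃ b < 1, ∀ t ∈ Icc t₀ 1, ∀ V θ, KreinDiagonalizes (w t) V θ →
      ∀ j, Real.cos (θ j) ∈ Icc (-b) b := by
  have hsub : Icc t₀ 1 ⊆ Icc (0 : ℝ) 1 := Icc_subset_Icc_left ht₀.1.le
  have hcont : ContinuousOn (fun t => (1 - cosPart (w t) * cosPart (w t)).det) (Icc t₀ 1) := by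
    have h1 : Continuous fun W : Matrix (Fin n ⊕ Fin n) (Fin n ⊕ Fin n) ℝ =>
        (1 - cosPart W * cosPart W).det :=
      Continuous.matrix_det (continuous_const.sub (continuous_cosPart.mul continuous_cosPart))
    exact h1.comp_continuousOn (h.continuousOn.mono hsub)
  -- The continuous function `∏ sin² θⱼ` has a positive minimum `m` on the compact interval.
  obtain ⟨t₁, ht₁, hmin⟩ := isCompact_Icc.exists_isMinOn ⟨1, ht₀.2, le_rfl⟩ hcont
  set m := (1 - cosPart (w t₁) * cosPart (w t₁)).det with hm
  have hsq : ∀ {θ : ℝ}, |θ| < Real.pi → θ ≠ 0 → 0 < 1 - Real.cos θ ^ 2 := by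
    intro θ h1 h2
    rw [← Real.sin_sq]
    refine sq_pos_of_ne_zero ?_
    have h0 := abs_lt.1 h1
    rcases lt_or_gt_of_ne h2 with hj | hj
    · exact (Real.sin_neg_of_neg_of_neg_pi_lt hj h0.1).ne
    · exact (Real.sin_pos_of_pos_of_lt_pi hj h0.2).ne'
  have hm0 : 0 < m := by
    obtain ⟨V, θ, hk⟩ := h.exists_kreinDiagonalizes hdet ⟨ht₀.1.trans_le ht₁.1, ht₁.2⟩
    rw [hm, hk.det_one_sub_cosPart_sq (h.symplectic _ (hsub ht₁))]
    exact Finset.prod_pos fun j _ => hsq (hk.abs_lt j) (hk.ne_zero j)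
  -- Each factor `sin² θᵢ` is at most `1`, so each is at least the product, hence at least `m`; this
  -- means `cos² θⱼ ≤ 1 - m`.
  refine ⟨Real.sqrt (1 - m), ?_, fun t ht V θ hk j => ?_⟩
  · rw [Real.sqrt_lt' one_pos]; linarith
  · have h1 : m ≤ ∏ j, (1 - Real.cos (θ j) ^ 2) := by
      rw [← hk.det_one_sub_cosPart_sq (h.symplectic _ (hsub ht))]
      exact hmin ht
    have h2 : ∏ j, (1 - Real.cos (θ j) ^ 2) ≤ 1 - Real.cos (θ j) ^ 2 := by
      rw [← Finset.mul_prod_erase _ _ (Finset.mem_univ j)]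
      refine mul_le_of_le_one_right (hsq (hk.abs_lt j) (hk.ne_zero j)).le
        (Finset.prod_le_one (fun i _ => (hsq (hk.abs_lt i) (hk.ne_zero i)).le) fun i _ => ?_)
      linarith [sq_nonneg (Real.cos (θ i))]
    exact abs_le.1 (Real.abs_le_sqrt (by linarith))

/-- For `p` close to `arccos` up to a constant, `t ↦ tr p(cosPart (w t))` grows at least at the rate
`2n (1 - ε) (det a)^{1/2n}`, and its total growth is at most `∑ |θⱼ(1)|` up to `O(ε)`. Time `0` is
excluded because all the eigenvalues sit there at `1`, where `arccos` is not differentiable. -/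
theorem integral_le_rot_of_pos (h : IsPositiveLinearPath w a) (hn : 1 ≤ n)
    (ha : ContinuousOn a (Icc 0 1)) (hdet : ∀ t ∈ Icc (0 : ℝ) 1, (w t + 1).det ≠ 0) {t₀ : ℝ}
    (ht₀ : t₀ ∈ Ioc (0 : ℝ) 1) :
    2 * n * ∫ t in t₀..1, (a t).det ^ (1 / (2 * (n : ℝ))) ≤ 4 * Real.pi * rot (w 1) := by
  have hsub : Icc t₀ 1 ⊆ Icc (0 : ℝ) 1 := Icc_subset_Icc_left ht₀.1.le
  obtain ⟨b, hb, hcos⟩ := h.exists_cos_le hdet ht₀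
  have hD : ContinuousOn (fun t => (a t).det ^ (1 / (2 * (n : ℝ)))) (Icc 0 1) :=
    ((Continuous.matrix_det continuous_id).comp_continuousOn ha).rpow_const
      fun t ht => Or.inl (h.posDef t ht).det_pos.ne'
  set S := ∫ t in t₀..1, (a t).det ^ (1 / (2 * (n : ℝ))) with hS
  have hε : ∀ ε, 0 < ε → ε < 1 → 2 * n * (1 - ε) * S ≤ 4 * Real.pi * rot (w 1) + 4 * n * ε := by
    intro ε hε hε1
    obtain ⟨p, k, hp1, hp2⟩ := exists_polynomial_near_arccos hb hε
    have hder : ∀ t ∈ Icc t₀ 1, HasDerivWithinAt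
        (fun t => (Polynomial.aeval (cosPart (w t)) p).trace)
        (Polynomial.aeval (cosPart (w t)) p.derivative *
          ((2⁻¹ : ℝ) • (J₀ n * a t * w t - symplecticInv (w t) * J₀ n * a t))).trace
        (Icc t₀ 1) t := by
      intro t ht
      refine hasDerivWithinAt_trace_aeval (hasDerivWithinAt_cosPart ?_ ?_) p
      · have := (h.posDef t (hsub ht)).isHermitian
        rwa [Matrix.IsHermitian, Matrix.conjTranspose_eq_transpose_of_trivial] at this
      · exact hasDerivWithinAt_matrix_mono (h.hasDerivWithinAt t (hsub ht)) hsub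
    have hle := intervalIntegral.integral_le_sub_of_hasDeriv_right_of_le ht₀.2
      (fun t ht => (hder t ht).continuousWithinAt)
      (fun t ht => ((hder t ⟨ht.1.le, ht.2.le⟩).mono_of_mem_nhdsWithin (Icc_mem_nhdsGT_of_mem ⟨ht.1.le, ht.2⟩)))
      (φ := fun t => 2 * n * (1 - ε) * (a t).det ^ (1 / (2 * (n : ℝ))))
      ((continuousOn_const.mul (hD.mono hsub)).integrableOn_Icc) (fun t ht => by
        have ht' : t ∈ Icc t₀ 1 := ⟨ht.1.le, ht.2.le⟩
        obtain ⟨V, θ, hk⟩ := h.exists_kreinDiagonalizes hdet ⟨ht₀.1.trans_le ht'.1, ht'.2⟩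
        obtain ⟨h1, h2⟩ := hk.det_rpow_le hn (h.posDef t (hsub ht'))
        rw [hk.trace_aeval_mul_deriv (h.symplectic t (hsub ht')), ← Finset.sum_neg_distrib]
        calc 2 * n * (1 - ε) * (a t).det ^ (1 / (2 * (n : ℝ)))
            = (1 - ε) * (2 * n * (a t).det ^ (1 / (2 * (n : ℝ)))) := by ring
          _ ≤ (1 - ε) * ∑ j, ((Vᴴ * complexify (a t) * V) j j).re :=
              mul_le_mul_of_nonneg_left h1 (by linarith)
          _ = ∑ j, (1 - ε) * ((Vᴴ * complexify (a t) * V) j j).re := Finset.mul_sum _ _ _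
          _ ≤ _ := by
              refine Finset.sum_le_sum fun j _ => ?_
              have h3 := hp2 _ (hcos t ht' V θ hk j)
              rw [← neg_mul]
              exact mul_le_mul_of_nonneg_right (by linarith) (h2 j))
    rw [intervalIntegral.integral_const_mul] at hle
    refine hle.trans ?_
    obtain ⟨V₁, θ₁, hk₁⟩ := h.exists_kreinDiagonalizes hdet (t := 1) ⟨one_pos, le_rfl⟩
    obtain ⟨V₀, θ₀, hk₀⟩ := h.exists_kreinDiagonalizes hdet ht₀
    have h1 : (1 : ℝ) ∈ Icc t₀ 1 := ⟨ht₀.2, le_rfl⟩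
    have h0 : t₀ ∈ Icc t₀ 1 := ⟨le_rfl, ht₀.2⟩
    rw [hk₁.trace_aeval_cosPart (h.symplectic _ (hsub h1)),
      hk₀.trace_aeval_cosPart (h.symplectic _ (hsub h0)), ← Finset.sum_sub_distrib, hk₁.rot_eq,
      ← mul_assoc, mul_inv_cancel₀ (by positivity), one_mul]
    -- Each of the `2n` indices costs `ε` at either end; the term `-arccos` at time `t₀` is
    -- nonpositive and is dropped.
    calc ∑ j, (p.eval (Real.cos (θ₁ j)) - p.eval (Real.cos (θ₀ j)))
        ≤ ∑ j, (|θ₁ j| + 2 * ε) := by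
          refine Finset.sum_le_sum fun j _ => ?_
          have e1 := (abs_le.1 (hp1 _ (hcos 1 h1 _ _ hk₁ j))).2
          have e0 := (abs_le.1 (hp1 _ (hcos t₀ h0 _ _ hk₀ j))).1
          have e2 : Real.arccos (Real.cos (θ₁ j)) = |θ₁ j| := by
            rw [← Real.cos_abs, Real.arccos_cos (abs_nonneg _) (hk₁.abs_lt j).le]
          linarith [Real.arccos_nonneg (Real.cos (θ₀ j))]
      _ = ∑ j, |θ₁ j| + 4 * n * ε := by
          rw [Finset.sum_add_distrib]; simp; ring
  have h1 : Tendsto (fun ε : ℝ => 2 * n * (1 - ε) * S) (𝓝[>] 0) (𝓝 (2 * n * (1 - 0) * S)) :=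
    (Continuous.tendsto (by fun_prop) 0).mono_left nhdsWithin_le_nhds
  have h2 : Tendsto (fun ε : ℝ => 4 * Real.pi * rot (w 1) + 4 * n * ε) (𝓝[>] 0)
      (𝓝 (4 * Real.pi * rot (w 1) + 4 * n * 0)) :=
    (Continuous.tendsto (by fun_prop) 0).mono_left nhdsWithin_le_nhds
  have h3 := le_of_tendsto_of_tendsto h1 h2 (by
    filter_upwards [Ioo_mem_nhdsGT (zero_lt_one (α := ℝ))] with ε hε' using hε ε hε'.1 hε'.2)
  simpa using h3

/-- The limit `t₀ → 0`: the right-hand side of the previous estimate does not involve `t₀`. -/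
theorem integral_le_rot (h : IsPositiveLinearPath w a) (hn : 1 ≤ n)
    (ha : ContinuousOn a (Icc 0 1)) (hdet : ∀ t ∈ Icc (0 : ℝ) 1, (w t + 1).det ≠ 0) :
    ∫ t in (0 : ℝ)..1, (a t).det ^ (1 / (2 * (n : ℝ))) ≤ 2 * Real.pi / n * rot (w 1) := by
  have hD : ContinuousOn (fun t => (a t).det ^ (1 / (2 * (n : ℝ)))) (Icc 0 1) :=
    ((Continuous.matrix_det continuous_id).comp_continuousOn ha).rpow_const
      fun t ht => Or.inl (h.posDef t ht).det_pos.ne'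
  have h1 : ContinuousOn (fun x => ∫ t in x..(1 : ℝ), (a t).det ^ (1 / (2 * (n : ℝ)))) (uIcc 0 1) :=
    intervalIntegral.continuousOn_primitive_interval_left (by
      rw [uIcc_of_le zero_le_one]; exact hD.integrableOn_Icc)
  rw [uIcc_of_le zero_le_one] at h1
  have h2 := (h1 0 ⟨le_rfl, zero_le_one⟩).mono_left
    (nhdsWithin_mono 0 (Ioc_subset_Icc_self : Ioc (0 : ℝ) 1 ⊆ Icc 0 1))
  rw [nhdsWithin_Ioc_eq_nhdsGT one_pos] at h2
  have h3 := le_of_tendsto (h2.const_mul (2 * (n : ℝ))) (by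
    filter_upwards [Ioc_mem_nhdsGT (zero_lt_one (α := ℝ))] with t₀ ht₀ using
      h.integral_le_rot_of_pos hn ha hdet ht₀)
  have hn' : (0 : ℝ) < n := by exact_mod_cast hn
  rw [div_mul_eq_mul_div, le_div_iff₀ hn']
  linarith

end IsPositiveLinearPath

end ConvexSymp
end

noncomputable section

namespace ConvexSymp

/-! ### Indices of quadratic forms and generating forms of products -/

variable {n : ℕ}

/-! ### Positive index of a quadratic form: semicontinuity and monotonicity -/

section Signature

variable {E : Type*} [NormedAddCommGroup E] [NormedSpace ℝ E] [FiniteDimensional ℝ E]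
  {T : Type*} [TopologicalSpace T]

/-- Positivity on the compact unit sphere of a maximal positive subspace persists for nearby
parameters. -/
theorem eventually_sigPos_le {Q : T → QuadraticForm ℝ E}
    (hQ : Continuous fun p : T × E => Q p.1 p.2) (t₀ : T) :
    ∀ᶠ t in 𝓝 t₀, sigPos (Q t₀) ≤ sigPos (Q t) := by
  obtain ⟨V, hV, hpos⟩ := exists_finrank_eq_sigPos_and_posDef (Q t₀)
  have hK : IsCompact (Metric.sphere (0 : E) 1 ∩ (V : Set E)) :=
    (isCompact_sphere 0 1).inter_right V.closed_of_finiteDimensional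
  have h1 : ∀ᶠ t in 𝓝 t₀, ∀ v ∈ Metric.sphere (0 : E) 1 ∩ (V : Set E), 0 < Q t v := by
    refine hK.eventually_forall_of_forall_eventually fun v hv => ?_
    refine (hQ.tendsto (t₀, v)).eventually_const_lt ?_
    refine hpos ⟨v, hv.2⟩ fun h => ?_
    have h2 : ‖v‖ = 1 := by simpa using hv.1
    rw [show v = 0 from congrArg Subtype.val h, norm_zero] at h2
    exact zero_ne_one h2
  filter_upwards [h1] with t ht
  rw [← hV]
  refine le_sigPos_of_posDef (Q t) fun v hv => ?_
  have hv0 : (v : E) ≠ 0 := fun h => hv (Subtype.ext h)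
  have h2 := ht (‖(v : E)‖⁻¹ • (v : E)) ⟨by simp [norm_smul, hv0], V.smul_mem _ v.2⟩
  rw [QuadraticMap.map_smul, smul_eq_mul] at h2
  exact pos_of_mul_pos_right h2 (mul_self_nonneg _)

/-- The index is constant along continuous families of nondegenerate quadratic forms. -/
theorem sigPos_eq_of_preconnectedSpace [PreconnectedSpace T] {Q : T → QuadraticForm ℝ E}
    (hQ : Continuous fun p : T × E => Q p.1 p.2) (hrad : ∀ t, (Q t).radical = ⊥) (t₀ t₁ : T) :
    sigPos (Q t₀) = sigPos (Q t₁) := by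
  have hsum : ∀ t, sigPos (Q t) + sigNeg (Q t) = Module.finrank ℝ E := by
    intro t
    have := QuadraticForm.sigPos_add_sigNeg_add_radical (Q := Q t)
    rwa [hrad, finrank_bot, add_zero] at this
  -- Both indices are lower semicontinuous and, without a radical, their sum is the fixed dimension;
  -- so neither can jump.
  have hloc : IsLocallyConstant fun t => sigPos (Q t) := by
    refine (IsLocallyConstant.iff_eventually_eq _).2 fun t => ?_
    have hneg : Continuous fun p : T × E => (-Q p.1) p.2 := by
      simp only [neg_apply]
      exact hQ.neg
    filter_upwards [eventually_sigPos_le hQ t, eventually_sigPos_le (Q := fun t => -Q t) hneg t]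
      with s h1 h2
    have h3 := hsum s
    have h4 := hsum t
    simp only [sigPos_neg] at h2
    omega
  exact hloc.apply_eq_of_preconnectedSpace t₀ t₁

theorem sigPos_le_of_le {Q Q' : QuadraticForm ℝ E} (h : ∀ v, Q v ≤ Q' v) :
    sigPos Q ≤ sigPos Q' := by
  obtain ⟨V, hV, hpos⟩ := exists_finrank_eq_sigPos_and_posDef Q
  rw [← hV]
  exact le_sigPos_of_posDef Q' fun v hv => (hpos v hv).trans_le (h v)

/-- Adjoining `z` to a maximal positive subspace `V` of `Q` gives a larger subspace on which `Q'` is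
positive: `Q' (x + c z) ≥ Q (x + c z) = Q x > 0` if `x ≠ 0`, and `Q' (c z) = c² Q' z`. -/
theorem sigPos_lt_of_le {Q Q' : QuadraticForm ℝ E} (h : ∀ v, Q v ≤ Q' v) {z : E}
    (hz : z ∈ Q.radical) (hz' : 0 < Q' z) : sigPos Q < sigPos Q' := by
  obtain ⟨V, hV, hpos⟩ := exists_finrank_eq_sigPos_and_posDef Q
  obtain ⟨hz0, hzadd⟩ := QuadraticMap.mem_radical_iff'.1 hz
  have hzV : z ∉ V := fun hmem => by
    have h1 : (⟨z, hmem⟩ : V) ≠ 0 := fun h0 => by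
      rw [show z = 0 from congrArg Subtype.val h0, QuadraticMap.map_zero] at hz'
      exact lt_irrefl _ hz'
    have h2 := hpos _ h1
    rw [QuadraticMap.restrict_apply, hz0] at h2
    exact lt_irrefl _ h2
  rw [← hV, ← Nat.succ_le_iff, Nat.succ_eq_add_one, ← Submodule.finrank_sup_span_singleton hzV]
  refine le_sigPos_of_posDef Q' fun v hv => ?_
  obtain ⟨v, hmem⟩ := v
  have hv0 : v ≠ 0 := fun h => hv (Subtype.ext h)
  obtain ⟨x, hx, y, hy, rfl⟩ := Submodule.mem_sup.1 hmem
  obtain ⟨c, rfl⟩ := Submodule.mem_span_singleton.1 hy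
  change 0 < Q' (x + c • z)
  by_cases hx0 : x = 0
  · subst hx0
    have hc : c ≠ 0 := fun hc => hv0 (by simp [hc])
    rw [zero_add, QuadraticMap.map_smul, smul_eq_mul]
    exact mul_pos (mul_self_pos.2 hc) hz'
  · have h1 : 0 < Q x := hpos ⟨x, hx⟩ fun h => hx0 (congrArg Subtype.val h)
    have h2 : Q (x + c • z) = Q x := by
      rw [add_comm]
      exact (QuadraticMap.mem_radical_iff'.1 (Q.radical.smul_mem c hz)).2 x
    exact (h2 ▸ h1).trans_le (h _)

end Signature

/-! ### Generating form of a product of symplectic matrices -/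

section GeneratingForm

variable {N : ℕ} [NeZero N]

/-- The antiperiodic extension `z_N = -z_0` of a sequence `z_0, …, z_{N-1}`. -/
def antiExt (k : ℕ) : (Fin N → PhaseSpace n) →ₗ[ℝ] PhaseSpace n :=
  if h : k < N then LinearMap.proj ⟨k, h⟩ else -LinearMap.proj 0

/-- The sums `z_{k+1} + z_k` of consecutive terms of an antiperiodic sequence. -/
def stepSum : (Fin N → PhaseSpace n) →ₗ[ℝ] (Fin N → PhaseSpace n) :=
  LinearMap.pi fun k => antiExt (k + 1) + antiExt k

/-- The differences `z_{k+1} - z_k` of consecutive terms of an antiperiodic sequence. -/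
def stepDiff : (Fin N → PhaseSpace n) →ₗ[ℝ] (Fin N → PhaseSpace n) :=
  LinearMap.pi fun k => antiExt (k + 1) - antiExt k

theorem antiExt_coe (z : Fin N → PhaseSpace n) (k : Fin N) : antiExt k z = z k := by
  simp [antiExt]

theorem antiExt_last (z : Fin N → PhaseSpace n) : antiExt N z = -z 0 := by
  simp [antiExt]

theorem antiExt_zero (z : Fin N → PhaseSpace n) : antiExt 0 z = z 0 := by
  rw [antiExt, dif_pos (Nat.pos_of_ne_zero (NeZero.ne N))]
  rfl

theorem stepSum_apply (z : Fin N → PhaseSpace n) (k : Fin N) :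
    stepSum z k = antiExt (k + 1) z + antiExt k z := rfl

theorem stepDiff_apply (z : Fin N → PhaseSpace n) (k : Fin N) :
    stepDiff z k = antiExt (k + 1) z - antiExt k z := rfl

/-- A sequence with vanishing sums alternates, so `z_N = z_0` for even `N`; antiperiodicity then
forces `z_0 = 0`. Injectivity gives surjectivity by dimension. -/
theorem stepSum_surjective (hN : Even N) : Function.Surjective (stepSum (n := n) (N := N)) := by
  refine LinearMap.injective_iff_surjective.1 ((injective_iff_map_eq_zero _).2 fun z hz => ?_)
  have h1 : ∀ k ≤ N, antiExt k z = (-1 : ℝ) ^ k • z 0 := by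
    intro k hk
    induction k with
    | zero => simp [antiExt_zero]
    | succ k ih =>
      have h2 := congrFun hz ⟨k, hk⟩
      rw [stepSum_apply, ih (by omega)] at h2
      rw [pow_succ, mul_neg_one, neg_smul]
      exact eq_neg_of_add_eq_zero_left h2
  have h2 := h1 N le_rfl
  rw [antiExt_last, hN.neg_one_pow, one_smul] at h2
  have h3 : z 0 = 0 := self_eq_neg.1 h2.symm
  funext k
  rw [← antiExt_coe z k, h1 k k.2.le, h3, smul_zero]; rfl

/-- The generating form of the product of the symplectic matrices with Cayley transforms `S k`,
twisted by `-1`. -/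
def genBilin (S : Fin N → Matrix (Fin n ⊕ Fin n) (Fin n ⊕ Fin n) ℝ) :
    LinearMap.BilinForm ℝ (Fin N → PhaseSpace n) :=
  LinearMap.mk₂ ℝ
    (fun z y => ∑ k, (S k *ᵥ stepSum z k + J₀ n *ᵥ stepDiff z k) ⬝ᵥ stepSum y k)
    (fun z z' y => by
      simp only [map_add, Pi.add_apply, Matrix.mulVec_add, add_dotProduct, ← Finset.sum_add_distrib]
      refine Finset.sum_congr rfl fun k _ => by ring)
    (fun c z y => by
      simp only [map_smul, Pi.smul_apply, Matrix.mulVec_smul, ← smul_add, smul_dotProduct,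
        Finset.smul_sum])
    (fun z y y' => by
      simp only [map_add, Pi.add_apply, dotProduct_add, ← Finset.sum_add_distrib])
    (fun c z y => by
      simp only [map_smul, Pi.smul_apply, dotProduct_smul, Finset.smul_sum])

variable {S : Fin N → Matrix (Fin n ⊕ Fin n) (Fin n ⊕ Fin n) ℝ}

theorem genBilin_apply (z y : Fin N → PhaseSpace n) : genBilin S z y =
    ∑ k, (S k *ᵥ stepSum z k + J₀ n *ᵥ stepDiff z k) ⬝ᵥ stepSum y k := rfl

theorem J_mulVec_dotProduct (u v : PhaseSpace n) :
    (J₀ n *ᵥ u) ⬝ᵥ v = -((J₀ n *ᵥ v) ⬝ᵥ u) := by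
  rw [dotProduct_comm, Matrix.dotProduct_mulVec, ← Matrix.mulVec_transpose, Matrix.J_transpose,
    Matrix.neg_mulVec, neg_dotProduct]

/-- The antisymmetric part telescopes to the boundary terms at `0` and `N`, which agree because both
arguments change sign. -/
theorem genBilin_symm (hS : ∀ k, (S k)ᵀ = S k) (z y : Fin N → PhaseSpace n) :
    genBilin S z y = genBilin S y z := by
  have h1 : ∀ k, (S k *ᵥ stepSum z k) ⬝ᵥ stepSum y k = (S k *ᵥ stepSum y k) ⬝ᵥ stepSum z k := by
    intro k
    rw [dotProduct_comm, Matrix.dotProduct_mulVec, ← Matrix.mulVec_transpose, hS]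
  have h2 : ∀ k : Fin N, (J₀ n *ᵥ stepDiff z k) ⬝ᵥ stepSum y k -
      (J₀ n *ᵥ stepDiff y k) ⬝ᵥ stepSum z k =
      2 * ((J₀ n *ᵥ antiExt (k + 1) z) ⬝ᵥ antiExt (k + 1) y) -
        2 * ((J₀ n *ᵥ antiExt k z) ⬝ᵥ antiExt k y) := by
    intro k
    simp only [stepSum_apply, stepDiff_apply, Matrix.mulVec_sub, sub_dotProduct, dotProduct_add]
    rw [J_mulVec_dotProduct (antiExt (k + 1) y) (antiExt (k + 1) z),
      J_mulVec_dotProduct (antiExt (k + 1) y) (antiExt k z),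
      J_mulVec_dotProduct (antiExt k y) (antiExt (k + 1) z),
      J_mulVec_dotProduct (antiExt k y) (antiExt k z)]
    ring
  rw [← sub_eq_zero, genBilin_apply, genBilin_apply, ← Finset.sum_sub_distrib]
  calc _ = ∑ k : Fin N, (2 * ((J₀ n *ᵥ antiExt (k + 1) z) ⬝ᵥ antiExt (k + 1) y) -
        2 * ((J₀ n *ᵥ antiExt k z) ⬝ᵥ antiExt k y)) := by
        refine Finset.sum_congr rfl fun k _ => ?_
        rw [add_dotProduct, add_dotProduct, h1, ← h2]; ring
    _ = ∑ k ∈ Finset.range N, (2 * ((J₀ n *ᵥ antiExt (k + 1) z) ⬝ᵥ antiExt (k + 1) y) -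
        2 * ((J₀ n *ᵥ antiExt k z) ⬝ᵥ antiExt k y)) :=
        Fin.sum_univ_eq_sum_range (fun k : ℕ => (2 * ((J₀ n *ᵥ antiExt (k + 1) z) ⬝ᵥ
          antiExt (k + 1) y) - 2 * ((J₀ n *ᵥ antiExt k z) ⬝ᵥ antiExt k y))) N
    _ = 0 := by
        rw [Finset.sum_range_sub fun k => 2 * ((J₀ n *ᵥ antiExt k z) ⬝ᵥ antiExt k y)]
        simp [antiExt_last, antiExt_zero, Matrix.mulVec_neg]

/-- The quadratic form of `genBilin`. -/
def genForm (S : Fin N → Matrix (Fin n ⊕ Fin n) (Fin n ⊕ Fin n) ℝ) :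
    QuadraticForm ℝ (Fin N → PhaseSpace n) :=
  (genBilin S).toQuadraticMap

theorem genForm_apply (z : Fin N → PhaseSpace n) : genForm S z =
    ∑ k, (S k *ᵥ stepSum z k + J₀ n *ᵥ stepDiff z k) ⬝ᵥ stepSum z k := rfl

theorem genForm_sub_apply (S' : Fin N → Matrix (Fin n ⊕ Fin n) (Fin n ⊕ Fin n) ℝ)
    (z : Fin N → PhaseSpace n) : genForm S' z - genForm S z =
      ∑ k, ((S' k - S k) *ᵥ stepSum z k) ⬝ᵥ stepSum z k := by
  rw [genForm_apply, genForm_apply, ← Finset.sum_sub_distrib]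
  refine Finset.sum_congr rfl fun k _ => ?_
  rw [add_dotProduct, add_dotProduct, Matrix.sub_mulVec, sub_dotProduct]; ring

/-- The sums `stepSum y` run through all sequences, so orthogonality to every `y` makes each vector
`S k σ + J₀ δ` vanish, where `σ` and `δ` are the `k`-th sum and difference of `z`. -/
theorem mem_radical_genForm (hN : Even N) (hS : ∀ k, (S k)ᵀ = S k) {z : Fin N → PhaseSpace n} :
    z ∈ (genForm S).radical ↔ ∀ k, stepDiff z k = (J₀ n * S k) *ᵥ stepSum z k := by
  have hJ : J₀ n * J₀ n = -1 := Matrix.J_squared _ _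
  have hiff : ∀ k, stepDiff z k = (J₀ n * S k) *ᵥ stepSum z k ↔
      S k *ᵥ stepSum z k + J₀ n *ᵥ stepDiff z k = 0 := by
    intro k
    constructor
    · intro h
      rw [h, Matrix.mulVec_mulVec, ← mul_assoc, hJ, neg_one_mul, Matrix.neg_mulVec, add_neg_cancel]
    · intro h
      have h1 := congrArg (fun v => J₀ n *ᵥ v) h
      simp only [Matrix.mulVec_add, Matrix.mulVec_mulVec, hJ, Matrix.mulVec_zero, Matrix.neg_mulVec,
        Matrix.one_mulVec] at h1
      rw [add_neg_eq_zero] at h1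
      exact h1.symm
  have hadd : ∀ y, genForm S (z + y) = genForm S z + genForm S y + 2 * genBilin S z y := by
    intro y
    change genBilin S (z + y) (z + y) = genBilin S z z + genBilin S y y + 2 * genBilin S z y
    rw [map_add, map_add, LinearMap.add_apply, LinearMap.add_apply, genBilin_symm hS y z]
    ring
  rw [QuadraticMap.mem_radical_iff']
  constructor
  · rintro ⟨h0, h1⟩ k
    have h2 : ∀ y, genBilin S z y = 0 := by
      intro y
      have h3 := hadd y
      rw [h1, h0] at h3
      linarith
    obtain ⟨y, hy⟩ := stepSum_surjective hN
      (fun k => S k *ᵥ stepSum z k + J₀ n *ᵥ stepDiff z k)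
    have h3 := h2 y
    rw [genBilin_apply, hy, Finset.sum_eq_zero_iff_of_nonneg] at h3
    · exact (hiff k).2 (dotProduct_self_eq_zero.1 (h3 k (Finset.mem_univ k)))
    · exact fun k _ => Finset.sum_nonneg fun i _ => mul_self_nonneg _
  · intro h
    have h2 : ∀ y, genBilin S z y = 0 := by
      intro y
      rw [genBilin_apply]
      exact Finset.sum_eq_zero fun k _ => by rw [(hiff k).1 (h k), zero_dotProduct]
    have h0 : genForm S z = 0 := h2 z
    exact ⟨h0, fun y => by rw [hadd, h0, h2]; ring⟩

variable {W : ℕ → Matrix (Fin n ⊕ Fin n) (Fin n ⊕ Fin n) ℝ}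
  {w : ℕ → Matrix (Fin n ⊕ Fin n) (Fin n ⊕ Fin n) ℝ}

/-- The Cayley relation describes the graph of `W` in the coordinates given by sum and difference;
the converse direction uses `(W + 1)(1 - J₀ S) = 2`. -/
theorem stepDiff_eq_iff {W S : Matrix (Fin n ⊕ Fin n) (Fin n ⊕ Fin n) ℝ}
    (h : W - 1 = J₀ n * S * (W + 1)) (x y : PhaseSpace n) :
    y - x = (J₀ n * S) *ᵥ (y + x) ↔ y = W *ᵥ x := by
  constructor
  · intro hxy
    have e1 : (1 - J₀ n * S) * (W + 1) = (2 : ℝ) • 1 := by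
      rw [sub_mul, ← h, one_mul, two_smul]; abel
    have e2 : (W + 1) * (1 - J₀ n * S) = (2 : ℝ) • 1 := by
      have : (1 - J₀ n * S) * ((2 : ℝ)⁻¹ • (W + 1)) = 1 := by
        rw [Matrix.mul_smul, e1, smul_smul]; norm_num
      have := mul_eq_one_comm.1 this
      rw [Matrix.smul_mul] at this
      exact (inv_smul_eq_iff₀ two_ne_zero).1 this
    have e3 : (1 - J₀ n * S) *ᵥ (y + x) = (2 : ℝ) • x := by
      rw [Matrix.sub_mulVec, ← hxy, Matrix.one_mulVec, two_smul]; abel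
    have e4 := congrArg (fun v => (W + 1) *ᵥ v) e3
    simp only [Matrix.mulVec_mulVec, e2, Matrix.smul_mulVec, Matrix.one_mulVec,
      Matrix.mulVec_smul] at e4
    have e5 := smul_right_injective _ (two_ne_zero (α := ℝ)) e4
    rw [Matrix.add_mulVec, Matrix.one_mulVec] at e5
    exact add_right_cancel e5
  · rintro rfl
    have h1 := congrArg (fun M => M *ᵥ x) h
    simpa [Matrix.sub_mulVec, Matrix.add_mulVec, ← Matrix.mulVec_mulVec] using h1

/-- An element of the radical satisfies `z_{k+1} = W k z_k`, so `z_k = w k z_0`; antiperiodicity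
reads `w N z_0 = -z_0`. -/
theorem radical_genForm_eq_bot (hN : Even N) (hS : ∀ k, (S k)ᵀ = S k)
    (hWS : ∀ k : Fin N, W k - 1 = J₀ n * S k * (W k + 1)) (hw0 : w 0 = 1)
    (hw : ∀ k, w (k + 1) = W k * w k) (hdet : (w N + 1).det ≠ 0) : (genForm S).radical = ⊥ := by
  rw [Submodule.eq_bot_iff]
  intro z hz
  have h1 := (mem_radical_genForm hN hS).1 hz
  have h2 : ∀ k ≤ N, antiExt k z = w k *ᵥ z 0 := by
    intro k hk
    induction k with
    | zero => rw [antiExt_zero, hw0, Matrix.one_mulVec]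
    | succ k ih =>
      have h3 := h1 ⟨k, hk⟩
      rw [stepDiff_apply, stepSum_apply, stepDiff_eq_iff (hWS ⟨k, hk⟩)] at h3
      rw [hw, ← Matrix.mulVec_mulVec, ← ih (by omega)]
      exact h3
  have h3 := h2 N le_rfl
  rw [antiExt_last] at h3
  have h4 : z 0 = 0 := by
    by_contra hne
    refine hdet (Matrix.exists_mulVec_eq_zero_iff.1 ⟨z 0, hne, ?_⟩)
    rw [Matrix.add_mulVec, Matrix.one_mulVec, ← h3, neg_add_cancel]
  funext k
  rw [← antiExt_coe z k, h2 k k.2.le, h4, Matrix.mulVec_zero]; rfl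

theorem exists_mem_radical_genForm (hN : Even N) (hS : ∀ k, (S k)ᵀ = S k)
    (hWS : ∀ k : Fin N, W k - 1 = J₀ n * S k * (W k + 1)) (hw0 : w 0 = 1)
    (hw : ∀ k, w (k + 1) = W k * w k) (hdet : (w N + 1).det = 0)
    (hW : ∀ k : Fin N, (W k + 1).det ≠ 0) (hwdet : ∀ k, (w k).det ≠ 0) :
    ∃ z ∈ (genForm S).radical, ∀ k, stepSum z k ≠ 0 := by
  obtain ⟨v, hv, hwv⟩ := Matrix.exists_mulVec_eq_zero_iff.2 hdet
  rw [Matrix.add_mulVec, Matrix.one_mulVec] at hwv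
  set z : Fin N → PhaseSpace n := fun k => w k *ᵥ v with hz
  have h1 : ∀ k ≤ N, antiExt k z = w k *ᵥ v := by
    intro k hk
    rcases hk.lt_or_eq with hk | rfl
    · exact antiExt_coe z ⟨k, hk⟩
    · rw [antiExt_last, eq_neg_of_add_eq_zero_left hwv]
      simp [hz, hw0]
  refine ⟨z, (mem_radical_genForm hN hS).2 fun k => ?_, fun k => ?_⟩
  · rw [stepDiff_apply, stepSum_apply, stepDiff_eq_iff (hWS k), h1 _ k.2, h1 _ k.2.le, hw,
      Matrix.mulVec_mulVec]
  -- The sum is `(W k + 1) (w k v)` with both matrices invertible. Hence the form grows strictly at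
  -- `z` as soon as a single `S k` does.
  · rw [stepSum_apply, h1 _ k.2, h1 _ k.2.le, hw, ← Matrix.mulVec_mulVec]
    intro h
    have h2 : (W k + 1) *ᵥ (w k *ᵥ v) = 0 := by rw [Matrix.add_mulVec, Matrix.one_mulVec, h]
    have h3 := Matrix.eq_zero_of_mulVec_eq_zero (hW k) h2
    exact hv (Matrix.eq_zero_of_mulVec_eq_zero (hwdet k) h3)

theorem continuous_genForm {T : Type*} [TopologicalSpace T]
    {S : T → Fin N → Matrix (Fin n ⊕ Fin n) (Fin n ⊕ Fin n) ℝ} (hS : ∀ k, Continuous fun t => S t k) :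
    Continuous fun p : T × (Fin N → PhaseSpace n) => genForm (S p.1) p.2 := by
  simp only [genForm_apply]
  have h1 : Continuous (stepSum (n := n) (N := N)) := LinearMap.continuous_of_finiteDimensional _
  have h2 : Continuous (stepDiff (n := n) (N := N)) := LinearMap.continuous_of_finiteDimensional _
  refine continuous_finsetSum _ fun k _ => ?_
  have h3 := hS k
  fun_prop

end GeneratingForm

end ConvexSymp
end

noncomputable section

namespace ConvexSymp

/-! ### Homotopies of positive paths of symplectic matrices -/

variable {n : ℕ}

theorem symplecticInv_mem {W : Matrix (Fin n ⊕ Fin n) (Fin n ⊕ Fin n) ℝ}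
    (hW : W ∈ Matrix.symplecticGroup (Fin n) ℝ) :
    symplecticInv W ∈ Matrix.symplecticGroup (Fin n) ℝ := by
  have h1 := ((⟨W, hW⟩ : Matrix.symplecticGroup (Fin n) ℝ)⁻¹).2
  rw [SymplecticGroup.coe_inv] at h1
  simpa [symplecticInv] using h1

theorem det_one_add_one_ne_zero :
    ((1 : Matrix (Fin n ⊕ Fin n) (Fin n ⊕ Fin n) ℝ) + 1).det ≠ 0 := by
  have : (1 : Matrix (Fin n ⊕ Fin n) (Fin n ⊕ Fin n) ℝ) + 1 = (2 : ℝ) • 1 := (two_smul ℝ _).symm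
  rw [this, Matrix.det_smul, Matrix.det_one, mul_one]
  positivity

/-- On the diagonal `t' = t` the matrix is `2 · 1`; compactness makes the neighbourhood of the
diagonal uniform. -/
theorem exists_small_increment {H : ℝ → ℝ → Matrix (Fin n ⊕ Fin n) (Fin n ⊕ Fin n) ℝ}
    (hc : Continuous (Function.uncurry H))
    (hs : ∀ s t, H s t ∈ Matrix.symplecticGroup (Fin n) ℝ) :
    ∃ δ > 0, ∀ s ∈ Icc (0 : ℝ) 1, ∀ t ∈ Icc (0 : ℝ) 1, ∀ t', |t' - t| < δ →
      (H s t' * symplecticInv (H s t) + 1).det ≠ 0 := by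
  set D : ℝ × ℝ × ℝ → ℝ := fun p => (H p.1 p.2.2 * symplecticInv (H p.1 p.2.1) + 1).det with hD
  have hDc : Continuous D := by
    have h1 : Continuous fun p : ℝ × ℝ × ℝ => H p.1 p.2.2 :=
      hc.comp (continuous_fst.prodMk (continuous_snd.comp continuous_snd))
    have h2 : Continuous fun p : ℝ × ℝ × ℝ => H p.1 p.2.1 :=
      hc.comp (continuous_fst.prodMk (continuous_fst.comp continuous_snd))
    exact Continuous.matrix_det ((h1.mul (continuous_symplecticInv.comp h2)).add continuous_const)
  have hK : IsCompact ((fun q : ℝ × ℝ => (q.1, q.2, q.2)) '' (Icc 0 1 ×ˢ Icc 0 1)) :=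
    (isCompact_Icc.prod isCompact_Icc).image (by fun_prop)
  obtain ⟨δ, hδ, hsub⟩ := hK.exists_thickening_subset_open (isOpen_ne_fun hDc continuous_const)
    (by
      rintro _ ⟨⟨s, t⟩, -, rfl⟩
      change (H s t * symplecticInv (H s t) + 1).det ≠ 0
      rw [mul_symplecticInv (hs s t)]
      exact det_one_add_one_ne_zero)
  refine ⟨δ, hδ, fun s hs' t ht t' htt' => ?_⟩
  have h1 : (s, t, t') ∈ Metric.thickening δ
      ((fun q : ℝ × ℝ => (q.1, q.2, q.2)) '' (Icc (0 : ℝ) 1 ×ˢ Icc (0 : ℝ) 1)) := by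
    refine Metric.mem_thickening_iff.2 ⟨(s, t, t), ⟨(s, t), ⟨hs', ht⟩, rfl⟩, ?_⟩
    simpa [Prod.dist_eq, Real.dist_eq, hδ] using htt'
  exact hsub h1

/-- A positive path of symplectic matrices whose end point does not have the eigenvalue `-1`, and
which is homotopic with fixed ends to a path without the eigenvalue `-1`, does not have the
eigenvalue `-1` either. -/
theorem IsPositiveLinearPath.det_add_one_ne_zero
    {w a : ℝ → Matrix (Fin n ⊕ Fin n) (Fin n ⊕ Fin n) ℝ} (h : IsPositiveLinearPath w a)
    {H : ℝ → ℝ → Matrix (Fin n ⊕ Fin n) (Fin n ⊕ Fin n) ℝ} (hc : Continuous (Function.uncurry H))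
    (hs : ∀ s t, H s t ∈ Matrix.symplecticGroup (Fin n) ℝ) (hH0 : ∀ s, H s 0 = 1)
    (hw : ∀ t ∈ Icc (0 : ℝ) 1, H 0 t = w t) (hend : ∀ s ∈ Icc (0 : ℝ) 1, (H s 1 + 1).det ≠ 0)
    (hH1 : ∀ t ∈ Icc (0 : ℝ) 1, (H 1 t + 1).det ≠ 0) {t : ℝ} (ht : t ∈ Icc (0 : ℝ) 1) :
    (w t + 1).det ≠ 0 := by
  obtain ⟨δ, hδ, hsmall⟩ := exists_small_increment hc hs
  obtain ⟨M, hM⟩ := exists_nat_gt (1 / δ)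
  have hM0 : (0 : ℝ) < M := (by positivity : (0 : ℝ) < 1 / δ).trans hM
  -- Even, so that `stepSum` is onto, and large enough for each step to have a Cayley transform.
  set N := M + M with hN
  have hN0 : (0 : ℝ) < N := by rw [hN]; push_cast; linarith
  have hNδ : 1 / (N : ℝ) < δ := by
    rw [div_lt_iff₀ hN0, hN]
    rw [div_lt_iff₀ hδ] at hM
    push_cast
    nlinarith
  have : NeZero N := ⟨by exact_mod_cast hN0.ne'⟩
  have hNe : Even N := ⟨M, rfl⟩
  set u : ℕ → ℝ := fun k => k / N with hu
  have hu0 : u 0 = 0 := by simp [hu]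
  have huN : u N = 1 := by simp [hu, hN0.ne']
  have hustep : ∀ k, u (k + 1) = u k + 1 / N := fun k => by simp [hu, add_div]
  have hulast : ∀ k : Fin N, u (k + 1) ≤ 1 := by
    intro k
    rw [hu]
    have : ((k : ℕ) : ℝ) + 1 ≤ N := by exact_mod_cast k.2
    simpa using (div_le_one hN0).2 this
  have hupos : ∀ k, 0 ≤ u k := fun k => by positivity
  have hult : ∀ k, u k < u (k + 1) := fun k => by
    rw [hustep]; have : 0 < 1 / (N : ℝ) := by positivity
    linarith
  have hmem : ∀ k : Fin N, u k ∈ Icc (0 : ℝ) 1 := fun k =>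
    ⟨hupos k, (hult k).le.trans (hulast k)⟩
  -- Time `τ` clamped to the `k`-th subinterval. The `k`-th increment moves only while `τ` crosses
  -- that subinterval, and the product of all the increments is `H s τ`; the number of factors stays
  -- fixed.
  set cl : ℕ → ℝ → ℝ := fun k τ => max (u k) (min τ (u (k + 1))) with hcl
  have hclmem : ∀ k τ, cl k τ ∈ Icc (u k) (u (k + 1)) := fun k τ =>
    ⟨le_max_left _ _, max_le (hult k).le (min_le_right _ _)⟩
  have hdetstep : ∀ s ∈ Icc (0 : ℝ) 1, ∀ k : Fin N, ∀ t ∈ Icc (u k) (u (k + 1)),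
      (H s t * symplecticInv (H s (u k)) + 1).det ≠ 0 := by
    intro s hs' k t ht
    refine hsmall s hs' _ (hmem k) _ ?_
    rw [abs_of_nonneg (by linarith [ht.1])]
    have := ht.2
    rw [hustep] at this
    linarith
  set W : ℝ → ℝ → ℕ → Matrix (Fin n ⊕ Fin n) (Fin n ⊕ Fin n) ℝ :=
    fun s τ k => H s (cl k τ) * symplecticInv (H s (u k)) with hW
  have hWmem : ∀ s τ k, W s τ k ∈ Matrix.symplecticGroup (Fin n) ℝ := fun s τ k =>
    mul_mem (hs _ _) (symplecticInv_mem (hs _ _))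
  have hWdet : ∀ s ∈ Icc (0 : ℝ) 1, ∀ τ, ∀ k : Fin N, (W s τ k + 1).det ≠ 0 :=
    fun s hs' τ k => hdetstep s hs' k _ (hclmem k τ)
  set S : ℝ → ℝ → Fin N → Matrix (Fin n ⊕ Fin n) (Fin n ⊕ Fin n) ℝ :=
    fun s τ k => cayley (W s τ k) with hS
  have hSsymm : ∀ s ∈ Icc (0 : ℝ) 1, ∀ τ k, (S s τ k)ᵀ = S s τ k := fun s hs' τ k =>
    isSymm_cayley (hWmem s τ k) (hWdet s hs' τ k)
  have hWS : ∀ s ∈ Icc (0 : ℝ) 1, ∀ τ, ∀ k : Fin N,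
      W s τ k - 1 = J₀ n * S s τ k * (W s τ k + 1) := fun s hs' τ k =>
    cayley_mul_add_one (hWdet s hs' τ k)
  have hprod0 : ∀ s, ∀ τ ∈ Icc (0 : ℝ) 1, H s (min (u 0) τ) = 1 := by
    intro s τ hτ
    rw [hu0, min_eq_left hτ.1, hH0]
  have hprod : ∀ s τ k, H s (min (u (k + 1)) τ) = W s τ k * H s (min (u k) τ) := by
    intro s τ k
    simp only [hW, hcl]
    rcases le_total τ (u k) with hτ | hτ
    · rw [min_eq_right (hτ.trans (hult k).le), min_eq_right hτ,
        max_eq_left ((min_le_left _ _).trans hτ), mul_symplecticInv (hs _ _), one_mul]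
    · rw [min_eq_left hτ, max_eq_right (le_min hτ (hult k).le), mul_assoc,
        symplecticInv_mul (hs _ _), mul_one, min_comm]
  have hlast : ∀ s, ∀ τ ∈ Icc (0 : ℝ) 1, H s (min (u N) τ) = H s τ := by
    intro s τ hτ
    rw [huN, min_eq_right hτ.2]
  have hrad : ∀ s ∈ Icc (0 : ℝ) 1, ∀ τ ∈ Icc (0 : ℝ) 1, (H s τ + 1).det ≠ 0 →
      (genForm (S s τ)).radical = ⊥ := by
    intro s hs' τ hτ hd
    refine radical_genForm_eq_bot (w := fun k => H s (min (u k) τ)) hNe (hSsymm s hs' τ) (hWS s hs' τ) (hprod0 s τ hτ) (hprod s τ) ?_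
    rw [hlast s τ hτ]; exact hd
  have hScont : ∀ k, ContinuousOn (fun p : ℝ × ℝ => S p.1 p.2 k) (Icc 0 1 ×ˢ Icc 0 1) := by
    intro k p hp
    have h1 : Continuous fun p : ℝ × ℝ => W p.1 p.2 k := by
      have e1 : Continuous fun p : ℝ × ℝ => H p.1 (cl k p.2) := by
        have e0 : Continuous fun p : ℝ × ℝ => cl k p.2 := by
          simp only [hcl]; fun_prop
        exact hc.comp (continuous_fst.prodMk e0)
      have e2 : Continuous fun p : ℝ × ℝ => H p.1 (u k) :=
        hc.comp (continuous_fst.prodMk continuous_const)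
      exact e1.mul (continuous_symplecticInv.comp e2)
    exact (ContinuousAt.comp (f := fun p : ℝ × ℝ => W p.1 p.2 k)
      (continuousAt_cayley (hWdet p.1 hp.1 p.2 k)) h1.continuousAt).continuousWithinAt
  have h01 : (0 : ℝ) ∈ Icc (0 : ℝ) 1 := ⟨le_rfl, zero_le_one⟩
  have h11 : (1 : ℝ) ∈ Icc (0 : ℝ) 1 := ⟨zero_le_one, le_rfl⟩
  have hpath : ∀ γ : I → ℝ × ℝ, Continuous γ → (∀ r, γ r ∈ Icc (0 : ℝ) 1 ×ˢ Icc (0 : ℝ) 1) →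
      (∀ r, (H (γ r).1 (γ r).2 + 1).det ≠ 0) →
      sigPos (genForm (S (γ 0).1 (γ 0).2)) = sigPos (genForm (S (γ 1).1 (γ 1).2)) := by
    intro γ hγ hγm hγd
    refine sigPos_eq_of_preconnectedSpace (Q := fun r => genForm (S (γ r).1 (γ r).2)) ?_
      (fun r => hrad _ (hγm r).1 _ (hγm r).2 (hγd r)) 0 1
    exact continuous_genForm (S := fun r => S (γ r).1 (γ r).2)
      fun k => (hScont k).comp_continuous hγ hγm
  -- Two sides of the homotopy square without the eigenvalue `-1`: the endpoints `τ = 1`, then the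
  -- comparison path `s = 1`.
  have e1 := hpath (fun r => (r, 1)) (by fun_prop) (fun r => ⟨r.2, h11⟩) fun r => hend r r.2
  have e2 := hpath (fun r => (1, r)) (by fun_prop) (fun r => ⟨h11, r.2⟩) fun r => hH1 r r.2
  have e3 : S 1 0 = S 0 0 := by
    -- At `τ = 0` every increment is the identity, whatever `s` is.
    funext k
    have hcl0 : cl k 0 = u k := max_eq_left ((min_le_left _ _).trans (hupos k))
    simp only [hS, hW, hcl0, mul_symplecticInv (hs _ _)]
  have hclmono : ∀ k {τ τ'}, τ ≤ τ' → cl k τ ≤ cl k τ' := fun k τ τ' hτ =>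
    max_le_max le_rfl (min_le_min hτ le_rfl)
  have hpd : ∀ (k : Fin N) {τ τ'}, cl k τ < cl k τ' → (S 0 τ' k - S 0 τ k).PosDef := by
    intro k τ τ' hlt
    have hsub : Icc (u k) (u (k + 1)) ⊆ Icc (0 : ℝ) 1 := Icc_subset_Icc (hupos k) (hulast k)
    have hPw : ∀ t ∈ Icc (u k) (u (k + 1)), H 0 t * symplecticInv (H 0 (u k)) =
        w t * symplecticInv (w (u k)) := by
      intro t ht
      rw [hw t (hsub ht), hw _ (hmem k)]
    simp only [hS, hW]
    rw [hPw _ (hclmem k τ), hPw _ (hclmem k τ')]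
    refine cayley_sub_posDef (w := fun t => w t * symplecticInv (w (u k))) (a := a)
      (convex_Icc (u k) (u (k + 1))) (fun t ht => ?_) (fun t ht => ?_)
      (fun t ht => h.posDef t (hsub ht)) (fun t ht => ?_) (hclmem k τ) (hclmem k τ') hlt
    · exact mul_mem (h.symplectic t (hsub ht)) (symplecticInv_mem (h.symplectic _ (hmem k)))
    · rw [← mul_assoc]
      exact hasDerivWithinAt_matrix_mul_const _
        (hasDerivWithinAt_matrix_mono (h.hasDerivWithinAt t (hsub ht)) hsub)
    · rw [← hPw t ht]
      exact hdetstep 0 h01 k t ht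
  have hnonneg : ∀ (k : Fin N) {τ τ'}, τ ≤ τ' → ∀ x : PhaseSpace n,
      0 ≤ ((S 0 τ' k - S 0 τ k) *ᵥ x) ⬝ᵥ x := by
    intro k τ τ' hτ x
    rcases (hclmono k hτ).eq_or_lt with heq | hlt
    · have : S 0 τ' k = S 0 τ k := by simp only [hS, hW, heq]
      rw [this, sub_self, Matrix.zero_mulVec, zero_dotProduct]
    · rw [dotProduct_comm]
      exact (hpd k hlt).posSemidef.dotProduct_mulVec_nonneg x
  have hle : ∀ {τ τ'}, τ ≤ τ' → ∀ z, genForm (S 0 τ) z ≤ genForm (S 0 τ') z := by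
    intro τ τ' hτ z
    rw [← sub_nonneg, genForm_sub_apply]
    exact Finset.sum_nonneg fun k _ => hnonneg k hτ _
  intro hzero
  rw [← hw t ht] at hzero
  have ht1 : t < 1 := lt_of_le_of_ne ht.2 fun h1 => hend 0 h01 (h1 ▸ hzero)
  obtain ⟨z, hz, hzne⟩ := exists_mem_radical_genForm (w := fun k => H 0 (min (u k) t)) hNe (hSsymm 0 h01 t) (hWS 0 h01 t)
    (hprod0 0 t ht) (hprod 0 t) (by rw [hlast 0 t ht]; exact hzero) (hWdet 0 h01 t)
    (fun k => (SymplecticGroup.symplectic_det (hs _ _)).ne_zero)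
  have hk0 : ⌊t * N⌋₊ < N := by
    rw [Nat.floor_lt (mul_nonneg ht.1 hN0.le)]
    nlinarith
  -- The subinterval containing `t` before its right end: the Cayley transform of this increment
  -- still increases strictly after time `t`.
  set k₀ : Fin N := ⟨⌊t * N⌋₊, hk0⟩ with hk₀
  have hlo : u k₀ ≤ t := by
    rw [hu]; simp only [hk₀]
    rw [div_le_iff₀ hN0]
    exact Nat.floor_le (mul_nonneg ht.1 hN0.le)
  have hhi : t < u (k₀ + 1) := by
    rw [hu]; simp only [hk₀]
    rw [lt_div_iff₀ hN0]
    push_cast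
    exact Nat.lt_floor_add_one _
  have hclt : cl k₀ t = t := by
    simp only [hcl]; rw [min_eq_left hhi.le, max_eq_right hlo]
  have hcl1 : cl k₀ 1 = u (k₀ + 1) := by
    simp only [hcl]; rw [min_eq_right (hulast k₀), max_eq_right (hult k₀).le]
  have hlt : sigPos (genForm (S 0 t)) < sigPos (genForm (S 0 1)) := by
    refine sigPos_lt_of_le (hle ht.2) hz ?_
    have h0 : genForm (S 0 t) z = 0 := (QuadraticMap.mem_radical_iff'.1 hz).1
    have h5 := genForm_sub_apply (S := S 0 t) (S 0 1) z
    rw [h0, sub_zero] at h5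
    rw [h5]
    refine Finset.sum_pos' (fun k _ => hnonneg k ht.2 _) ⟨k₀, Finset.mem_univ _, ?_⟩
    rw [dotProduct_comm]
    exact (hpd k₀ (by rw [hclt, hcl1]; exact hhi)).dotProduct_mulVec_pos (hzne k₀)
  have hle0 := sigPos_le_of_le (hle ht.1)
  simp only [Set.Icc.coe_zero, Set.Icc.coe_one] at e1 e2
  rw [e3] at e2
  -- Writing `i(s, τ)` for the index: `i(0,0) ≤ i(0,t) < i(0,1) = i(1,1) = i(1,0) = i(0,0)`.
  omega

end ConvexSymp
end

noncomputable section

namespace ConvexSymp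

/-! ### Jacobians and Hessians on the closed domain -/

variable {n : ℕ} {Ω : UniformlyConvexDomain n}

theorem UniformlyConvexDomain.isCompact_cl (Ω : UniformlyConvexDomain n) : IsCompact Ω.cl := by
  obtain ⟨f, c, hf, hcoer, -, h⟩ := Ω.exists_function
  have h1 : ∀ᶠ z in cocompact (PhaseSpace n), c + 1 ≤ f z := hcoer.eventually_ge_atTop (c + 1)
  obtain ⟨K, hK, hKc⟩ := mem_cocompact.1 h1
  refine hK.closure_of_subset ?_
  rw [h]
  intro z hz
  by_contra hzK
  have h2 : c + 1 ≤ f z := hKc hzK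
  have h3 : f z < c := hz
  linarith

theorem Symp.contDiffOn_map (g : Symp Ω) : ContDiffOn ℝ ∞ g.map Ω.cl := g.contDiffOn

theorem Symp.map_mem (g : Symp Ω) {z : PhaseSpace n} (hz : z ∈ Ω.cl) : g.map z ∈ Ω.cl := by
  simp [Symp.map, extendMap, hz]

/-- The derivatives of a continuous family of symplectomorphisms are jointly continuous. -/
theorem continuousOn_iteratedFDerivWithin_map {T : Type*} [TopologicalSpace T] {f : T → Symp Ω}
    (hf : Continuous f) (k : ℕ) : ContinuousOn
      (fun p : T × PhaseSpace n => iteratedFDerivWithin ℝ k (f p.1).map Ω.cl p.2)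
      (univ ×ˢ Ω.cl) := by
  rintro ⟨t₀, z₀⟩ ⟨-, hz₀⟩
  have h0 : Continuous fun g : Symp Ω => (UniformOnFun.ofFun {Ω.cl}
      (iteratedFDerivWithin ℝ k g.map Ω.cl) :
        UniformOnFun (PhaseSpace n) (PhaseSpace n [×k]→L[ℝ] PhaseSpace n) {Ω.cl}) :=
    continuous_iff_le_induced.2 (iInf_le (fun k : ℕ => TopologicalSpace.induced
      (fun g : Symp Ω => (UniformOnFun.ofFun {Ω.cl} (iteratedFDerivWithin ℝ k g.map Ω.cl) :
        UniformOnFun (PhaseSpace n) (PhaseSpace n [×k]→L[ℝ] PhaseSpace n) {Ω.cl}))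
      inferInstance) k)
  have h1 := h0.comp hf
  have h2 := (UniformOnFun.tendsto_iff_tendstoUniformlyOn.1 (h1.tendsto t₀)) Ω.cl rfl
  have h3 : ContinuousWithinAt (iteratedFDerivWithin ℝ k (f t₀).map Ω.cl) Ω.cl z₀ :=
    ((f t₀).contDiffOn_map.continuousOn_iteratedFDerivWithin (m := k) (by exact_mod_cast le_top)
      Ω.uniqueDiffOn) z₀ hz₀
  rw [ContinuousWithinAt, nhdsWithin_prod_eq, nhdsWithin_univ, Metric.tendsto_nhds]
  intro ε hε
  have h4 := Metric.tendstoUniformlyOn_iff.1 h2 (ε / 2) (half_pos hε)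
  have h5 := (Metric.tendsto_nhds.1 h3 (ε / 2) (half_pos hε)).and self_mem_nhdsWithin
  filter_upwards [h4.prod_mk h5] with p hp
  have h6 := hp.1 p.2 hp.2.2
  calc dist (iteratedFDerivWithin ℝ k (f p.1).map Ω.cl p.2) (iteratedFDerivWithin ℝ k (f t₀).map Ω.cl z₀)
      ≤ _ := dist_triangle _ (iteratedFDerivWithin ℝ k (f t₀).map Ω.cl p.2) _
    _ < ε / 2 + ε / 2 := add_lt_add (by rw [dist_comm]; exact h6) hp.2.1
    _ = ε := add_halves ε

theorem continuousOn_map {T : Type*} [TopologicalSpace T] {f : T → Symp Ω}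
    (hf : Continuous f) : ContinuousOn (fun p : T × PhaseSpace n => (f p.1).map p.2)
      (univ ×ˢ Ω.cl) := by
  have h1 := continuousOn_iteratedFDerivWithin_map hf 0
  have h2 : Continuous fun m : PhaseSpace n [×0]→L[ℝ] PhaseSpace n => m 0 := by fun_prop
  refine (h2.comp_continuousOn h1).congr fun p _ => ?_
  simp

/-- The Jacobian matrix of `g` at `z`. -/
def Symp.jac (g : Symp Ω) (z : PhaseSpace n) : Matrix (Fin n ⊕ Fin n) (Fin n ⊕ Fin n) ℝ :=
  LinearMap.toMatrix' (g.diff z : PhaseSpace n →ₗ[ℝ] PhaseSpace n)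

theorem Symp.jac_apply (g : Symp Ω) (z : PhaseSpace n) (i j : Fin n ⊕ Fin n) :
    g.jac z i j = g.diff z (Pi.single j 1) i := by
  rw [Symp.jac, LinearMap.toMatrix'_apply]
  rfl

theorem Symp.jac_mem (g : Symp Ω) {z : PhaseSpace n} (hz : z ∈ Ω.cl) :
    g.jac z ∈ Matrix.symplecticGroup (Fin n) ℝ := g.symplectic z hz

theorem Symp.coe_diffSp (g : Symp Ω) {z : PhaseSpace n} (hz : z ∈ Ω.cl) :
    (g.diffSp z).1 = g.jac z := by
  simp [Symp.diffSp, hz, Symp.jac]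

theorem continuousOn_jac {T : Type*} [TopologicalSpace T] {f : T → Symp Ω}
    (hf : Continuous f) : ContinuousOn (fun p : T × PhaseSpace n => (f p.1).jac p.2)
      (univ ×ˢ Ω.cl) := by
  have h1 := continuousOn_iteratedFDerivWithin_map hf 1
  refine continuousOn_pi.2 fun i => continuousOn_pi.2 fun j => ?_
  have h2 : Continuous fun m : PhaseSpace n [×1]→L[ℝ] PhaseSpace n => m (fun _ => Pi.single j 1) i := by
    fun_prop
  refine (h2.comp_continuousOn h1).congr fun p hp => ?_
  rw [Symp.jac_apply, Function.comp_apply, iteratedFDerivWithin_one_apply (Ω.uniqueDiffOn _ hp.2)]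
  rfl

/-- The continuous linear map of a matrix. -/
def matCLM : Matrix (Fin n ⊕ Fin n) (Fin n ⊕ Fin n) ℝ →ₗ[ℝ] (PhaseSpace n →L[ℝ] PhaseSpace n) :=
  (LinearMap.toContinuousLinearMap (𝕜 := ℝ) (E := PhaseSpace n) (F' := PhaseSpace n)).toLinearMap ∘ₗ
    Matrix.toLin'.toLinearMap

theorem matCLM_apply (M : Matrix (Fin n ⊕ Fin n) (Fin n ⊕ Fin n) ℝ) (v : PhaseSpace n) :
    matCLM M v = M *ᵥ v := rfl

theorem continuous_matCLM : Continuous (matCLM (n := n)) :=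
  LinearMap.continuous_of_finiteDimensional _

theorem matCLM_mul (M N : Matrix (Fin n ⊕ Fin n) (Fin n ⊕ Fin n) ℝ) :
    matCLM (M * N) = (matCLM M).comp (matCLM N) := by
  ext v i
  simp [matCLM_apply, Matrix.mulVec_mulVec]

theorem Symp.matCLM_jac (g : Symp Ω) (z : PhaseSpace n) : matCLM (g.jac z) = g.diff z := by
  ext1 v
  rw [matCLM_apply, ← Matrix.toLin'_apply, Symp.jac, Matrix.toLin'_toMatrix']
  rfl

theorem Symp.hasFDerivWithinAt_map (g : Symp Ω) {z : PhaseSpace n} (hz : z ∈ Ω.cl) :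
    HasFDerivWithinAt g.map (matCLM (g.jac z)) Ω.cl z := by
  rw [Symp.matCLM_jac]
  exact ((g.contDiffOn_map.differentiableOn (by simp)) z hz).hasFDerivWithinAt

/-- Symmetry holds up to the boundary because every point of the closure is a limit of interior
points. -/
theorem symm_secondDiff {H : PhaseSpace n → ℝ} (hH : ContDiffOn ℝ ∞ H Ω.cl) {z : PhaseSpace n}
    (hz : z ∈ Ω.cl) (u v : PhaseSpace n) : secondDiff Ω.cl H z u v = secondDiff Ω.cl H z v u := by
  have h1 : z ∈ closure (interior Ω.cl) :=
    closure_mono (interior_maximal subset_closure Ω.isOpen) hz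
  exact (hH z hz).isSymmSndFDerivWithinAt
    (by simpa using WithTop.coe_le_coe.2 (le_top : (2 : ℕ∞) ≤ ⊤)) Ω.uniqueDiffOn h1 hz u v

theorem secondDiff_eq_hessian (H : PhaseSpace n → ℝ) (z u v : PhaseSpace n) :
    secondDiff Ω.cl H z u v = u ⬝ᵥ (hessian Ω.cl H z *ᵥ v) := by
  have h1 : ∀ x : PhaseSpace n, x = ∑ i, x i • (Pi.single i (1 : ℝ) : PhaseSpace n) := fun x => by
    rw [← Finset.univ_sum_single x]
    refine Finset.sum_congr rfl fun i _ => ?_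
    rw [Finset.univ_sum_single, ← Pi.single_smul, smul_eq_mul, mul_one]
  conv_lhs => rw [h1 u, h1 v]
  simp only [map_sum, map_smul, sum_apply, smul_apply,
    dotProduct, Matrix.mulVec, hessian, Matrix.of_apply, smul_eq_mul, Finset.mul_sum]
  rw [Finset.sum_comm]
  refine Finset.sum_congr rfl fun i _ => Finset.sum_congr rfl fun j _ => by ring

theorem hessian_transpose {H : PhaseSpace n → ℝ} (hH : ContDiffOn ℝ ∞ H Ω.cl) {z : PhaseSpace n}
    (hz : z ∈ Ω.cl) : (hessian Ω.cl H z)ᵀ = hessian Ω.cl H z := by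
  ext i j
  exact symm_secondDiff hH hz _ _

theorem IsPosHamiltonian.posDef_hessian {H : PhaseSpace n → ℝ} (hH : IsPosHamiltonian Ω H)
    {z : PhaseSpace n} (hz : z ∈ Ω.cl) : (hessian Ω.cl H z).PosDef := by
  refine Matrix.PosDef.of_dotProduct_mulVec_pos ?_ fun v hv => ?_
  · rw [Matrix.IsHermitian, Matrix.conjTranspose_eq_transpose_of_trivial,
      hessian_transpose hH.1.1 hz]
  · have := hH.2 z hz v hv
    rw [secondDiff_eq_hessian] at this
    simpa using this

theorem hasFDerivWithinAt_hamVectorField {H : PhaseSpace n → ℝ} (hH : ContDiffOn ℝ ∞ H Ω.cl)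
    {z : PhaseSpace n} (hz : z ∈ Ω.cl) : HasFDerivWithinAt (hamVectorField Ω H)
      (matCLM (J₀ n * hessian Ω.cl H z)) Ω.cl z := by
  have h1 : DifferentiableOn ℝ (fderivWithin ℝ H Ω.cl) Ω.cl :=
    (hH.fderivWithin (m := 1) Ω.uniqueDiffOn (by norm_cast)).differentiableOn (by simp)
  have h2 : HasFDerivWithinAt (grad Ω.cl H) (matCLM (hessian Ω.cl H z)) Ω.cl z := by
    refine hasFDerivWithinAt_pi'.2 fun i => ?_
    have h3 := (h1 z hz).hasFDerivWithinAt.clm_apply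
      (hasFDerivWithinAt_const (Pi.single i (1 : ℝ) : PhaseSpace n) z Ω.cl)
    refine h3.congr_fderiv ?_
    ext1 v
    have h4 := secondDiff_eq_hessian (Ω := Ω) H z (Pi.single i 1) v
    rw [single_one_dotProduct, symm_secondDiff hH hz] at h4
    simpa [matCLM_apply, secondDiff] using h4
  have h5 := (matCLM (J₀ n)).hasFDerivAt.comp_hasFDerivWithinAt z h2
  rw [matCLM_mul]
  exact h5

end ConvexSymp
end

noncomputable section

namespace ConvexSymp

/-! ### The linearized equation -/

variable {n : ℕ} {Ω : UniformlyConvexDomain n}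

/-! ### Differentiating a flow with respect to the initial point -/

section Parametric

variable {E F G : Type*} [NormedAddCommGroup E] [NormedAddCommGroup F] [NormedAddCommGroup G]
  {K U : Set E}

theorem continuousOn_slice_left {f : ℝ → E → G}
    (hf : ContinuousOn (Function.uncurry f) (Icc 0 1 ×ˢ K)) {z : E} (hz : z ∈ K) :
    ContinuousOn (fun t => f t z) (Icc 0 1) :=
  hf.comp (f := fun t : ℝ => (t, z)) (by fun_prop) fun _ ht => ⟨ht, hz⟩

theorem continuousOn_slice_right {f : ℝ → E → G}
    (hf : ContinuousOn (Function.uncurry f) (Icc 0 1 ×ˢ K)) {t : ℝ} (ht : t ∈ Icc (0 : ℝ) 1) :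
    ContinuousOn (f t) K :=
  hf.comp (f := fun z : E => (t, z)) (by fun_prop) fun _ hz => ⟨ht, hz⟩

theorem uIoc_zero_subset {t : ℝ} (ht : t ∈ Icc (0 : ℝ) 1) : uIoc 0 t ⊆ Icc 0 1 := by
  rw [uIoc_of_le ht.1]
  exact fun x hx => ⟨hx.1.le, hx.2.trans ht.2⟩

theorem uIcc_zero_subset {t : ℝ} (ht : t ∈ Icc (0 : ℝ) 1) : uIcc 0 t ⊆ Icc 0 1 := by
  rw [uIcc_of_le ht.1]
  exact Icc_subset_Icc le_rfl ht.2

theorem aestronglyMeasurable_slice {f : ℝ → E → G}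
    (hf : ContinuousOn (Function.uncurry f) (Icc 0 1 ×ˢ K)) {z : E} (hz : z ∈ K) {t : ℝ}
    (ht : t ∈ Icc (0 : ℝ) 1) :
    AEStronglyMeasurable (fun τ => f τ z) (volume.restrict (uIoc 0 t)) :=
  ((continuousOn_slice_left hf hz).mono (uIoc_zero_subset ht)).aestronglyMeasurable
    measurableSet_uIoc

theorem exists_norm_le_of_continuousOn (hK : IsCompact K) {f : ℝ → E → G}
    (hf : ContinuousOn (Function.uncurry f) (Icc 0 1 ×ˢ K)) :
    ∃ C, ∀ t ∈ Icc (0 : ℝ) 1, ∀ z ∈ K, ‖f t z‖ ≤ C := by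
  obtain ⟨C, hC⟩ := (isCompact_Icc.prod hK).exists_bound_of_continuousOn hf
  exact ⟨C, fun t ht z hz => hC (t, z) ⟨ht, hz⟩⟩

theorem continuousOn_integral_slice [NormedSpace ℝ G] (hK : IsCompact K) {f : ℝ → E → G}
    (hf : ContinuousOn (Function.uncurry f) (Icc 0 1 ×ˢ K)) {t : ℝ} (ht : t ∈ Icc (0 : ℝ) 1) :
    ContinuousOn (fun z => ∫ τ in (0 : ℝ)..t, f τ z) K := by
  obtain ⟨C, hC⟩ := exists_norm_le_of_continuousOn hK hf
  intro z hz
  refine intervalIntegral.continuousWithinAt_of_dominated_interval (bound := fun _ => C) ?_ ?_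
    intervalIntegrable_const ?_
  · filter_upwards [self_mem_nhdsWithin] with y hy using aestronglyMeasurable_slice hf hy ht
  · filter_upwards [self_mem_nhdsWithin] with y hy
    exact Eventually.of_forall fun τ hτ => hC τ (uIoc_zero_subset ht hτ) y hy
  · exact Eventually.of_forall fun τ hτ =>
      continuousOn_slice_right hf (uIoc_zero_subset ht hτ) z hz

/-- The space derivatives of the solutions of an ordinary differential equation satisfy the
linearized equation, up to the boundary of a domain. -/
theorem hasDerivWithinAt_fderiv_of_flow [NormedSpace ℝ E] [NormedSpace ℝ F] [CompleteSpace F]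
    (hK : IsCompact K) (hU : IsOpen U) (hUK : U ⊆ K) (hKU : K ⊆ closure U) {Φ Y : ℝ → E → F} {D C : ℝ → E → E →L[ℝ] F}
    (hY : ContinuousOn (Function.uncurry Y) (Icc 0 1 ×ˢ K))
    (hD : ContinuousOn (Function.uncurry D) (Icc 0 1 ×ˢ K))
    (hC : ContinuousOn (Function.uncurry C) (Icc 0 1 ×ˢ K))
    (hΦ : ∀ t ∈ Icc (0 : ℝ) 1, ∀ z ∈ U, HasDerivWithinAt (fun t => Φ t z) (Y t z) (Icc 0 1) t)
    (hΦD : ∀ t ∈ Icc (0 : ℝ) 1, ∀ z ∈ U, HasFDerivAt (Φ t) (D t z) z)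
    (hYC : ∀ t ∈ Icc (0 : ℝ) 1, ∀ z ∈ U, HasFDerivAt (Y t) (C t z) z)
    {t : ℝ} (ht : t ∈ Icc (0 : ℝ) 1) {z : E} (hz : z ∈ K) :
    HasDerivWithinAt (fun t => D t z) (C t z) (Icc 0 1) t := by
  have h0 : (0 : ℝ) ∈ Icc (0 : ℝ) 1 := ⟨le_rfl, zero_le_one⟩
  obtain ⟨M, hM⟩ := exists_norm_le_of_continuousOn hK hC
  have h1 : ∀ t ∈ Icc (0 : ℝ) 1, ∀ z ∈ U, Φ t z = Φ 0 z + ∫ τ in (0 : ℝ)..t, Y τ z := by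
    intro t ht z hz
    rw [intervalIntegral.integral_eq_sub_of_hasDeriv_right
      (f := fun t => Φ t z) (f' := fun t => Y t z)]
    · abel
    · exact fun τ hτ => ((hΦ τ (uIcc_zero_subset ht hτ) z hz).continuousWithinAt).mono
        (uIcc_zero_subset ht)
    · intro τ hτ
      rw [min_eq_left ht.1, max_eq_right ht.1] at hτ
      have hτ' : τ ∈ Ioo (0 : ℝ) 1 := ⟨hτ.1, hτ.2.trans_le ht.2⟩
      exact ((hΦ τ (Ioo_subset_Icc_self hτ') z hz).hasDerivAt
        (Icc_mem_nhds hτ'.1 hτ'.2)).hasDerivWithinAt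
    · exact ((continuousOn_slice_left hY (hUK hz)).mono (uIcc_zero_subset ht)).intervalIntegrable
  -- The integrated equation `h1` is differentiated in `z` under the integral sign, which is
  -- possible at points of the open set `U`.
  have h2 : ∀ t ∈ Icc (0 : ℝ) 1, ∀ z ∈ U, D t z = D 0 z + ∫ τ in (0 : ℝ)..t, C τ z := by
    intro t ht z hz
    refine (hΦD t ht z hz).unique ?_
    have h3 : HasFDerivAt (fun z => ∫ τ in (0 : ℝ)..t, Y τ z) (∫ τ in (0 : ℝ)..t, C τ z) z := by
      refine intervalIntegral.hasFDerivAt_integral_of_dominated_of_fderiv_le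
        (bound := fun _ => M) (F := fun z τ => Y τ z) (F' := fun z τ => C τ z) (hU.mem_nhds hz)
        ?_ ?_ ?_ ?_ intervalIntegrable_const ?_
      · filter_upwards [hU.mem_nhds hz] with y hy using aestronglyMeasurable_slice hY (hUK hy) ht
      · exact ((continuousOn_slice_left hY (hUK hz)).mono (uIcc_zero_subset ht)).intervalIntegrable
      · exact aestronglyMeasurable_slice hC (hUK hz) ht
      · exact Eventually.of_forall fun τ hτ y hy => hM τ (uIoc_zero_subset ht hτ) y (hUK hy)
      · exact Eventually.of_forall fun τ hτ y hy => hYC τ (uIoc_zero_subset ht hτ) y hy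
    refine ((hΦD 0 h0 z hz).add h3).congr_of_eventuallyEq ?_
    filter_upwards [hU.mem_nhds hz] with y hy using h1 t ht y hy
  -- Both sides are continuous on `K`, and `U` is dense in it.
  have h4 : ∀ t ∈ Icc (0 : ℝ) 1, ∀ z ∈ K, D t z = D 0 z + ∫ τ in (0 : ℝ)..t, C τ z := by
    intro t ht
    exact EqOn.of_subset_closure (h2 t ht) (continuousOn_slice_right hD ht)
      ((continuousOn_slice_right hD h0).add (continuousOn_integral_slice hK hC ht)) hUK hKU
  -- Selects the one-sided form of the fundamental theorem of calculus relative to `Icc 0 1`, valid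
  -- at the end times too.
  have _ : Fact (t ∈ Icc (0 : ℝ) 1) := ⟨ht⟩
  have hc := continuousOn_slice_left hC hz
  have h5 : HasDerivWithinAt (fun t => ∫ τ in (0 : ℝ)..t, C τ z) (C t z) (Icc 0 1) t :=
    intervalIntegral.integral_hasDerivWithinAt_right (hc.mono (uIcc_zero_subset ht)).intervalIntegrable
      (hc.stronglyMeasurableAtFilter_nhdsWithin measurableSet_Icc t) (hc t ht)
  exact (h5.const_add (D 0 z)).congr (fun t ht => h4 t ht z hz) (h4 t ht z hz)

end Parametric

variable {g₀ g₁ : Symp₀ Ω} {H : ℝ → PhaseSpace n → ℝ} {φ : Path g₀ g₁}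

theorem hasDerivWithinAt_of_matCLM {w : ℝ → Matrix (Fin n ⊕ Fin n) (Fin n ⊕ Fin n) ℝ}
    {w' : Matrix (Fin n ⊕ Fin n) (Fin n ⊕ Fin n) ℝ} {s : Set ℝ} {t : ℝ}
    (h : HasDerivWithinAt (fun t => matCLM (w t)) (matCLM w') s t) :
    HasDerivWithinAt w w' s t := by
  let _ := Matrix.linftyOpNormedRing (n := Fin n ⊕ Fin n) (α := ℝ)
  let _ := Matrix.linftyOpNormedAlgebra (n := Fin n ⊕ Fin n) (α := ℝ) (R := ℝ)
  let L : (PhaseSpace n →L[ℝ] PhaseSpace n) →ₗ[ℝ] Matrix (Fin n ⊕ Fin n) (Fin n ⊕ Fin n) ℝ :=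
    LinearMap.toMatrix'.toLinearMap ∘ₗ ContinuousLinearMap.coeLM ℝ
  have hL : ∀ M, L (matCLM M) = M := fun M => LinearMap.toMatrix'_toLin' M
  have h1 := (LinearMap.toContinuousLinearMap L).hasFDerivAt.comp_hasDerivWithinAt t h
  exact (h1.congr_deriv (hL w')).congr (fun x _ => (hL _).symm) (hL _).symm

theorem continuousOn_matrix_mul {T m : Type*} [TopologicalSpace T] [Fintype m]
    {A B : T → Matrix m m ℝ} {s : Set T} (hA : ContinuousOn A s) (hB : ContinuousOn B s) :
    ContinuousOn (fun t => A t * B t) s :=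
  (continuous_fst.matrix_mul continuous_snd).comp_continuousOn (hA.prodMk hB)

theorem Symp.jac_id {z : PhaseSpace n} (hz : z ∈ Ω.cl) : (Symp.id Ω).jac z = 1 := by
  have h : (Symp.id Ω).map = id := extendMap_id _
  rw [Symp.jac, Symp.diff, h, fderivWithin_id (Ω.uniqueDiffOn z hz)]
  exact LinearMap.toMatrix'_id

theorem continuous_extend_val (φ : Path g₀ g₁) : Continuous fun t => (φ.extend t).1 :=
  continuous_subtype_val.comp φ.continuous_extend

namespace PositivelyGenerates

theorem continuousOn_hessian (hH : PositivelyGenerates H φ) : ContinuousOn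
    (fun p : ℝ × PhaseSpace n => hessian Ω.cl (H p.1) p.2) (Icc 0 1 ×ˢ Ω.cl) := by
  refine continuousOn_pi.2 fun i => continuousOn_pi.2 fun j => ?_
  have h2 : Continuous fun m : PhaseSpace n [×2]→L[ℝ] ℝ =>
      m ![Pi.single i 1, Pi.single j 1] := by fun_prop
  refine (h2.comp_continuousOn (hH.continuousOn 2)).congr fun p hp => ?_
  rw [Function.comp_apply, iteratedFDerivWithin_two_apply _ Ω.uniqueDiffOn hp.2]
  rfl

theorem continuousOn_hamVectorField (hH : PositivelyGenerates H φ) : ContinuousOn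
    (fun p : ℝ × PhaseSpace n => hamVectorField Ω (H p.1) p.2) (Icc 0 1 ×ˢ Ω.cl) := by
  have h1 : ContinuousOn (fun p : ℝ × PhaseSpace n => grad Ω.cl (H p.1) p.2)
      (Icc 0 1 ×ˢ Ω.cl) := by
    refine continuousOn_pi.2 fun i => ?_
    have h2 : Continuous fun m : PhaseSpace n [×1]→L[ℝ] ℝ => m fun _ => Pi.single i 1 := by
      fun_prop
    refine (h2.comp_continuousOn (hH.continuousOn 1)).congr fun p hp => ?_
    rw [Function.comp_apply, iteratedFDerivWithin_one_apply (Ω.uniqueDiffOn _ hp.2)]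
    rfl
  exact (matCLM (J₀ n)).continuous.comp_continuousOn h1

theorem continuousOn_flow (φ : Path g₀ g₁) : ContinuousOn
    (fun p : ℝ × PhaseSpace n => (p.1, (φ.extend p.1).1.map p.2)) (Icc 0 1 ×ˢ Ω.cl) :=
  continuousOn_fst.prodMk
    ((continuousOn_map (continuous_extend_val φ)).mono (prod_mono (subset_univ _) subset_rfl))

theorem mapsTo_flow (φ : Path g₀ g₁) : MapsTo
    (fun p : ℝ × PhaseSpace n => (p.1, (φ.extend p.1).1.map p.2)) (Icc 0 1 ×ˢ Ω.cl)
      (Icc 0 1 ×ˢ Ω.cl) :=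
  fun _ hp => ⟨hp.1, Symp.map_mem _ hp.2⟩

theorem continuousOn_hessian_flow (hH : PositivelyGenerates H φ) : ContinuousOn
    (fun p : ℝ × PhaseSpace n => hessian Ω.cl (H p.1) ((φ.extend p.1).1.map p.2))
      (Icc 0 1 ×ˢ Ω.cl) :=
  ContinuousOn.comp (g := fun p : ℝ × PhaseSpace n => hessian Ω.cl (H p.1) p.2)
    (f := fun p : ℝ × PhaseSpace n => (p.1, (φ.extend p.1).1.map p.2))
    hH.continuousOn_hessian (continuousOn_flow φ) (mapsTo_flow φ)

theorem hasDerivWithinAt_jac (hH : PositivelyGenerates H φ) {t : ℝ} (ht : t ∈ Icc (0 : ℝ) 1)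
    {z : PhaseSpace n} (hz : z ∈ Ω.cl) : HasDerivWithinAt (fun t => (φ.extend t).1.jac z)
      (J₀ n * hessian Ω.cl (H t) ((φ.extend t).1.map z) * (φ.extend t).1.jac z) (Icc 0 1) t := by
  have hj : ContinuousOn (fun p : ℝ × PhaseSpace n => (φ.extend p.1).1.jac p.2)
      (Icc 0 1 ×ˢ Ω.cl) :=
    (continuousOn_jac (continuous_extend_val φ)).mono (prod_mono (subset_univ _) subset_rfl)
  have hnhds : ∀ z ∈ Ω.carrier, Ω.cl ∈ 𝓝 z := fun z hz =>
    mem_of_superset (Ω.isOpen.mem_nhds hz) subset_closure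
  have key := hasDerivWithinAt_fderiv_of_flow Ω.isCompact_cl Ω.isOpen subset_closure subset_rfl
    (Φ := fun t z => (φ.extend t).1.map z)
    (Y := fun t z => hamVectorField Ω (H t) ((φ.extend t).1.map z))
    (D := fun t z => matCLM ((φ.extend t).1.jac z))
    (C := fun t z => matCLM
      (J₀ n * hessian Ω.cl (H t) ((φ.extend t).1.map z) * (φ.extend t).1.jac z))
    (ContinuousOn.comp (g := fun p : ℝ × PhaseSpace n => hamVectorField Ω (H p.1) p.2)
      (f := fun p : ℝ × PhaseSpace n => (p.1, (φ.extend p.1).1.map p.2))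
      hH.continuousOn_hamVectorField (continuousOn_flow φ) (mapsTo_flow φ))
    (continuous_matCLM.comp_continuousOn hj)
    (continuous_matCLM.comp_continuousOn
      (continuousOn_matrix_mul (continuousOn_matrix_mul continuousOn_const
        hH.continuousOn_hessian_flow) hj))
    (fun t ht z hz => hH.hasDerivWithinAt t ht z (subset_closure hz))
    (fun t ht z hz => ((φ.extend t).1.hasFDerivWithinAt_map (subset_closure hz)).hasFDerivAt
      (hnhds z hz))
    (fun t ht z hz => by
      have h1 := (φ.extend t).1.hasFDerivWithinAt_map (subset_closure hz : z ∈ Ω.cl)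
      have h2 := hasFDerivWithinAt_hamVectorField (hH.pos t ht).1.1
        ((φ.extend t).1.map_mem (subset_closure hz : z ∈ Ω.cl))
      have h3 := h2.comp z h1 fun y hy => (φ.extend t).1.map_mem hy
      rw [← matCLM_mul] at h3
      exact h3.hasFDerivAt (hnhds z hz)) ht hz
  exact hasDerivWithinAt_of_matCLM key

theorem isPositiveLinearPath {g : Symp₀ Ω} {φ : Path (Symp₀.id Ω) g}
    (hH : PositivelyGenerates H φ) {z : PhaseSpace n} (hz : z ∈ Ω.cl) :
    IsPositiveLinearPath (fun t => (φ.extend t).1.jac z)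
      (fun t => hessian Ω.cl (H t) ((φ.extend t).1.map z)) where
  symplectic t _ := Symp.jac_mem _ hz
  zero := by
    rw [φ.extend_zero]
    exact Symp.jac_id hz
  hasDerivWithinAt t ht := hH.hasDerivWithinAt_jac ht hz
  posDef t ht := (hH.pos t ht).posDef_hessian (Symp.map_mem _ hz)

theorem continuousOn_generator (hH : PositivelyGenerates H φ) {z : PhaseSpace n} (hz : z ∈ Ω.cl) :
    ContinuousOn (fun t => hessian Ω.cl (H t) ((φ.extend t).1.map z)) (Icc 0 1) :=
  hH.continuousOn_hessian_flow.comp (f := fun t : ℝ => (t, z)) (by fun_prop) fun _ ht => ⟨ht, hz⟩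

end PositivelyGenerates

end ConvexSymp
end

noncomputable section

namespace ConvexSymp

variable {n : ℕ} {Ω : UniformlyConvexDomain n}

/-! ### The length as an average over the trajectories -/

theorem UniformlyConvexDomain.setIntegral_cl (Ω : UniformlyConvexDomain n)
    (f : PhaseSpace n → ℝ) : ∫ z in Ω.cl, f z = ∫ z in Ω.carrier, f z := by
  refine setIntegral_congr_set ?_
  have h := Ω.convex.addHaar_frontier volume
  rw [frontier, Ω.isOpen.interior_eq] at h
  exact (ae_le_set.2 h).antisymm (LE.le.eventuallyLE subset_closure)

theorem Symp.image_map_cl (g : Symp Ω) : g.map '' Ω.cl = Ω.cl := by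
  refine Subset.antisymm (image_subset_iff.2 fun z hz => g.map_mem hz) fun w hw => ?_
  refine ⟨g.toEquiv.symm ⟨w, hw⟩, Subtype.coe_prop _, ?_⟩
  simp [Symp.map, extendMap]

theorem Symp.injOn_map (g : Symp Ω) : InjOn g.map Ω.cl := by
  intro z hz w hw h
  have h1 : g.toEquiv ⟨z, hz⟩ = g.toEquiv ⟨w, hw⟩ :=
    Subtype.ext (by simpa [Symp.map, extendMap, hz, hw] using h)
  exact congrArg Subtype.val (g.toEquiv.injective h1)

/-- The change of variables is made on the closure, which the map permutes with Jacobian determinant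
`1`; the boundary of a convex set is negligible. -/
theorem Symp.setIntegral_comp_map (g : Symp Ω) (f : PhaseSpace n → ℝ) :
    ∫ z in Ω.carrier, f (g.map z) = ∫ z in Ω.carrier, f z := by
  rw [← Ω.setIntegral_cl, ← Ω.setIntegral_cl]
  have h := integral_image_eq_integral_abs_det_fderiv_smul volume Ω.isCompact_cl.measurableSet
    (fun z hz => g.hasFDerivWithinAt_map hz) g.injOn_map f
  rw [g.image_map_cl] at h
  rw [h]
  refine setIntegral_congr_fun Ω.isCompact_cl.measurableSet fun z hz => ?_
  have h1 : (matCLM (g.jac z)).det = 1 := by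
    have h2 : (matCLM (g.jac z)).det = LinearMap.det (Matrix.toLin' (g.jac z)) := rfl
    rw [h2, LinearMap.det_toLin', SymplecticGroup.det_eq_one (g.jac_mem hz)]
  simp [h1]

variable {g₀ g₁ : Symp₀ Ω} {H : ℝ → PhaseSpace n → ℝ} {φ : Path g₀ g₁}

theorem integral_integral_swap_of_continuousOn {f : ℝ → PhaseSpace n → ℝ}
    (hf : ContinuousOn (Function.uncurry f) (Icc 0 1 ×ˢ Ω.cl)) :
    ∫ t in (0 : ℝ)..1, ∫ z in Ω.carrier, f t z = ∫ z in Ω.carrier, ∫ t in (0 : ℝ)..1, f t z := by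
  refine intervalIntegral_integral_swap ?_
  rw [Measure.prod_restrict]
  exact (hf.integrableOn_compact (isCompact_Icc.prod Ω.isCompact_cl)).mono_set
    (prod_mono (uIoc_zero_subset ⟨zero_le_one, le_rfl⟩) subset_closure)

namespace PositivelyGenerates

theorem continuousOn_det_hessian_flow (hH : PositivelyGenerates H φ) : ContinuousOn
    (Function.uncurry fun t z =>
      (hessian Ω.cl (H t) ((φ.extend t).1.map z)).det ^ (1 / (2 * (n : ℝ))))
      (Icc 0 1 ×ˢ Ω.cl) :=
  ((Continuous.matrix_det continuous_id).comp_continuousOn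
    hH.continuousOn_hessian_flow).rpow_const fun _ _ => Or.inr (by positivity)

/-- Volume preservation evaluates each Hessian at the moving point, and Fubini then gives a mean
over trajectories. -/
theorem length𝓖_eq_integral (hH : PositivelyGenerates H φ) :
    length𝓖 φ = (volume.real Ω.carrier)⁻¹ * ∫ z in Ω.carrier, ∫ t in (0 : ℝ)..1,
      (hessian Ω.cl (H t) ((φ.extend t).1.map z)).det ^ (1 / (2 * (n : ℝ))) := by
  have h := integral_integral_swap_of_continuousOn (f := fun t z =>
      (hessian Ω.cl (H t) ((φ.extend t).1.map z)).det ^ (1 / (2 * (n : ℝ))))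
    hH.continuousOn_det_hessian_flow
  rw [length𝓖_eq hH, ← h, ← intervalIntegral.integral_const_mul]
  refine intervalIntegral.integral_congr fun t _ => ?_
  have h2 := (φ.extend t).1.setIntegral_comp_map fun z =>
    (hessian Ω.cl (H t) z).det ^ (1 / (2 * (n : ℝ)))
  simp only [𝓖, h2]

end PositivelyGenerates

/-! ### The averaged quasimorphism -/

/-- Two lifts differ by a continuous integer-valued function on a connected interval that vanishes
at `0`, so the chosen lift agrees with `θ`. -/
theorem maslov_eq {w : I → Sp n} (θ : C(I, ℝ)) (h0 : θ 0 = 0)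
    (h : ∀ t, upsilon (w t) = Complex.exp (2 * Real.pi * Complex.I * θ t)) : maslov w = θ 1 := by
  have hex : ∃ θ : C(I, ℝ), θ 0 = 0 ∧
      ∀ t, upsilon (w t) = Complex.exp (2 * Real.pi * Complex.I * θ t) := ⟨θ, h0, h⟩
  rw [maslov, dif_pos hex]
  obtain ⟨hρ0, hρ⟩ := hex.choose_spec
  set ρ := hex.choose
  have h1 : ∀ t, ∃ k : ℤ, (k : ℝ) = ρ t - θ t := fun t => by
    obtain ⟨k, hk⟩ := Complex.exp_eq_exp_iff_exists_int.1 ((hρ t).symm.trans (h t))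
    refine ⟨k, ?_⟩
    have h2 : (2 * Real.pi * Complex.I) * (ρ t : ℂ) = (2 * Real.pi * Complex.I) * (θ t + k) := by
      rw [hk]; ring
    have h3 := mul_left_cancel₀ Complex.two_pi_I_ne_zero h2
    have h4 : ρ t = θ t + k := by exact_mod_cast h3
    rw [h4]; ring
  choose k hk using h1
  have hkc : Continuous k := by
    rw [Int.isClosedEmbedding_coe_real.isEmbedding.continuous_iff]
    exact (ρ.continuous.sub θ.continuous).congr fun t => (hk t).symm
  have h5 := PreconnectedSpace.constant inferInstance hkc (x := 1) (y := 0)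
  have h6 := hk 1
  rw [h5, hk 0, hρ0, h0] at h6
  linarith

theorem hasEigenvalue_neg_one_iff (g : Symp Ω) (z : PhaseSpace n) :
    Module.End.HasEigenvalue (g.diff z : PhaseSpace n →ₗ[ℝ] PhaseSpace n) (-1) ↔
      (g.jac z + 1).det = 0 := by
  rw [← Matrix.exists_mulVec_eq_zero_iff]
  have h1 : ∀ v, (g.jac z + 1) *ᵥ v = g.diff z v + v := fun v => by
    rw [Matrix.add_mulVec, Matrix.one_mulVec, ← matCLM_apply, Symp.matCLM_jac]
  constructor
  · intro h
    obtain ⟨v, hv⟩ := h.exists_hasEigenvector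
    refine ⟨v, hv.2, ?_⟩
    rw [h1, show g.diff z v = (-1 : ℝ) • v from hv.apply_eq_smul]
    simp
  · rintro ⟨v, hv, h⟩
    refine Module.End.hasEigenvalue_of_hasEigenvector (x := v)
      ⟨Module.End.mem_eigenspace_iff.2 ?_, hv⟩
    rw [h1] at h
    rw [neg_one_smul]
    exact eq_neg_of_add_eq_zero_left h

theorem noEigenvalueNegOne_iff : NoEigenvalueNegOne φ ↔
    ∀ t ∈ Icc (0 : ℝ) 1, ∀ z ∈ Ω.cl, ((φ.extend t).1.jac z + 1).det ≠ 0 := by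
  constructor
  · intro h t ht z hz
    rw [φ.extend_apply ht]
    exact fun h1 => h ⟨t, ht⟩ z hz ((hasEigenvalue_neg_one_iff _ z).2 h1)
  · intro h t z hz h1
    have h2 := h t t.2 z hz
    rw [φ.extend_extends'] at h2
    exact h2 ((hasEigenvalue_neg_one_iff _ z).1 h1)

section Endpoint

variable {g : Symp₀ Ω} {φ : Path (Symp₀.id Ω) g}

theorem PositivelyGenerates.isElliptic_jac (hH : PositivelyGenerates H φ)
    (hφ : NoEigenvalueNegOne φ) {t : ℝ} (ht : t ∈ Icc (0 : ℝ) 1) {z : PhaseSpace n}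
    (hz : z ∈ Ω.cl) : IsElliptic ((φ.extend t).1.jac z) :=
  (hH.isPositiveLinearPath hz).isElliptic
    (fun t ht => noEigenvalueNegOne_iff.1 hφ t ht z hz) ht

/-- `rot` along the path is itself the continuous lift, so only the end map enters the value. -/
theorem PositivelyGenerates.maslov_diffSp (hH : PositivelyGenerates H φ)
    (hφ : NoEigenvalueNegOne φ) {z : PhaseSpace n} (hz : z ∈ Ω.cl) :
    maslov (fun t => (φ t).1.diffSp z) = rot (g.1.jac z) := by
  have hell : ∀ t : I, IsElliptic ((φ t).1.jac z) := fun t => by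
    have := hH.isElliptic_jac hφ t.2 hz
    rwa [φ.extend_extends'] at this
  have hc : Continuous fun t : I => (φ t).1.jac z := by
    have h1 : Continuous fun t : I => (φ t).1 := continuous_subtype_val.comp φ.continuous
    rw [← continuousOn_univ]
    exact ContinuousOn.comp (f := fun t : I => (t, z)) (continuousOn_jac h1) (by fun_prop)
      fun _ _ => ⟨mem_univ _, hz⟩
  have hθ : Continuous fun t : I => rot ((φ t).1.jac z) :=
    continuousOn_rot.comp_continuous hc hell
  have h := maslov_eq (w := fun t => (φ t).1.diffSp z) ⟨_, hθ⟩ ?_ fun t => ?_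
  · rw [h]
    simp
  · change rot ((φ 0).1.jac z) = 0
    rw [φ.source]
    exact (congrArg rot (Symp.jac_id hz)).trans rot_one
  · have h2 : ((φ t).1.diffSp z).1 = (φ t).1.jac z := Symp.coe_diffSp _ hz
    rw [upsilon_eq_exp_rot (h2 ▸ hell t), h2]
    rfl

theorem PositivelyGenerates.𝓜_eq (hH : PositivelyGenerates H φ) (hφ : NoEigenvalueNegOne φ) :
    𝓜 φ = (volume.real Ω.carrier)⁻¹ * ∫ z in Ω.carrier, rot (g.1.jac z) := by
  rw [𝓜]
  congr 1
  exact setIntegral_congr_fun Ω.isOpen.measurableSet fun z hz =>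
    hH.maslov_diffSp hφ (subset_closure hz)

theorem PositivelyGenerates.continuousOn_rot_jac (hH : PositivelyGenerates H φ)
    (hφ : NoEigenvalueNegOne φ) : ContinuousOn (fun z => rot (g.1.jac z)) Ω.cl := by
  refine continuousOn_rot.comp ?_ fun z hz => ?_
  · exact ContinuousOn.comp (f := fun z => ((), z))
      (continuousOn_jac (continuous_const (y := g.1))) (by fun_prop) fun z hz => ⟨mem_univ _, hz⟩
  · have := hH.isElliptic_jac hφ (t := 1) ⟨zero_le_one, le_rfl⟩ hz
    rwa [φ.extend_one] at this

/-- For each `z`, the differentials of the homotopy form a continuous square of symplectic matrices.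
Fixed ends make the side `t = 1` constant, equal to the differential of the end map of `φ`. -/
theorem PositivelyGenerates.noEigenvalueNegOne_of_homotopic {ψ : Path (Symp₀.id Ω) g}
    (hψ : PositivelyGenerates H ψ) (hφ : NoEigenvalueNegOne φ) (hom : ψ.Homotopic φ) :
    NoEigenvalueNegOne ψ := by
  obtain ⟨F⟩ := hom
  rw [noEigenvalueNegOne_iff] at hφ ⊢
  intro t ht z hz
  set p : ℝ → I := projIcc 0 1 zero_le_one
  have hp : Continuous p := continuous_projIcc
  have hp0 : p 0 = 0 := projIcc_left _
  have hp1 : p 1 = 1 := projIcc_right _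
  have hF : Continuous fun q : ℝ × ℝ => (F (p q.1, p q.2)).1 :=
    continuous_subtype_val.comp (F.continuous.comp (by fun_prop))
  refine (hψ.isPositiveLinearPath hz).det_add_one_ne_zero
    (H := fun s t => (F (p s, p t)).1.jac z) ?_ ?_ ?_ ?_ ?_ ?_ ht
  · rw [← continuousOn_univ]
    exact ContinuousOn.comp (f := fun q : ℝ × ℝ => (q, z)) (continuousOn_jac hF) (by fun_prop)
      fun _ _ => ⟨mem_univ _, hz⟩
  · exact fun s t => Symp.jac_mem _ hz
  · intro s
    simp only [hp0, F.source]
    exact Symp.jac_id hz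
  · intro t ht
    simp only [hp0, F.apply_zero]
    rfl
  · intro s _
    simp only [hp1, F.target]
    have := hφ 1 ⟨zero_le_one, le_rfl⟩ z hz
    rwa [φ.extend_one] at this
  · intro t ht
    simp only [hp1, F.apply_one]
    exact hφ t ht z hz

end Endpoint

end ConvexSymp
end

/-! ### The main theorem -/

theorem mainTheorem9 (n : ℕ) (hn : 1 ≤ n) (Ω : UniformlyConvexDomain n) (g : Symp₀ Ω)
    (φ : Path (Symp₀.id Ω) g) (hφ : IsPositivePath φ) (hφ' : NoEigenvalueNegOne φ)
    (ψ : Path (Symp₀.id Ω) g) (hψ : IsPositivePath ψ) (hom : ψ.Homotopic φ) :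
    NoEigenvalueNegOne ψ ∧ length𝓖 ψ ≤ 2 * Real.pi / n * 𝓜 φ := by
  obtain ⟨K, hK⟩ := hφ
  obtain ⟨H, hH⟩ := hψ
  have hψ' : NoEigenvalueNegOne ψ := hH.noEigenvalueNegOne_of_homotopic hφ' hom
  refine ⟨hψ', ?_⟩
  -- `𝓜 φ` is the mean of `rot` of the differential of the end map `g`, which `φ` and `ψ` share; it
  -- suffices to compare the integrands at each `z` along `ψ`.
  rw [hH.length𝓖_eq_integral, hK.𝓜_eq hφ', mul_left_comm, ← integral_const_mul (2 * Real.pi / (n : ℝ))]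
  refine mul_le_mul_of_nonneg_left ?_ (inv_nonneg.2 measureReal_nonneg)
  refine setIntegral_mono_on
    (((continuousOn_integral_slice Ω.isCompact_cl hH.continuousOn_det_hessian_flow
      ⟨zero_le_one, le_rfl⟩).integrableOn_compact
      Ω.isCompact_cl).mono_set subset_closure)
    ((((hK.continuousOn_rot_jac hφ').integrableOn_compact Ω.isCompact_cl).mono_set
      subset_closure).const_mul _) Ω.isOpen.measurableSet fun z hz => ?_
  have hz' : z ∈ Ω.cl := subset_closure hz
  have h := (hH.isPositiveLinearPath hz').integral_le_rot hn (hH.continuousOn_generator hz')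
    fun t ht => noEigenvalueNegOne_iff.1 hψ' t ht z hz'
  rwa [ψ.extend_one] at h
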